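/- A (Čech) closure space is a set $X$ with an operation $c:\mathcal P(X)\to\mathcal P(X)$ such that $c(\emptyset)=\emptyset$, $A\subseteq c(A)$ and $c(A\cup B)=c(A)\cup c(B)$; its interior is $i(A)=X\setminus c(X\setminus A)$. A map $f$ is continuous if $f(c(A))\subseteq c(f(A))$ for all $A$. A subset $A\subseteq X$ carries the closure $B\mapsto c(B)\cap A$, and products carry the product closure $\times$ (finite intersections of preimages of neighborhoods of the coordinates form local bases). A pair $(X,A)$ is a closure space $X$ with a subspace $A\subseteq X$; a map of pairs $(X,A)\to(Y,B)$ is a continuous $f:X\to Y$ with $f(A)\subseteq B$. Let $J$ be one of $I=[0,1]$ with its usual topology, $J_1=\{0,1\}$ with the indiscrete closure, or $J_+=\{0,1\}$ with $c(\{0\})=\{0,1\}$, $c(\{1\})=\{1\}$. Two maps $f,g:(X,A)\to(Y,B)$ are one-step $(J,\times)$-homotopic if there is a continuous $h:X\times J\to Y$ with $h(-,0)=f$, $h(-,1)=g$ and $h(A\times J)\subseteq B$; let $\sim_{(J,\times)}$ be the equivalence relation generated by this relation. Simplicial chains: let $|\Delta^n|^J$ be the standard topological simplex if $J=I$, the set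 $\{0,\dots,n\}$ with the indiscrete closure if $J=J_1$, and $\{0,\dots,n\}$ with $c(\{i\})=\{j: i\le j\}$ if $J=J_+$. Let $C_n(X)$ be the free abelian group on the continuous maps $|\Delta^n|^J\to X$, with $\partial=\sum_{i=0}^n(-1)^id_i$, where $d_i$ is restriction to the $i$-th face. Cubical chains: let $C_n(X)$ be the free abelian group on the continuous maps $\sigma:J^{\times n}\to X$ modulo the subgroup generated by the degenerate ones (those that do not depend on some coordinate), with $\partial\sigma=\sum_{i=1}^n(-1)^i(A_i\sigma-B_i\sigma)$, where $A_i\sigma$ and $B_i\sigma$ are obtained by setting the $i$-th coordinate to $0$ and $1$. In both cases put $C_\bullet(X,A)=C_\bullet(X)/C_\bullet(A)$, and for an abelian group $G$ let $H_n(X,A)$ and $H^n(X,A;G)$, $n\ge 0$, be the homology of $C_\bullet(X,A)$ and the cohomology of $\operatorname{Hom}(C_\bullet(X,A),G)$. Write $H_n(X)$ for $H_n(X,\emptyset)$, and similarly for cohomology; groups of negative degree are $0$. **Theorem.** For every $J\in\{I,J_1,J_+\}$, both the singular simplicial homology functors and the singular cubical homology functors $H_n$ form a $(J,\times)$ homology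 theory of closure spaces. That is, there are natural transformations $\partial:H_{n+1}(X,A)\to H_n(A)$, $n\ge 0$, such that: 1. (homotopy) if $f\sim_{(J,\times)}g$, then $H_n(f)=H_n(g)$ for all $n$; 2. (excision) if $A,B\subseteq X$ satisfy $i(A)\cup i(B)=X$, then the inclusion $(B,A\cap B)\to(X,A)$ induces isomorphisms $H_n(B,A\cap B)\cong H_n(X,A)$ for all $n$; 3. (dimension) $H_n(X,\emptyset)=0$ for all $n\ge1$ if $X$ is a one-point space; 4. (long exact sequence) for every pair $(X,A)$ the sequence $\cdots\to H_n(A)\to H_n(X)\to H_n(X,A)\xrightarrow{\partial}H_{n-1}(A)\to\cdots\to H_0(X,A)\to0$, whose unnamed maps are induced by the inclusions $A\to X$ and $(X,\emptyset)\to(X,A)$, is exact. Likewise, for every $J\in\{I,J_1,J_+\}$ and every abelian group $G$, both the singular simplicial and the singular cubical cohomology functors $H^n(-;G)$ form a $(J,\times)$ cohomology theory: there are natural transformations $\delta:H^n(A;G)\to H^{n+1}(X,A;G)$, $n\ge0$, for which the homotopy, excision and dimension axioms hold with $H^n(-;G)$ in place of $H_n$, and for which every sequence $0\to H^0(X,A;G)\to\cdots\to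 H^n(X,A;G)\to H^n(X;G)\to H^n(A;G)\xrightarrow{\delta}H^{n+1}(X,A;G)\to\cdots$ is exact. -/

import Mathlib

universe u v w

open CategoryTheory Opposite

namespace CechClosure

/-! ### Closure spaces -/

/-- A (Čech) closure space: a type with a closure operation, not assumed idempotent. -/
class ClosureSpace (X : Type u) where
  cl : Set X → Set X
  cl_empty : cl ∅ = ∅
  subset_cl : ∀ A, A ⊆ cl A
  cl_union : ∀ A B, cl (A ∪ B) = cl A ∪ cl B

open ClosureSpace

section Basic

variable {X : Type u} {Y : Type v} {Z : Type w} [ClosureSpace X] [ClosureSpace Y] [ClosureSpace Z]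

theorem cl_mono {A B : Set X} (h : A ⊆ B) : cl A ⊆ cl B := by
  have := cl_union A B
  rw [Set.union_eq_self_of_subset_left h] at this
  rw [this]
  exact Set.subset_union_left

/-- The interior `i(A) = X - c(X - A)`. -/
def interior (A : Set X) : Set X := (cl Aᶜ)ᶜ

/-- `V` is a neighborhood of the point `x`. -/
def IsNhd (V : Set X) (x : X) : Prop := x ∈ interior V

theorem IsNhd.mem {V : Set X} {x : X} (h : IsNhd V x) : x ∈ V := by
  by_contra hx
  exact h (subset_cl _ hx)

theorem IsNhd.inter {V W : Set X} {x : X} (hV : IsNhd V x) (hW : IsNhd W x) :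
    IsNhd (V ∩ W) x := by
  unfold IsNhd interior at *
  rw [Set.compl_inter, cl_union]
  exact fun h => h.elim hV hW

theorem isNhd_univ (x : X) : IsNhd (Set.univ : Set X) x := by
  unfold IsNhd interior
  rw [Set.compl_univ, cl_empty]
  exact fun h => h

/-- A point lies in the closure of `A` iff all its neighborhoods meet `A`. -/
theorem mem_cl_iff {A : Set X} {x : X} :
    x ∈ cl A ↔ ∀ V, IsNhd V x → (V ∩ A).Nonempty := by
  constructor
  · intro hx V hV
    by_contra hne
    rw [Set.not_nonempty_iff_eq_empty] at hne
    refine hV (cl_mono ?_ hx)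
    intro a ha hav
    have : a ∈ V ∩ A := ⟨hav, ha⟩
    rw [hne] at this
    exact this
  · intro h
    by_contra hx
    obtain ⟨a, ha, ha'⟩ := h Aᶜ (by unfold IsNhd interior; rwa [compl_compl])
    exact ha ha'

/-- Continuity: `f(c(A)) ⊆ d(f(A))` for all `A`. -/
def Continuous (f : X → Y) : Prop := ∀ A : Set X, f '' cl A ⊆ cl (f '' A)

theorem continuous_id : Continuous (id : X → X) := by
  intro A
  simp

theorem Continuous.comp {g : Y → Z} {f : X → Y} (hg : Continuous g) (hf : Continuous f) :
    Continuous (g ∘ f) := by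
  intro A
  rw [Set.image_comp, Set.image_comp]
  exact (Set.image_mono (hf A)).trans (hg _)

theorem continuous_iff_nhd {f : X → Y} :
    Continuous f ↔ ∀ x V, IsNhd V (f x) → IsNhd (f ⁻¹' V) x := by
  constructor
  · intro hf x V hV hx
    refine hV (cl_mono ?_ (hf _ ⟨x, hx, rfl⟩))
    rintro _ ⟨a, ha, rfl⟩
    exact ha
  · rintro hf A _ ⟨x, hx, rfl⟩
    rw [mem_cl_iff] at hx ⊢
    intro V hV
    obtain ⟨a, ha, ha'⟩ := hx _ (hf x V hV)
    exact ⟨f a, ha, a, ha', rfl⟩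

end Basic

/-- The subspace closure `c_A(B) = c(B) ∩ A`. -/
instance instSubspace {X : Type u} [ClosureSpace X] (A : Set X) : ClosureSpace A where
  cl B := Subtype.val ⁻¹' cl (Subtype.val '' B)
  cl_empty := by simp [cl_empty]
  subset_cl B := fun x hx => subset_cl _ ⟨x, hx, rfl⟩
  cl_union B C := by rw [Set.image_union, cl_union, Set.preimage_union]

/-- The product closure on an arbitrary product: the finite intersections of preimages
`π_i⁻¹(V_i)` of neighborhoods form a local base. -/
instance instPi {ι : Type v} {X : ι → Type u} [∀ i, ClosureSpace (X i)] :
    ClosureSpace (∀ i, X i) where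
  cl A := {x | ∀ (F : Finset ι) (V : ∀ i, Set (X i)), (∀ i ∈ F, IsNhd (V i) (x i)) →
    ((F : Set ι).pi V ∩ A).Nonempty}
  cl_empty := by
    ext x
    simp only [Set.inter_empty, Set.not_nonempty_empty, imp_false, Set.mem_ofPred_eq,
      Set.mem_empty_iff_false, iff_false]
    exact fun h => h ∅ (fun _ => Set.univ) (by simp)
  subset_cl A := fun x hx F V hV => ⟨x, fun i hi => (hV i hi).mem, hx⟩
  cl_union A B := by
    classical
    ext x
    constructor
    · intro h
      by_contra hcon
      simp only [Set.mem_union, Set.mem_ofPred_eq, not_or, not_forall] at hcon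
      obtain ⟨⟨F, V, hV, hA⟩, G, W, hW, hB⟩ := hcon
      obtain ⟨y, hy, hyAB⟩ := h (F ∪ G)
        (fun i => (if i ∈ F then V i else Set.univ) ∩ (if i ∈ G then W i else Set.univ)) (by
          intro i _
          refine IsNhd.inter ?_ ?_
          · split_ifs with hi
            · exact hV i hi
            · exact isNhd_univ _
          · split_ifs with hi
            · exact hW i hi
            · exact isNhd_univ _)
      rcases hyAB with hyA | hyB
      · refine hA ⟨y, fun i hi => ?_, hyA⟩
        have := (hy i (by simp [Finset.mem_coe.1 hi])).1
        rwa [if_pos (Finset.mem_coe.1 hi)] at this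
      · refine hB ⟨y, fun i hi => ?_, hyB⟩
        have := (hy i (by simp [Finset.mem_coe.1 hi])).2
        rwa [if_pos (Finset.mem_coe.1 hi)] at this
    · rintro (h | h) F V hV
      · exact (h F V hV).mono (Set.inter_subset_inter_right _ Set.subset_union_left)
      · exact (h F V hV).mono (Set.inter_subset_inter_right _ Set.subset_union_right)

/-- The product closure on a binary product: the sets `U × V`, with `U` and `V` neighborhoods of
the coordinates, form a local base. -/
instance instProd {X : Type u} {Y : Type v} [ClosureSpace X] [ClosureSpace Y] :
    ClosureSpace (X × Y) where
  cl A := {p | ∀ (U : Set X) (V : Set Y), IsNhd U p.1 → IsNhd V p.2 → ((U ×ˢ V) ∩ A).Nonempty}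
  cl_empty := by
    ext p
    simp only [Set.inter_empty, Set.not_nonempty_empty, imp_false, Set.mem_ofPred_eq,
      Set.mem_empty_iff_false, iff_false]
    exact fun h => h Set.univ Set.univ (isNhd_univ _) (isNhd_univ _)
  subset_cl A := fun p hp U V hU hV => ⟨p, ⟨hU.mem, hV.mem⟩, hp⟩
  cl_union A B := by
    ext p
    constructor
    · intro h
      by_contra hcon
      simp only [Set.mem_union, Set.mem_ofPred_eq, not_or, not_forall] at hcon
      obtain ⟨⟨U, V, hU, hV, hA⟩, U', V', hU', hV', hB⟩ := hcon
      obtain ⟨y, hy, hyAB⟩ := h _ _ (hU.inter hU') (hV.inter hV')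
      rcases hyAB with hyA | hyB
      · exact hA ⟨y, ⟨hy.1.1, hy.2.1⟩, hyA⟩
      · exact hB ⟨y, ⟨hy.1.2, hy.2.2⟩, hyB⟩
    · rintro (h | h) U V hU hV
      · exact (h U V hU hV).mono (Set.inter_subset_inter_right _ Set.subset_union_left)
      · exact (h U V hU hV).mono (Set.inter_subset_inter_right _ Set.subset_union_right)

/-- The closure space of a topological space. -/
abbrev ofTopology (X : Type u) [TopologicalSpace X] : ClosureSpace X where
  cl A := closure A
  cl_empty := closure_empty
  subset_cl _ := subset_closure
  cl_union _ _ := closure_union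

/-- The indiscrete closure: `c(A)` is everything as soon as `A ≠ ∅`. -/
abbrev indiscrete (X : Type u) : ClosureSpace X where
  cl A := {_x | A.Nonempty}
  cl_empty := by simp
  subset_cl A := fun x hx => ⟨x, hx⟩
  cl_union A B := by ext; simp [Set.union_nonempty]

/-- The closure with `c({i}) = {j | i ≤ j}`; its open sets are the down-sets. -/
abbrev upClosure (X : Type u) [Preorder X] : ClosureSpace X where
  cl A := {j | ∃ i ∈ A, i ≤ j}
  cl_empty := by simp
  subset_cl A := fun x hx => ⟨x, hx, le_rfl⟩
  cl_union A B := by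
    ext j
    simp only [Set.mem_union, Set.mem_ofPred_eq]
    constructor
    · rintro ⟨i, hi | hi, hij⟩
      · exact Or.inl ⟨i, hi, hij⟩
      · exact Or.inr ⟨i, hi, hij⟩
    · rintro (⟨i, hi, hij⟩ | ⟨i, hi, hij⟩)
      · exact ⟨i, Or.inl hi, hij⟩
      · exact ⟨i, Or.inr hi, hij⟩

/-! ### The category of closure spaces and the category of pairs -/

/-- Continuous maps between closure spaces. -/
@[ext]
structure ContMap (X : Type u) (Y : Type v) [ClosureSpace X] [ClosureSpace Y] where
  toFun : X → Y
  cont : Continuous toFun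

instance {X : Type u} {Y : Type v} [ClosureSpace X] [ClosureSpace Y] :
    CoeFun (ContMap X Y) (fun _ => X → Y) := ⟨ContMap.toFun⟩

/-- Composition of continuous maps. -/
def ContMap.comp {X : Type u} {Y : Type v} {Z : Type w}
    [ClosureSpace X] [ClosureSpace Y] [ClosureSpace Z]
    (g : ContMap Y Z) (f : ContMap X Y) : ContMap X Z := ⟨g ∘ f, g.cont.comp f.cont⟩

/-- Bundled closure spaces. -/
structure Cl : Type (u + 1) where
  carrier : Type u
  [str : ClosureSpace carrier]

instance : CoeSort Cl.{u} (Type u) := ⟨Cl.carrier⟩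

attribute [instance] Cl.str

instance : Category Cl.{u} where
  Hom X Y := ContMap X Y
  id X := ⟨id, continuous_id⟩
  comp f g := ContMap.comp g f

/-- Pairs `(X, A)` of a closure space and a subspace. -/
structure ClPair : Type (u + 1) where
  space : Cl.{u}
  sub : Set space

/-- Maps of pairs `(X, A) → (Y, B)`: continuous `f : X → Y` with `f(A) ⊆ B`. -/
@[ext]
structure ClPair.Hom (P Q : ClPair.{u}) where
  map : ContMap P.space Q.space
  mapsTo : Set.MapsTo map P.sub Q.sub

instance : Category ClPair.{u} where
  Hom := ClPair.Hom
  id P := ⟨⟨id, continuous_id⟩, fun _ h => h⟩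
  comp f g := ⟨g.map.comp f.map, g.mapsTo.comp f.mapsTo⟩

theorem continuous_subtype_val {X : Type u} [ClosureSpace X] (A : Set X) :
    Continuous (Subtype.val : A → X) := by
  rintro B _ ⟨x, hx, rfl⟩
  exact hx

theorem Continuous.subtype {X : Type u} {Y : Type v} [ClosureSpace X] [ClosureSpace Y]
    {f : X → Y} (hf : Continuous f) {B : Set Y} (h : ∀ x, f x ∈ B) :
    Continuous (fun x => (⟨f x, h x⟩ : B)) := by
  rintro C _ ⟨x, hx, rfl⟩
  change f x ∈ cl (Subtype.val '' ((fun x => (⟨f x, h x⟩ : B)) '' C))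
  rw [← Set.image_comp]
  exact hf C ⟨x, hx, rfl⟩

/-- The inclusion of a subspace. -/
def inclMap {X : Type u} [ClosureSpace X] (A : Set X) : ContMap A X :=
  ⟨Subtype.val, continuous_subtype_val A⟩

/-- The restriction `A → B` of a map of pairs. -/
def ClPair.Hom.restrict {P Q : ClPair.{u}} (f : ClPair.Hom P Q) : ContMap P.sub Q.sub :=
  ⟨fun a => ⟨f.map a.1, f.mapsTo a.2⟩,
    (f.map.cont.comp (continuous_subtype_val P.sub)).subtype (fun a => f.mapsTo a.2)⟩

/-- The functor `(X, A) ↦ X`. -/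
def ClPair.totalFunctor : ClPair.{u} ⥤ Cl.{u} where
  obj P := P.space
  map f := f.map

/-- The functor `(X, A) ↦ A`. -/
def ClPair.subFunctor : ClPair.{u} ⥤ Cl.{u} where
  obj P := ⟨P.sub⟩
  map f := f.restrict

/-- The natural inclusion `A → X`. -/
def ClPair.inclusion : ClPair.subFunctor.{u} ⟶ ClPair.totalFunctor.{u} where
  app P := inclMap P.sub

/-- The pair `(X, ∅)`. -/
def absPair (X : Cl.{u}) : ClPair.{u} := ⟨X, ∅⟩

/-- The functor `X ↦ (X, ∅)`. -/
def absFunctor : Cl.{u} ⥤ ClPair.{u} where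
  obj := absPair
  map f := ⟨f, fun _ h => h.elim⟩

/-- The functor `(X, A) ↦ (A, ∅)`. -/
def ClPair.restr : ClPair.{u} ⥤ ClPair.{u} := ClPair.subFunctor ⋙ absFunctor

/-- The map `i : (A, ∅) → (X, ∅)`. -/
def pairI (P : ClPair.{u}) : ClPair.restr.obj P ⟶ absPair P.space :=
  absFunctor.map (ClPair.inclusion.app P)

/-- The map `j : (X, ∅) → (X, A)`. -/
def pairJ (P : ClPair.{u}) : absPair P.space ⟶ P :=
  ClPair.Hom.mk ⟨id, continuous_id⟩ (fun _ h => h.elim)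

/-- The pair `(B, A ∩ B)` for `A, B ⊆ X`. -/
def excPair (X : Cl.{u}) (A B : Set X) : ClPair.{u} := ⟨⟨B⟩, Subtype.val ⁻¹' A⟩

/-- The inclusion `(B, A ∩ B) → (X, A)`. -/
def excMap (X : Cl.{u}) (A B : Set X) : excPair X A B ⟶ (⟨X, A⟩ : ClPair.{u}) :=
  ClPair.Hom.mk (inclMap B) (fun _ h => h)

/-! ### Intervals and homotopy -/

/-- The three choices of the interval `J`. -/
inductive IntervalKind
  | I
  | J1
  | Jplus

/-- `J_{m,⊤}`: the set `{0, …, m}` with the indiscrete closure. -/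
def Jtop (m : ℕ) : Cl.{0} := @Cl.mk (Fin (m + 1)) (indiscrete _)

/-- `J_{m,≤}`: the set `{0, …, m}` with the closure `c(i) = {j | i ≤ j}`. -/
def Jle (m : ℕ) : Cl.{0} := @Cl.mk (Fin (m + 1)) (upClosure _)

/-- The underlying closure space of the interval: `[0,1]`, `J_1 = J_{1,⊤}` or `J_+ = J_{1,≤}`. -/
def IntervalKind.space : IntervalKind → Cl.{0}
  | I => @Cl.mk unitInterval (ofTopology _)
  | J1 => Jtop 1
  | Jplus => Jle 1

/-- The endpoint `0` (for `false`) or `1` (for `true`) of the interval. -/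
def IntervalKind.endpoint : (J : IntervalKind) → Bool → J.space
  | I, e => bif e then (1 : unitInterval) else (0 : unitInterval)
  | J1, e => bif e then (1 : Fin 2) else (0 : Fin 2)
  | Jplus, e => bif e then (1 : Fin 2) else (0 : Fin 2)

/-- One-step `(J, ×)`-homotopy of maps of pairs `(X, A) → (Y, B)`: a continuous
`h : X × J → Y` from `f` to `g` which maps `A × J` into `B`. For `A = B = ∅` this is one-step
homotopy of maps `X → Y`. -/
def OneStepHomotopic (J : IntervalKind) {P Q : ClPair.{u}} (f g : P ⟶ Q) : Prop :=
  ∃ h : ContMap (P.space × J.space) Q.space,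
    (∀ x, h (x, J.endpoint false) = f.map x) ∧
    (∀ x, h (x, J.endpoint true) = g.map x) ∧
    ∀ x ∈ P.sub, ∀ t, h (x, t) ∈ Q.sub

/-- `(J, ×)`-homotopy: the equivalence relation generated by one-step homotopies. -/
def Homotopic (J : IntervalKind) {P Q : ClPair.{u}} (f g : P ⟶ Q) : Prop :=
  Relation.EqvGen (OneStepHomotopic J) f g

/-! ### Homology and cohomology theories -/

/-- The Eilenberg–Steenrod axioms with respect to `(J, ×)` for functors `H n` on pairs and
natural transformations `∂ : H_{n+1}(X, A) → H_n(A, ∅)`; here `H_{-1} = 0`. -/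
structure IsHomologyTheory (J : IntervalKind) (H : ℕ → ClPair.{u} ⥤ AddCommGrpCat.{u})
    (bd : ∀ n, H (n + 1) ⟶ ClPair.restr ⋙ H n) : Prop where
  homotopy : ∀ {P Q : ClPair.{u}} (f g : P ⟶ Q), Homotopic J f g →
    ∀ n, (H n).map f = (H n).map g
  excision : ∀ (X : Cl.{u}) (A B : Set X), interior A ∪ interior B = Set.univ →
    ∀ n, IsIso ((H n).map (excMap X A B))
  dimension : ∀ (X : Cl.{u}) [Unique X] (n : ℕ), 1 ≤ n → Subsingleton ((H n).obj (absPair X))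
  exact_space : ∀ (P : ClPair.{u}) (n : ℕ),
    Function.Exact ((H n).map (pairI P)) ((H n).map (pairJ P))
  exact_pair : ∀ (P : ClPair.{u}) (n : ℕ),
    Function.Exact ((H (n + 1)).map (pairJ P)) ((bd n).app P)
  exact_sub : ∀ (P : ClPair.{u}) (n : ℕ),
    Function.Exact ((bd n).app P) ((H n).map (pairI P))
  exact_end : ∀ P : ClPair.{u}, Function.Surjective ((H 0).map (pairJ P))

/-- The Eilenberg–Steenrod axioms for cohomology with respect to `(J, ×)`, for contravariant
functors `H n` on pairs and natural transformations `δ : H^n(A, ∅) → H^{n+1}(X, A)`;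
here `H^{-1} = 0`. -/
structure IsCohomologyTheory (J : IntervalKind) (H : ℕ → ClPair.{u}ᵒᵖ ⥤ AddCommGrpCat.{u})
    (cobd : ∀ n, ClPair.restr.op ⋙ H n ⟶ H (n + 1)) : Prop where
  homotopy : ∀ {P Q : ClPair.{u}} (f g : P ⟶ Q), Homotopic J f g →
    ∀ n, (H n).map f.op = (H n).map g.op
  excision : ∀ (X : Cl.{u}) (A B : Set X), interior A ∪ interior B = Set.univ →
    ∀ n, IsIso ((H n).map (excMap X A B).op)
  dimension : ∀ (X : Cl.{u}) [Unique X] (n : ℕ), 1 ≤ n →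
    Subsingleton ((H n).obj (op (absPair X)))
  exact_space : ∀ (P : ClPair.{u}) (n : ℕ),
    Function.Exact ((H n).map (pairJ P).op) ((H n).map (pairI P).op)
  exact_sub : ∀ (P : ClPair.{u}) (n : ℕ),
    Function.Exact ((H n).map (pairI P).op) ((cobd n).app (op P))
  exact_pair : ∀ (P : ClPair.{u}) (n : ℕ),
    Function.Exact ((cobd n).app (op P)) ((H (n + 1)).map (pairJ P).op)
  exact_start : ∀ P : ClPair.{u}, Function.Injective ((H 0).map (pairJ P).op)

/-! ### The singular simplicial chain complex -/

/-- The standard topological `n`-simplex. -/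
def topSimplex (n : ℕ) : Cl.{0} := @Cl.mk (stdSimplex ℝ (Fin (n + 1))) (ofTopology _)

/-- The affine map of standard simplices induced by a map of vertices. -/
noncomputable def topSimplexMap {m n : ℕ} (f : Fin (m + 1) → Fin (n + 1)) :
    ContMap (topSimplex m) (topSimplex n) where
  toFun := fun x => (stdSimplex.map f x : stdSimplex ℝ (Fin (n + 1)))
  cont := by
    have h : ∀ A : Set (stdSimplex ℝ (Fin (m + 1))), stdSimplex.map (S := ℝ) f '' closure A ⊆
        closure (stdSimplex.map f '' A) :=
      fun _ => image_closure_subset_closure_image (stdSimplex.continuous_map f)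
    exact h

/-- A map of finite sets as a map of indiscrete spaces. -/
def JtopMap {m n : ℕ} (f : Fin (m + 1) → Fin (n + 1)) : ContMap (Jtop m) (Jtop n) where
  toFun := f
  cont := by
    rintro A _ ⟨x, hx, rfl⟩
    exact Set.Nonempty.image f hx

/-- An order preserving map as a map of the spaces `J_{m,≤}`. -/
def JleMap {m n : ℕ} (f : Fin (m + 1) →o Fin (n + 1)) : ContMap (Jle m) (Jle n) where
  toFun := f
  cont := by
    rintro A _ ⟨x, ⟨i, hi, hix⟩, rfl⟩
    exact ⟨f i, ⟨i, hi, rfl⟩, f.monotone hix⟩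

/-- The `n`-simplex `|Δ^n|^J`: the standard topological simplex, `J_{n,⊤}` or `J_{n,≤}`. -/
def IntervalKind.simplex : IntervalKind → ℕ → Cl.{0}
  | I, n => topSimplex n
  | J1, n => Jtop n
  | Jplus, n => Jle n

/-- The map of simplices induced by an order preserving map `[m] → [n]`: the affine extension
to the standard simplices if `J = I`, the map itself otherwise. -/
noncomputable def IntervalKind.simplexMap : (J : IntervalKind) → {m n : ℕ} →
    (Fin (m + 1) →o Fin (n + 1)) → ContMap (J.simplex m) (J.simplex n)
  | I, _, _, f => topSimplexMap f
  | J1, _, _, f => JtopMap f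
  | Jplus, _, _, f => JleMap f

theorem IntervalKind.simplexMap_id (J : IntervalKind) (n : ℕ) (x : J.simplex n) :
    J.simplexMap (OrderHom.id : Fin (n + 1) →o Fin (n + 1)) x = x := by
  cases J
  · exact stdSimplex.map_id_apply x
  · rfl
  · rfl

theorem IntervalKind.simplexMap_comp (J : IntervalKind) {l m n : ℕ}
    (g : Fin (m + 1) →o Fin (n + 1)) (f : Fin (l + 1) →o Fin (m + 1)) (x : J.simplex l) :
    J.simplexMap (g.comp f) x = J.simplexMap g (J.simplexMap f x) := by
  cases J
  · exact (stdSimplex.map_comp_apply (S := ℝ) f g x).symm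
  · rfl
  · rfl

/-- The `J` nerve `𝒮^J(X)`: its `n`-simplices are the continuous maps `|Δ^n|^J → X`. -/
noncomputable def singularSet (J : IntervalKind) : Cl.{u} ⥤ SSet.{u} where
  obj X :=
    { obj := fun n => ContMap (J.simplex n.unop.len) X
      map := fun f => TypeCat.ofHom fun σ => σ.comp (J.simplexMap f.unop.toOrderHom)
      map_id := by
        intro n
        ext σ x
        exact congrArg σ.toFun (J.simplexMap_id _ x)
      map_comp := by
        intro a b c f g
        ext σ x
        exact congrArg σ.toFun (J.simplexMap_comp _ _ x) }
  map φ := { app := fun n => TypeCat.ofHom fun σ => ContMap.comp φ σ }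

/-- The singular simplicial chain complex: the Moore complex of the free simplicial abelian
group `ℤ 𝒮^J(X)`, with differential `∑ (-1)^i d_i`. -/
noncomputable def simplicialChains (J : IntervalKind) : Cl.{u} ⥤ ChainComplex AddCommGrpCat.{u} ℕ :=
  singularSet J ⋙ (SimplicialObject.whiskering _ _).obj AddCommGrpCat.free ⋙
    AlgebraicTopology.alternatingFaceMapComplex AddCommGrpCat.{u}

/-! ### The singular cubical chain complex -/

/-- The cube `J^{×n}`, with the product closure. -/
abbrev IntervalKind.Cube (J : IntervalKind) (n : ℕ) : Type := Fin n → J.space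

/-- Singular cubes `J^{×n} → X`. -/
abbrev SingularCube (J : IntervalKind) (n : ℕ) (X : Type u) [ClosureSpace X] : Type u :=
  ContMap (J.Cube n) X

theorem continuous_insertNth {J : Type u} [ClosureSpace J] {n : ℕ} (i : Fin (n + 1)) (t : J) :
    Continuous (fun a : Fin n → J => (i.insertNth t a : Fin (n + 1) → J)) := by
  classical
  rintro A _ ⟨a, ha, rfl⟩ F V hV
  beta_reduce at hV
  obtain ⟨b, hb, hbA⟩ := ha (Finset.univ.filter fun k => i.succAbove k ∈ F)
    (fun k => V (i.succAbove k)) (fun k hk => by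
      have := hV (i.succAbove k) (Finset.mem_filter.1 hk).2
      rwa [Fin.insertNth_apply_succAbove] at this)
  refine ⟨i.insertNth (α := fun _ => J) t b, ?_, b, hbA, rfl⟩
  intro k hk
  rcases Fin.eq_self_or_eq_succAbove i k with rfl | ⟨k, rfl⟩
  · have := (hV k hk).mem
    beta_reduce at this
    rwa [Fin.insertNth_apply_same] at this ⊢
  · rw [Fin.insertNth_apply_succAbove]
    exact hb k (by simpa using hk)

/-- The face of a singular cube obtained by setting the `i`-th coordinate to the endpoint `e`. -/
def cubeFace {J : IntervalKind} {n : ℕ} {X : Type u} [ClosureSpace X] (i : Fin (n + 1)) (e : Bool)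
    (σ : SingularCube J (n + 1) X) : SingularCube J n X :=
  σ.comp ⟨fun a => i.insertNth (J.endpoint e) a, continuous_insertNth i _⟩

/-- A singular cube is degenerate if it does not depend on some coordinate, that is, if it lies in
the image of a degeneracy map of the cubical set of singular cubes. -/
def IsDegenerate {J : IntervalKind} {n : ℕ} {X : Type u} [ClosureSpace X]
    (σ : SingularCube J n X) : Prop :=
  ∃ i : Fin n, ∀ a b : J.Cube n, (∀ k, k ≠ i → a k = b k) → σ a = σ b

section Cubical

variable (J : IntervalKind) (n : ℕ) (X : Type u) [ClosureSpace X]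

/-- The free abelian group on the singular `n`-cubes. -/
abbrev CubeGroup : Type u := FreeAbelianGroup (SingularCube J n X)

/-- The homomorphism `σ ↦ A_i σ - B_i σ`, the difference of the two `i`-th faces. -/
def faceDiff (i : Fin (n + 1)) : CubeGroup J (n + 1) X →+ CubeGroup J n X :=
  FreeAbelianGroup.lift fun σ =>
    FreeAbelianGroup.of (cubeFace i false σ) - FreeAbelianGroup.of (cubeFace i true σ)

/-- The boundary `∂ = ∑_{i=1}^{n+1} (-1)^i (A_i - B_i)`; the coordinates are numbered from `0`
here. -/
def cubeBoundary : CubeGroup J (n + 1) X →+ CubeGroup J n X :=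
  ∑ i : Fin (n + 1), (-1 : ℤ) ^ ((i : ℕ) + 1) • faceDiff J n X i

/-- The subgroup generated by the degenerate singular cubes. -/
def degenerate : AddSubgroup (CubeGroup J n X) :=
  AddSubgroup.closure {x | ∃ σ : SingularCube J n X, IsDegenerate σ ∧ x = FreeAbelianGroup.of σ}

/-- The normalized cubical chains. -/
abbrev NormCubeGroup : Type u := CubeGroup J n X ⧸ degenerate J n X

variable {J X}

theorem of_mem_degenerate {n : ℕ} {σ : SingularCube J n X} (h : IsDegenerate σ) :
    FreeAbelianGroup.of σ ∈ degenerate J n X :=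
  AddSubgroup.subset_closure ⟨σ, h, rfl⟩

theorem IsDegenerate.face {n : ℕ} {σ : SingularCube J (n + 1) X} {i k : Fin (n + 1)}
    (h : ∀ a b : J.Cube (n + 1), (∀ l, l ≠ i → a l = b l) → σ a = σ b) (hk : i ≠ k) (e : Bool) :
    IsDegenerate (cubeFace k e σ) := by
  obtain ⟨i', rfl⟩ := Fin.exists_succAbove_eq hk
  refine ⟨i', fun a b hab => h _ _ fun l hl => ?_⟩
  dsimp only
  rcases Fin.eq_self_or_eq_succAbove k l with rfl | ⟨l, rfl⟩
  · rw [Fin.insertNth_apply_same, Fin.insertNth_apply_same]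
  · rw [Fin.insertNth_apply_succAbove, Fin.insertNth_apply_succAbove]
    exact hab l fun hll => hl (hll ▸ rfl)

theorem cubeFace_eq_of_indep {n : ℕ} {σ : SingularCube J (n + 1) X} {i : Fin (n + 1)}
    (h : ∀ a b : J.Cube (n + 1), (∀ l, l ≠ i → a l = b l) → σ a = σ b) :
    cubeFace i false σ = cubeFace i true σ := by
  refine ContMap.ext (funext fun a => h _ _ fun l hl => ?_)
  dsimp only
  obtain ⟨l, rfl⟩ := Fin.exists_succAbove_eq hl
  rw [Fin.insertNth_apply_succAbove, Fin.insertNth_apply_succAbove]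

theorem insertNth_comm {T : Type u} {n : ℕ} {i j : Fin (n + 1)} (h : i ≤ j) (s t : T)
    (a : Fin n → T) :
    (j.succ.insertNth t (i.insertNth s a : Fin (n + 1) → T) : Fin (n + 2) → T) =
      i.castSucc.insertNth s (j.insertNth t a : Fin (n + 1) → T) := by
  have h1 := Fin.succAbove_castSucc_of_le i j h
  have h2 := Fin.succAbove_succ_of_le j i h
  have h3 := Fin.predAbove_succ_of_le i j h
  refine Fin.insertNth_eq_iff.2 ⟨?_, Fin.insertNth_eq_iff.2 ⟨?_, ?_⟩⟩
  · rw [← h1, Fin.insertNth_apply_succAbove, Fin.insertNth_apply_same]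
  · rw [Fin.removeNth_apply, h2, Fin.insertNth_apply_same]
  · rw [Fin.removeNth_removeNth_eq_swap, h2, h3, Fin.removeNth_insertNth, Fin.removeNth_insertNth]

theorem cubeFace_comm {n : ℕ} (σ : SingularCube J (n + 2) X) {i j : Fin (n + 1)} (h : i ≤ j)
    (e e' : Bool) :
    cubeFace i e (cubeFace j.succ e' σ) = cubeFace j e' (cubeFace i.castSucc e σ) :=
  ContMap.ext (funext fun a => congrArg σ.toFun
    (insertNth_comm h (J.endpoint e) (J.endpoint e') a))

theorem faceDiff_comm {n : ℕ} {i j : Fin (n + 1)} (h : i ≤ j) (x : CubeGroup J (n + 2) X) :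
    faceDiff J n X i (faceDiff J (n + 1) X j.succ x) =
      faceDiff J n X j (faceDiff J (n + 1) X i.castSucc x) := by
  induction x using FreeAbelianGroup.induction_on with
  | zero => simp
  | of σ =>
    simp only [faceDiff, FreeAbelianGroup.lift_apply_of, map_sub, cubeFace_comm σ h]
    abel
  | neg σ hσ => rw [map_neg, map_neg, map_neg, map_neg, hσ]
  | add x y hx hy => rw [map_add, map_add, map_add, map_add, hx, hy]

theorem cubeBoundary_apply {n : ℕ} (x : CubeGroup J (n + 1) X) :
    cubeBoundary J n X x = ∑ i : Fin (n + 1), (-1 : ℤ) ^ ((i : ℕ) + 1) • faceDiff J n X i x := by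
  simp [cubeBoundary, AddMonoidHom.finsetSum_apply]

theorem cubeBoundary_cubeBoundary {n : ℕ} (x : CubeGroup J (n + 2) X) :
    cubeBoundary J n X (cubeBoundary J (n + 1) X x) = 0 := by
  simp only [cubeBoundary_apply, map_sum, map_zsmul, Finset.smul_sum, smul_smul]
  rw [Finset.sum_comm, ← Finset.sum_product']
  let P := Fin (n + 1) × Fin (n + 2)
  let S : Finset P := {ij : P | (ij.2 : ℕ) ≤ (ij.1 : ℕ)}
  rw [Finset.univ_product_univ, ← Finset.sum_add_sum_compl S, ← eq_neg_iff_add_eq_zero,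
    ← Finset.sum_neg_distrib]
  let φ : ∀ ij : P, ij ∈ S → P := fun ij hij =>
    (Fin.castLT ij.2 (lt_of_le_of_lt (Finset.mem_filter.mp hij).right (Fin.is_lt ij.1)), ij.1.succ)
  apply Finset.sum_bij φ
  · intro ij hij
    simp_rw [S, φ, Finset.compl_filter, Finset.mem_filter_univ, Fin.val_succ,
      Fin.val_castLT] at hij ⊢
    lia
  · rintro ⟨i, j⟩ hij ⟨i', j'⟩ hij' h
    rw [Prod.mk_inj]
    exact ⟨by simpa [φ] using! congr_arg Prod.snd h,
      by simpa [φ, Fin.castSucc_castLT] using! congr_arg Fin.castSucc (congr_arg Prod.fst h)⟩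
  · rintro ⟨i', j'⟩ hij'
    simp_rw [S, Finset.compl_filter, Finset.mem_filter_univ, not_le] at hij'
    refine ⟨(j'.pred <| ?_, Fin.castSucc i'), ?_, ?_⟩
    · rintro rfl
      simp only [Fin.val_zero, not_lt_zero] at hij'
    · simpa [S] using! Nat.le_sub_one_of_lt hij'
    · simp only [φ, Fin.castLT_castSucc, Fin.succ_pred]
  · rintro ⟨i, j⟩ hij
    have hij' : (j : ℕ) ≤ (i : ℕ) := (Finset.mem_filter.mp hij).2
    have key := faceDiff_comm (J := J) (X := X)
      (i := Fin.castLT j (lt_of_le_of_lt hij' i.is_lt)) (j := i) hij' x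
    rw [Fin.castSucc_castLT] at key
    dsimp only [φ]
    rw [key, ← neg_smul]
    congr 1
    simp only [Fin.val_succ, Fin.val_castLT, pow_add, pow_one]
    ring

theorem cubeBoundary_degenerate (n : ℕ) :
    degenerate J (n + 1) X ≤ (degenerate J n X).comap (cubeBoundary J n X) := by
  refine (AddSubgroup.closure_le _).2 ?_
  rintro _ ⟨σ, ⟨i, hi⟩, rfl⟩
  change cubeBoundary J n X _ ∈ degenerate J n X
  rw [cubeBoundary_apply]
  refine AddSubgroup.sum_mem _ fun k _ => AddSubgroup.zsmul_mem _ ?_ _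
  rw [faceDiff, FreeAbelianGroup.lift_apply_of]
  by_cases hk : i = k
  · subst hk
    rw [cubeFace_eq_of_indep hi, sub_self]
    exact AddSubgroup.zero_mem _
  · exact AddSubgroup.sub_mem _ (of_mem_degenerate (IsDegenerate.face hi hk _))
      (of_mem_degenerate (IsDegenerate.face hi hk _))

variable (J X)

/-- The boundary of the normalized complex. -/
def normBoundary : NormCubeGroup J (n + 1) X →+ NormCubeGroup J n X :=
  QuotientAddGroup.map _ _ (cubeBoundary J n X) (cubeBoundary_degenerate n)

theorem normBoundary_normBoundary (x : NormCubeGroup J (n + 2) X) :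
    normBoundary J n X (normBoundary J (n + 1) X x) = 0 := by
  induction x using QuotientAddGroup.induction_on with
  | H x =>
    simp only [normBoundary, QuotientAddGroup.map_mk, cubeBoundary_cubeBoundary]
    rfl

variable {X} {Y : Type v} [ClosureSpace Y]

/-- The map of cubical chains induced by a continuous map. -/
def cubeMap (f : ContMap X Y) : CubeGroup J n X →+ CubeGroup J n Y :=
  FreeAbelianGroup.map fun σ => f.comp σ

variable {J}

theorem cubeMap_boundary {n : ℕ} (f : ContMap X Y) (x : CubeGroup J (n + 1) X) :
    cubeBoundary J n Y (cubeMap J (n + 1) f x) = cubeMap J n f (cubeBoundary J n X x) := by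
  rw [cubeBoundary_apply, cubeBoundary_apply, map_sum]
  refine Finset.sum_congr rfl fun i _ => ?_
  rw [map_zsmul]
  congr 1
  induction x using FreeAbelianGroup.induction_on with
  | zero => simp
  | of σ => simp [faceDiff, cubeMap, FreeAbelianGroup.map_of_apply]; rfl
  | neg σ hσ => rw [map_neg, map_neg, map_neg, map_neg, hσ]
  | add x y hx hy => rw [map_add, map_add, map_add, map_add, hx, hy]

theorem cubeMap_degenerate (f : ContMap X Y) :
    degenerate J n X ≤ (degenerate J n Y).comap (cubeMap J n f) := by
  refine (AddSubgroup.closure_le _).2 ?_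
  rintro _ ⟨σ, ⟨i, hi⟩, rfl⟩
  change cubeMap J n f _ ∈ degenerate J n Y
  rw [cubeMap, FreeAbelianGroup.map_of_apply]
  exact of_mem_degenerate ⟨i, fun a b hab => congrArg f.toFun (hi a b hab)⟩

variable (J)

/-- The map of normalized cubical chains induced by a continuous map. -/
def normCubeMap (f : ContMap X Y) : NormCubeGroup J n X →+ NormCubeGroup J n Y :=
  QuotientAddGroup.map _ _ (cubeMap J n f) (cubeMap_degenerate n f)

variable {J}

theorem normCubeMap_boundary {n : ℕ} (f : ContMap X Y) (x : NormCubeGroup J (n + 1) X) :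
    normBoundary J n Y (normCubeMap J (n + 1) f x) = normCubeMap J n f (normBoundary J n X x) := by
  induction x using QuotientAddGroup.induction_on with
  | H x => exact congrArg (QuotientAddGroup.mk) (cubeMap_boundary f x)

theorem normCubeMap_id (x : NormCubeGroup J n X) :
    normCubeMap J n ⟨id, continuous_id⟩ x = x := by
  induction x using QuotientAddGroup.induction_on with
  | H x => exact congrArg (QuotientAddGroup.mk) (FreeAbelianGroup.map_id_apply x)

theorem normCubeMap_comp {Z : Type w} [ClosureSpace Z] (g : ContMap Y Z) (f : ContMap X Y)
    (x : NormCubeGroup J n X) :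
    normCubeMap J n (g.comp f) x = normCubeMap J n g (normCubeMap J n f x) := by
  induction x using QuotientAddGroup.induction_on with
  | H x =>
    exact congrArg (QuotientAddGroup.mk)
      (FreeAbelianGroup.map_comp_apply (f := fun σ => f.comp σ) (g := fun σ => g.comp σ) x)

end Cubical

/-- The (normalized) singular cubical chain complex: singular cubes `J^{×n} → X` modulo
degenerate ones. -/
def cubicalComplex (J : IntervalKind) (X : Cl.{u}) : ChainComplex AddCommGrpCat.{u} ℕ :=
  ChainComplex.of (fun n => AddCommGrpCat.of (NormCubeGroup J n X))
    (fun n => AddCommGrpCat.ofHom (normBoundary J n X))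
    (fun n => AddCommGrpCat.hom_ext (AddMonoidHom.ext fun x => normBoundary_normBoundary J n X x))

/-- The singular cubical chain complex as a functor. -/
def cubicalChains (J : IntervalKind) : Cl.{u} ⥤ ChainComplex AddCommGrpCat.{u} ℕ where
  obj X := cubicalComplex J X
  map {X Y} f := ChainComplex.ofHom (X := cubicalComplex J X) (Y := cubicalComplex J Y)
    (fun n => AddCommGrpCat.ofHom (normCubeMap J n f))
    (fun n => by
      simp only [cubicalComplex, ChainComplex.of_d]
      exact AddCommGrpCat.hom_ext (AddMonoidHom.ext fun x => normCubeMap_boundary f x))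
  map_id X := HomologicalComplex.hom_ext _ _ fun n =>
    AddCommGrpCat.hom_ext (AddMonoidHom.ext fun x => normCubeMap_id n x)
  map_comp f g := HomologicalComplex.hom_ext _ _ fun n =>
    AddCommGrpCat.hom_ext (AddMonoidHom.ext fun x => normCubeMap_comp n g f x)

/-! ### Relative homology and cohomology -/

section Relative

variable (C : Cl.{u} ⥤ ChainComplex AddCommGrpCat.{u} ℕ)

/-- The relative chains `C(X, A) = C(X) / C(A)`, for a functor `C` of chains. -/
noncomputable def relativeChains : ClPair.{u} ⥤ ChainComplex AddCommGrpCat.{u} ℕ where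
  obj P := Limits.cokernel (C.map (ClPair.inclusion.app P))
  map {P Q} f := Limits.cokernel.map _ _ (C.map (ClPair.subFunctor.map f))
    (C.map (ClPair.totalFunctor.map f)) (by
      rw [← C.map_comp, ← C.map_comp, ClPair.inclusion.naturality])
  map_id P := by
    rw [← cancel_epi (Limits.cokernel.π _)]
    simp
  map_comp f g := by
    rw [← cancel_epi (Limits.cokernel.π _)]
    simp

/-- Relative homology `H_n(X, A)`. -/
noncomputable def relativeHomology (n : ℕ) : ClPair.{u} ⥤ AddCommGrpCat.{u} :=
  relativeChains C ⋙ HomologicalComplex.homologyFunctor _ _ n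

/-- The functor sending a chain complex `K` to the cochain complex `Hom(K, G)`. -/
noncomputable def dualComplex (G : AddCommGrpCat.{u}) :
    (ChainComplex AddCommGrpCat.{u} ℕ)ᵒᵖ ⥤ CochainComplex AddCommGrpCat.{u} ℕ :=
  HomologicalComplex.opFunctor _ _ ⋙ (preadditiveYoneda.obj G).mapHomologicalComplex _

/-- Relative cohomology `H^n(X, A; G)`, the cohomology of `Hom(C(X, A), G)`. -/
noncomputable def relativeCohomology (G : AddCommGrpCat.{u}) (n : ℕ) :
    ClPair.{u}ᵒᵖ ⥤ AddCommGrpCat.{u} :=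
  (relativeChains C).op ⋙ dualComplex G ⋙ HomologicalComplex.homologyFunctor _ _ n

end Relative

end CechClosure

namespace CechClosure

/-! ### Complexes of abelian groups -/

section Algebra

open Limits HomologicalComplex

/-! All the axioms are deduced in `IsChainTheory.isHomologyTheory` and
`IsChainTheory.isCohomologyTheory` from a few properties of the functor `C` of absolute chains,
collected in `IsChainTheory`. Discarding the generators not contained in `A` retracts `C(X)` onto
`C(A)` in each degree, so `0 → C(A) → C(X) → C(X, A) → 0` is degreewise split; it therefore stays
exact under `Hom(-, G)`, and both long exact sequences follow. A natural chain homotopy between the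
two ends of `X × J` gives homotopy invariance. If every chain of `X` with small boundary is, up to a
boundary, a chain of `A` plus a chain of `B`, then `C(B, A ∩ B) → C(X, A)` is a quasi-isomorphism;
relative chains being projective, it is even a homotopy equivalence, and excision holds in
cohomology too.

Simplices and cubes are handled together through `ChainModel`: chains generated in each degree by
the maps out of one model space, with the degenerate maps set to zero. The remaining geometric
inputs are prism operators, the one-point space, and approximation by small chains.

For `J1` and `Jplus` every model has a point whose only neighborhood is the whole model, so each
singular simplex or cube already lies in `A` or in `B` (`HasTop.forall_mem_or`). For `I`, cubes are
halved repeatedly: by a Lebesgue number argument the pieces become small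
(`exists_isSmall_iterate_subdivision`), and subdivision is naturally homotopic to the identity by
acyclic models (`ChainModel.naturallyHomotopic`), the models being contractible. Simplices over `I`
need no subdivision of their own: acyclic models give natural maps between simplicial and cubical
chains (`exists_simplicial_cubical`), along which small approximation is transferred
(`SmallApprox.transfer`). -/

/-- A chain homotopy of `ℕ`-indexed chain complexes from its components. -/
noncomputable def homotopyOfComponents {V : Type v} [Category.{w} V] [Preadditive V]
    {K L : ChainComplex V ℕ} {f g : K ⟶ L}
    (h : ∀ n, K.X n ⟶ L.X (n + 1)) (h_zero : f.f 0 - g.f 0 = h 0 ≫ L.d 1 0)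
    (h_succ : ∀ n, f.f (n + 1) - g.f (n + 1) =
      K.d (n + 1) n ≫ h n + h (n + 1) ≫ L.d (n + 2) (n + 1)) : Homotopy f g where
  hom i j := if e : i + 1 = j then h i ≫ eqToHom (by rw [e]) else 0
  zero i j hij := dif_neg hij
  comm i := by
    rw [Homotopy.prevD_chainComplex]
    cases i with
    | zero => simp [← h_zero]
    | succ n =>
      rw [Homotopy.dNext_succ_chainComplex]
      simp [← h_succ]

/-- A morphism of a short exact sequence of complexes with acyclic quotient is a
quasi-isomorphism. -/
theorem quasiIso_of_shortExact_of_acyclic {V : Type v} [Category.{w} V] [Abelian V] {ι : Type*}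
    {c : ComplexShape ι} {S : ShortComplex (HomologicalComplex V c)} (hS : S.ShortExact)
    (h : S.X₃.Acyclic) : QuasiIso S.f := by
  rw [quasiIso_iff]
  intro i
  rw [quasiIsoAt_iff_isIso_homologyMap]
  have hz : ∀ i, IsZero (S.X₃.homology i) := fun i => (h i).isZero_homology
  have : Epi (homologyMap S.f i) := (hS.homology_exact₂ i).epi_f ((hz i).eq_of_tgt _ _)
  have : Mono (homologyMap S.f i) := by
    by_cases hi : ∃ j, c.Rel j i
    · obtain ⟨j, hj⟩ := hi
      exact (hS.homology_exact₁ j i hj).mono_g ((hz j).eq_of_src _ _)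
    -- With no differential into degree `i` there are no boundaries there, so injectivity on cycles
    -- is injectivity on homology.
    · have := hS.mono_f
      exact mono_homologyMap_of_mono_of_not_rel _ _ (by simpa using hi)
  exact isIso_of_mono_of_epi _

/-- A degreewise injective chain map is a quasi-isomorphism if every relative cycle is homologous
to a chain in the image. -/
theorem quasiIso_of_injective {K L : ChainComplex AddCommGrpCat.{u} ℕ} (f : K ⟶ L)
    (hf : ∀ n, Function.Injective (f.f n))
    (h_zero : ∀ z : L.X 0, ∃ (w : L.X 1) (x : K.X 0), z = L.d 1 0 w + f.f 0 x)
    (h_succ : ∀ (n : ℕ) (z : L.X (n + 1)) (y : K.X n), L.d (n + 1) n z = f.f n y →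
      ∃ (w : L.X (n + 2)) (x : K.X (n + 1)), z = L.d (n + 2) (n + 1) w + f.f (n + 1) x) :
    QuasiIso f := by
  have : ∀ n, Mono (f.f n) := fun n => (AddCommGrpCat.mono_iff_injective _).2 (hf n)
  have : Mono f := mono_of_mono_f _ this
  let S := ShortComplex.mk f (cokernel.π f) (cokernel.condition f)
  have hS : S.ShortExact := { exact := ShortComplex.exact_cokernel f }
  refine quasiIso_of_shortExact_of_acyclic hS fun n => ?_
  have hd := (shortExact_iff_degreewise_shortExact S).1 hS
  have hsurj : ∀ n, Function.Surjective (S.g.f n) := fun n => (hd n).ab_surjective_g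
  have hex : ∀ n (x : L.X n), S.g.f n x = 0 → ∃ y, f.f n y = x :=
    fun n => (ShortComplex.ab_exact_iff _).1 (hd n).exact
  have hzero : ∀ n (y : K.X n), S.g.f n (f.f n y) = 0 := fun n y =>
    ShortComplex.ab_zero_apply (S.map (eval _ _ n)) y
  have hcomm : ∀ i j (x : L.X i), S.X₃.d i j (S.g.f i x) = S.g.f j (L.d i j x) := fun i j x =>
    ConcreteCategory.congr_hom (S.g.comm i j) x
  cases n with
  | zero =>
    rw [exactAt_iff' _ 1 0 0 (by simp) (by simp), ShortComplex.ab_exact_iff]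
    intro q _
    obtain ⟨z, rfl⟩ := hsurj 0 q
    obtain ⟨w, x, rfl⟩ := h_zero z
    refine ⟨S.g.f 1 w, (hcomm 1 0 w).trans ?_⟩
    rw [map_add, hzero, add_zero]
  | succ n =>
    rw [exactAt_iff' _ (n + 2) (n + 1) n (by simp) (by simp), ShortComplex.ab_exact_iff]
    intro q hq
    obtain ⟨z, rfl⟩ := hsurj (n + 1) q
    obtain ⟨y, hy⟩ := hex n _ ((hcomm (n + 1) n z).symm.trans hq)
    obtain ⟨w, x, rfl⟩ := h_succ n z y hy.symm
    refine ⟨S.g.f (n + 2) w, (hcomm (n + 2) (n + 1) w).trans ?_⟩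
    rw [map_add, hzero, add_zero]

/-- A chain homotopy on the quotient of a degreewise split sequence from its lift. -/
theorem nonempty_homotopy_of_lift {S : ShortComplex (ChainComplex AddCommGrpCat.{u} ℕ)}
    (s : ∀ n, (S.map (HomologicalComplex.eval _ _ n)).Splitting)
    {L : ChainComplex AddCommGrpCat.{u} ℕ} {f g : S.X₃ ⟶ L} (h : ∀ n, S.X₂.X n ⟶ L.X (n + 1))
    (h_f : ∀ n, S.f.f n ≫ h n = 0) (h_zero : S.g.f 0 ≫ (f.f 0 - g.f 0) = h 0 ≫ L.d 1 0)
    (h_succ : ∀ n, S.g.f (n + 1) ≫ (f.f (n + 1) - g.f (n + 1)) =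
      S.X₂.d (n + 1) n ≫ h n + h (n + 1) ≫ L.d (n + 2) (n + 1)) : Nonempty (Homotopy f g) := by
  have hepi : ∀ n, Epi (S.g.f n) := fun n => (s n).epi_g
  have hdesc : ∀ n, ∃ t : S.X₃.X n ⟶ L.X (n + 1), S.g.f n ≫ t = h n := fun n =>
    -- Splitness makes `S.g.f n` a cokernel of `S.f.f n`, so a component that kills the subcomplex
    -- descends to the quotient.
    ⟨(s n).gIsCokernel.desc (CokernelCofork.ofπ (f := S.f.f n) (h n) (h_f n)),
      (s n).gIsCokernel.fac (CokernelCofork.ofπ (f := S.f.f n) (h n) (h_f n)) .one⟩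
  choose t ht using hdesc
  refine ⟨homotopyOfComponents t ?_ fun n => ?_⟩
  · rw [← cancel_epi (S.g.f 0), h_zero, reassoc_of% ht 0]
  · rw [← cancel_epi (S.g.f (n + 1)), h_succ, Preadditive.comp_add, reassoc_of% ht (n + 1),
      S.g.comm_assoc, ht n]

/-! ### Dualisation of homotopies and of split sequences -/

variable (G : AddCommGrpCat.{u})

/-- The dual of a chain homotopy. -/
noncomputable def dualHomotopy {K L : ChainComplex AddCommGrpCat.{u} ℕ} {f g : K ⟶ L}
    (h : Homotopy f g) : Homotopy ((dualComplex G).map f.op) ((dualComplex G).map g.op) :=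
  (preadditiveYoneda.obj G).mapHomotopy h.op

/-- An additive functor preserves homotopy equivalences, though not quasi-isomorphisms in general.
This is why cohomological excision passes through a homotopy equivalence. -/
theorem isIso_homologyMap_dual {K L : ChainComplex AddCommGrpCat.{u} ℕ} {f : K ⟶ L}
    (h : homotopyEquivalences AddCommGrpCat.{u} (.down ℕ) f) (n : ℕ) :
    IsIso (homologyMap ((dualComplex G).map f.op) n) := by
  obtain ⟨e, rfl⟩ := h
  refine ⟨homologyMap ((dualComplex G).map e.inv.op) n, ?_, ?_⟩
  · rw [← homologyMap_comp, ← Functor.map_comp, ← op_comp,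
      (dualHomotopy G e.homotopyInvHomId).homologyMap_eq, op_id,
      CategoryTheory.Functor.map_id, homologyMap_id]
  · rw [← homologyMap_comp, ← Functor.map_comp, ← op_comp,
      (dualHomotopy G e.homotopyHomInvId).homologyMap_eq, op_id,
      CategoryTheory.Functor.map_id, homologyMap_id]

/-- The dual of a short complex of chain complexes. -/
noncomputable abbrev dualShortComplex (S : ShortComplex (ChainComplex AddCommGrpCat.{u} ℕ)) :
    ShortComplex (CochainComplex AddCommGrpCat.{u} ℕ) :=
  ShortComplex.mk ((dualComplex G).map S.g.op) ((dualComplex G).map S.f.op) (by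
    rw [← Functor.map_comp, ← op_comp, S.zero]
    ext n x
    exact zero_comp (X := S.X₁.X n) (Y := S.X₃.X n) (f := x))

/-- `Hom(-, G)` is not exact, but it preserves degreewise splittings. -/
theorem dualShortComplex_shortExact {S : ShortComplex (ChainComplex AddCommGrpCat.{u} ℕ)}
    (s : ∀ n, (S.map (eval _ _ n)).Splitting) : (dualShortComplex G S).ShortExact :=
  shortExact_of_degreewise_shortExact _ fun n =>
    ((s n).op.map (preadditiveYoneda.obj G)).shortExact

theorem shortExact_of_splitting {S : ShortComplex (ChainComplex AddCommGrpCat.{u} ℕ)}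
    (s : ∀ n, (S.map (eval _ _ n)).Splitting) : S.ShortExact :=
  shortExact_of_degreewise_shortExact _ fun n => (s n).shortExact

/-- Between the projection from cycles and the inclusion into opcycles, the map induced on homology
factors through the degree `n` component, so the vanishing of that component suffices. -/
theorem homologyMap_eq_zero_of_homotopy {ι : Type*} {c : ComplexShape ι}
    {K L : HomologicalComplex AddCommGrpCat.{u} c} {f g : K ⟶ L} (h : Homotopy f g) (n : ι)
    (hg : g.f n = 0) : homologyMap f n = 0 := by
  rw [h.homologyMap_eq, ← cancel_epi (K.homologyπ n), homologyπ_naturality,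
    ← cancel_mono (L.homologyι n)]
  rw [Category.assoc, homology_π_ι, cyclesMap_i_assoc, hg]
  simp

/-- A complex whose identity is homotopic to a map vanishing in degree `n` has no homology in
degree `n`. -/
theorem subsingleton_homology_of_homotopy {ι : Type*} {c : ComplexShape ι}
    {K : HomologicalComplex AddCommGrpCat.{u} c} {p : K ⟶ K} (h : Homotopy (𝟙 K) p) (n : ι)
    (hp : p.f n = 0) : Subsingleton (K.homology n) := by
  have := homologyMap_eq_zero_of_homotopy h n hp
  rw [homologyMap_id] at this
  exact AddCommGrpCat.subsingleton_of_isZero ((IsZero.iff_id_eq_zero _).2 this)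

end Algebra

end CechClosure

namespace CechClosure

/-! ### Cylinders -/

theorem isNhd_mono {X : Type u} [ClosureSpace X] {V W : Set X} {x : X} (h : V ⊆ W)
    (hV : IsNhd V x) : IsNhd W x :=
  fun hx => hV (cl_mono (Set.compl_subset_compl.2 h) hx)

theorem isNhd_prod_iff {X : Type u} {Y : Type v} [ClosureSpace X] [ClosureSpace Y]
    {W : Set (X × Y)} {p : X × Y} :
    IsNhd W p ↔ ∃ U V, IsNhd U p.1 ∧ IsNhd V p.2 ∧ U ×ˢ V ⊆ W := by
  have : IsNhd W p ↔ ¬ ∀ (U : Set X) (V : Set Y), IsNhd U p.1 → IsNhd V p.2 →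
    ((U ×ˢ V) ∩ Wᶜ).Nonempty := Iff.rfl
  rw [this]
  push Not
  simp only [← Set.subset_compl_iff_disjoint_right, ← Set.disjoint_iff_inter_eq_empty, compl_compl]

theorem isNhd_pi_iff {ι : Type v} {X : ι → Type u} [∀ i, ClosureSpace (X i)]
    {W : Set (∀ i, X i)} {p : ∀ i, X i} :
    IsNhd W p ↔ ∃ (F : Finset ι) (V : ∀ i, Set (X i)), (∀ i ∈ F, IsNhd (V i) (p i)) ∧
      (F : Set ι).pi V ⊆ W := by
  have : IsNhd W p ↔ ¬ ∀ (F : Finset ι) (V : ∀ i, Set (X i)), (∀ i ∈ F, IsNhd (V i) (p i)) →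
    ((F : Set ι).pi V ∩ Wᶜ).Nonempty := Iff.rfl
  rw [this]
  push Not
  simp only [← Set.subset_compl_iff_disjoint_right, ← Set.disjoint_iff_inter_eq_empty, compl_compl]

theorem continuous_const {X : Type u} {Y : Type v} [ClosureSpace X] [ClosureSpace Y] (y : Y) :
    Continuous (fun _ : X => y) := by
  rw [continuous_iff_nhd]
  intro x V hV
  rw [Set.preimage_const_of_mem hV.mem]
  exact isNhd_univ x

theorem continuous_fst {X : Type u} {Y : Type v} [ClosureSpace X] [ClosureSpace Y] :
    Continuous (Prod.fst : X × Y → X) := by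
  rw [continuous_iff_nhd]
  exact fun x V hV => isNhd_prod_iff.2 ⟨V, Set.univ, hV, isNhd_univ _, fun p hp => hp.1⟩

theorem continuous_snd {X : Type u} {Y : Type v} [ClosureSpace X] [ClosureSpace Y] :
    Continuous (Prod.snd : X × Y → Y) := by
  rw [continuous_iff_nhd]
  exact fun x V hV => isNhd_prod_iff.2 ⟨Set.univ, V, isNhd_univ _, hV, fun p hp => hp.2⟩

theorem Continuous.prodMk {X : Type u} {Y : Type v} {Z : Type w} [ClosureSpace X] [ClosureSpace Y]
    [ClosureSpace Z] {f : Z → X} {g : Z → Y} (hf : Continuous f) (hg : Continuous g) :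
    Continuous (fun z => (f z, g z)) := by
  rw [continuous_iff_nhd] at *
  intro z W hW
  obtain ⟨U, V, hU, hV, hUV⟩ := isNhd_prod_iff.1 hW
  exact isNhd_mono (fun x hx => hUV ⟨hx.1, hx.2⟩) ((hf z U hU).inter (hg z V hV))

theorem continuous_apply {ι : Type v} {X : ι → Type u} [∀ i, ClosureSpace (X i)] (i : ι) :
    Continuous (fun p : ∀ i, X i => p i) := by
  classical
  rw [continuous_iff_nhd]
  refine fun p V hV => isNhd_pi_iff.2 ⟨{i}, fun j => if h : j = i then h ▸ V else Set.univ, ?_, ?_⟩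
  · intro j hj
    obtain rfl := Finset.mem_singleton.1 hj
    simpa using hV
  · intro q hq
    simpa using hq i (by simp)

theorem isNhd_biInter {X : Type u} [ClosureSpace X] {ι : Type v} (F : Finset ι) {V : ι → Set X}
    {x : X} (h : ∀ i ∈ F, IsNhd (V i) x) : IsNhd (⋂ i ∈ F, V i) x := by
  classical
  induction F using Finset.induction_on with
  | empty => simpa using isNhd_univ x
  | insert i F hi ih =>
    rw [Finset.set_biInter_insert]
    exact (h i (by simp)).inter (ih fun j hj => h j (by simp [hj]))

theorem continuous_pi {Z : Type w} [ClosureSpace Z] {ι : Type v} {X : ι → Type u}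
    [∀ i, ClosureSpace (X i)] {f : Z → ∀ i, X i} (hf : ∀ i, Continuous fun z => f z i) :
    Continuous f := by
  rw [continuous_iff_nhd]
  intro z W hW
  obtain ⟨F, V, hV, hW⟩ := isNhd_pi_iff.1 hW
  refine isNhd_mono ?_ (isNhd_biInter F fun i hi => continuous_iff_nhd.1 (hf i) z (V i) (hV i hi))
  exact fun x hx => hW fun i hi => Set.mem_iInter₂.1 hx i hi

/-- The cylinder functor `X ↦ X × J`. -/
def cylinder (J : IntervalKind) : Cl.{u} ⥤ Cl.{u} where
  obj X := ⟨X × J.space⟩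
  map f := ⟨fun p => (f.toFun p.1, p.2),
    Continuous.prodMk (f.cont.comp continuous_fst) continuous_snd⟩

/-- The two ends of the cylinder. -/
def cylinderEnd (J : IntervalKind) (e : Bool) : 𝟭 Cl.{u} ⟶ cylinder J where
  app X := ⟨fun x => (x, J.endpoint e), Continuous.prodMk continuous_id (continuous_const _)⟩

/-- Chain homotopies between natural chain maps which are themselves natural. -/
def NaturallyHomotopic {F G : Cl.{u} ⥤ ChainComplex AddCommGrpCat.{u} ℕ} (φ ψ : F ⟶ G) : Prop :=
  ∃ h : ∀ (n : ℕ) (X : Cl.{u}), (F.obj X).X n ⟶ (G.obj X).X (n + 1),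
    (∀ (n : ℕ) {X Y : Cl.{u}} (f : X ⟶ Y), (F.map f).f n ≫ h n Y = h n X ≫ (G.map f).f (n + 1)) ∧
    (∀ X, (φ.app X).f 0 - (ψ.app X).f 0 = h 0 X ≫ (G.obj X).d 1 0) ∧
    ∀ X n, (φ.app X).f (n + 1) - (ψ.app X).f (n + 1) =
      (F.obj X).d (n + 1) n ≫ h n X + h (n + 1) X ≫ (G.obj X).d (n + 2) (n + 1)

/-- The properties of a functor of chains from which the axioms for relative homology and
cohomology follow. -/
structure IsChainTheory (J : IntervalKind) (C : Cl.{u} ⥤ ChainComplex AddCommGrpCat.{u} ℕ) :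
    Prop where
  projective : ∀ (X : Cl.{u}) (n : ℕ), Projective ((C.obj X).X n)
  isZero_of_isEmpty : ∀ (X : Cl.{u}) [IsEmpty X], Limits.IsZero (C.obj X)
  -- A retraction that discards the generators outside `A` commutes with `f : (X, A) → (Y, B)` only
  -- if nothing outside `A` is sent into `B`; hence the condition on `f`.
  exists_retraction : ∃ r : ∀ (P : ClPair.{u}) (n : ℕ),
    (C.obj (ClPair.totalFunctor.obj P)).X n ⟶ (C.obj (ClPair.subFunctor.obj P)).X n,
    (∀ P n, (C.map (ClPair.inclusion.app P)).f n ≫ r P n = 𝟙 _) ∧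
    ∀ {P Q : ClPair.{u}} (f : P ⟶ Q) (n : ℕ), (∀ x, f.map x ∈ Q.sub → x ∈ P.sub) →
      (C.map (ClPair.totalFunctor.map f)).f n ≫ r Q n =
        r P n ≫ (C.map (ClPair.subFunctor.map f)).f n
  homotopy : NaturallyHomotopic (Functor.whiskerRight (cylinderEnd J false) C)
    (Functor.whiskerRight (cylinderEnd J true) C)
  -- A homotopy, rather than vanishing homology, is asked for because it can be dualised.
  dimension : ∀ (X : Cl.{u}) [Unique X], ∃ p : C.obj X ⟶ C.obj X,
    Nonempty (Homotopy (𝟙 _) p) ∧ ∀ n, 1 ≤ n → p.f n = 0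
  small_zero : ∀ (X : Cl.{u}) (A B : Set X), interior A ∪ interior B = Set.univ →
    ∀ z : (C.obj X).X 0, ∃ (w : (C.obj X).X 1) (a : (C.obj ⟨A⟩).X 0) (b : (C.obj ⟨B⟩).X 0),
      z = (C.obj X).d 1 0 w + (C.map (X := ⟨A⟩) (Y := X) (inclMap A)).f 0 a +
        (C.map (X := ⟨B⟩) (Y := X) (inclMap B)).f 0 b
  small_succ : ∀ (X : Cl.{u}) (A B : Set X), interior A ∪ interior B = Set.univ →
    ∀ (n : ℕ) (z : (C.obj X).X (n + 1)) (a : (C.obj ⟨A⟩).X n) (b : (C.obj ⟨B⟩).X n),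
    (C.obj X).d (n + 1) n z = (C.map (X := ⟨A⟩) (Y := X) (inclMap A)).f n a +
        (C.map (X := ⟨B⟩) (Y := X) (inclMap B)).f n b →
    ∃ (w : (C.obj X).X (n + 2)) (a : (C.obj ⟨A⟩).X (n + 1)) (b : (C.obj ⟨B⟩).X (n + 1)),
      z = (C.obj X).d (n + 2) (n + 1) w +
        (C.map (X := ⟨A⟩) (Y := X) (inclMap A)).f (n + 1) a +
        (C.map (X := ⟨B⟩) (Y := X) (inclMap B)).f (n + 1) b

end CechClosure

namespace CechClosure

/-! ### The axioms for relative homology and cohomology -/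

section Axioms

open Limits HomologicalComplex

/-- The homology sequences involve `C(A)` and `C(X)`, whereas the axioms speak of the pairs `(A, ∅)`
and `(X, ∅)`; exactness is carried across the identification. -/
theorem function_exact_of_iso {S : ShortComplex AddCommGrpCat.{u}} (hS : S.Exact)
    {X₁ X₂ X₃ : AddCommGrpCat.{u}} {f : X₁ ⟶ X₂} {g : X₂ ⟶ X₃} (e₁ : S.X₁ ≅ X₁) (e₂ : S.X₂ ≅ X₂)
    (e₃ : S.X₃ ≅ X₃) (hf : e₁.hom ≫ f = S.f ≫ e₂.hom) (hg : e₂.hom ≫ g = S.g ≫ e₃.hom) :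
    Function.Exact f g := by
  have w : f ≫ g = 0 := by
    rw [← cancel_epi e₁.hom, reassoc_of% hf, hg, S.zero_assoc, zero_comp, comp_zero]
  exact (ShortComplex.ab_exact_iff_function_exact (ShortComplex.mk f g w)).1
    (ShortComplex.exact_of_iso (ShortComplex.isoMk e₁ e₂ e₃ hf hg) hS)

theorem paste_squares {V : Type v} [Category.{w} V] {A B D A' B' D' : V} {f : A ⟶ B} {g : B ⟶ D}
    {f' : A' ⟶ B'} {g' : B' ⟶ D'} {a : A ⟶ A'} {b : B ⟶ B'} {d : D ⟶ D'}
    (h : a ≫ f' = f ≫ b) (h' : b ≫ g' = g ≫ d) : a ≫ f' ≫ g' = (f ≫ g) ≫ d := by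
  rw [reassoc_of% h, h', Category.assoc]

variable (C : Cl.{u} ⥤ ChainComplex AddCommGrpCat.{u} ℕ)

/-- The sequence `C(A) → C(X) → C(X, A)`. -/
noncomputable abbrev pairSequence (P : ClPair.{u}) :
    ShortComplex (ChainComplex AddCommGrpCat.{u} ℕ) :=
  ShortComplex.mk (X₃ := (relativeChains C).obj P) (C.map (ClPair.inclusion.app P))
    (cokernel.π _) (cokernel.condition _)

/-- The map of sequences induced by a map of pairs. -/
noncomputable def pairSequenceMap {P Q : ClPair.{u}} (f : P ⟶ Q) :
    pairSequence C P ⟶ pairSequence C Q where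
  τ₁ := C.map (ClPair.subFunctor.map f)
  τ₂ := C.map (ClPair.totalFunctor.map f)
  τ₃ := (relativeChains C).map f
  comm₁₂ := by
    rw [← C.map_comp, ← C.map_comp, ClPair.inclusion.naturality]
  comm₂₃ := (cokernel.π_desc _ _ _).symm

/-- The map of dual sequences induced by a map of pairs. -/
noncomputable def dualPairSequenceMap (G : AddCommGrpCat.{u}) {P Q : ClPair.{u}} (f : P ⟶ Q) :
    dualShortComplex G (pairSequence C Q) ⟶ dualShortComplex G (pairSequence C P) where
  τ₁ := (dualComplex G).map (pairSequenceMap C f).τ₃.op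
  τ₂ := (dualComplex G).map (pairSequenceMap C f).τ₂.op
  τ₃ := (dualComplex G).map (pairSequenceMap C f).τ₁.op
  comm₁₂ := by
    rw [← Functor.map_comp, ← Functor.map_comp, ← op_comp, ← op_comp, (pairSequenceMap C f).comm₂₃]
  comm₂₃ := by
    rw [← Functor.map_comp, ← Functor.map_comp, ← op_comp, ← op_comp, (pairSequenceMap C f).comm₁₂]

/-- The map `C(X) → C(X, ∅)`. -/
noncomputable def toAbsolute : C ⟶ absFunctor ⋙ relativeChains C where
  app X := (pairSequence C (absPair X)).g
  naturality _ _ f := (pairSequenceMap C (absFunctor.map f)).comm₂₃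

/-- Under the comparison of `C(X)` with `C(X, ∅)`, the map induced by `j` becomes the quotient map
`C(X) → C(X, A)` of the short exact sequence. -/
theorem toAbsolute_pairJ (P : ClPair.{u}) :
    (toAbsolute C).app P.space ≫ (relativeChains C).map (pairJ P) = (pairSequence C P).g :=
  (pairSequenceMap C (pairJ P)).comm₂₃.symm.trans (by
    change C.map (𝟙 P.space) ≫ _ = _
    rw [C.map_id]
    exact Category.id_comp _)

variable {C} {J : IntervalKind} (hC : IsChainTheory J C)

include hC

/-- The retraction need not commute with the differential, so the splitting is claimed in each
degree separately. -/
theorem IsChainTheory.nonempty_splitting (P : ClPair.{u}) (n : ℕ) :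
    Nonempty ((pairSequence C P).map (HomologicalComplex.eval _ _ n)).Splitting := by
  obtain ⟨r, hr, -⟩ := hC.exists_retraction
  have : Epi ((pairSequence C P).map (HomologicalComplex.eval _ _ n)).g :=
    inferInstanceAs (Epi ((HomologicalComplex.eval _ _ n).map (cokernel.π (C.map (ClPair.inclusion.app P)))))
  exact ⟨ShortComplex.Splitting.ofExactOfRetraction _
    ((exact_iff_degreewise_exact _).1 (ShortComplex.exact_cokernel _) n) (r P n) (hr P n) this⟩

theorem IsChainTheory.shortExact (P : ClPair.{u}) : (pairSequence C P).ShortExact :=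
  shortExact_of_splitting fun n => (hC.nonempty_splitting P n).some

theorem IsChainTheory.dual_shortExact (G : AddCommGrpCat.{u}) (P : ClPair.{u}) :
    (dualShortComplex G (pairSequence C P)).ShortExact :=
  dualShortComplex_shortExact G fun n => (hC.nonempty_splitting P n).some

/-- The empty space has no chains, so `C(X, ∅)` is the cokernel of a zero map. -/
theorem IsChainTheory.isIso_toAbsolute : IsIso (toAbsolute C) := by
  have : ∀ X, IsIso ((toAbsolute C).app X) := fun X => by
    have : IsEmpty ((ClPair.subFunctor.obj (absPair X)).carrier) :=
      inferInstanceAs (IsEmpty (∅ : Set X))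
    have h : C.map (ClPair.inclusion.app (absPair X)) = 0 :=
      (hC.isZero_of_isEmpty (ClPair.subFunctor.obj (absPair X))).eq_of_src _ _
    change IsIso (cokernel.π (C.map (ClPair.inclusion.app (absPair X))))
    rw [h]
    infer_instance
  exact NatIso.isIso_of_isIso_app _

/-- The isomorphism `C(X) ≅ C(X, ∅)`. -/
noncomputable def IsChainTheory.absoluteIso : C ≅ absFunctor ⋙ relativeChains C :=
  have := hC.isIso_toAbsolute
  asIso (toAbsolute C)

/-- The isomorphism `H_n(C(X)) ≅ H_n(X, ∅)`. -/
noncomputable def IsChainTheory.homologyIso (n : ℕ) :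
    C ⋙ homologyFunctor _ _ n ≅ absFunctor ⋙ relativeHomology C n :=
  Functor.isoWhiskerRight hC.absoluteIso _

/-- The isomorphism `Hⁿ(X, ∅; G) ≅ Hⁿ(Hom(C(X), G))`. -/
noncomputable def IsChainTheory.cohomologyIso (G : AddCommGrpCat.{u}) (n : ℕ) :
    absFunctor.op ⋙ relativeCohomology C G n ≅ C.op ⋙ dualComplex G ⋙ homologyFunctor _ _ n :=
  Functor.isoWhiskerRight (NatIso.op hC.absoluteIso) (dualComplex G ⋙ homologyFunctor _ _ n)

/-- The connecting homomorphism `H_{n+1}(X, A) → H_n(A)`. -/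
noncomputable def IsChainTheory.bd (n : ℕ) :
    relativeHomology C (n + 1) ⟶ ClPair.restr ⋙ relativeHomology C n where
  app P := (hC.shortExact P).δ (n + 1) n (by simp) ≫
    (hC.homologyIso n).hom.app (ClPair.subFunctor.obj P)
  naturality P Q f := by
    have h := HomologySequence.δ_naturality (pairSequenceMap C f) (hC.shortExact P)
      (hC.shortExact Q) (n + 1) n (by simp)
    have h' := (hC.homologyIso n).hom.naturality (ClPair.subFunctor.map f)
    exact paste_squares h.symm h'

/-- The connecting homomorphism `Hⁿ(A; G) → Hⁿ⁺¹(X, A; G)`. -/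
noncomputable def IsChainTheory.cobd (G : AddCommGrpCat.{u}) (n : ℕ) :
    ClPair.restr.op ⋙ relativeCohomology C G n ⟶ relativeCohomology C G (n + 1) where
  app P := (hC.cohomologyIso G n).hom.app (op (ClPair.subFunctor.obj P.unop)) ≫
    (hC.dual_shortExact G P.unop).δ n (n + 1) (by simp)
  naturality P Q f := by
    have h := HomologySequence.δ_naturality
      (dualPairSequenceMap C G f.unop)
      (hC.dual_shortExact G P.unop) (hC.dual_shortExact G Q.unop) n (n + 1) (by simp)
    have h' := (hC.cohomologyIso G n).hom.naturality (ClPair.subFunctor.map f.unop).op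
    exact paste_squares h' h.symm

/-! ### Homotopy and dimension axioms for relative chains -/

/-- Homotopic maps of pairs induce chain homotopic maps of relative chains. -/
theorem IsChainTheory.nonempty_homotopy {P Q : ClPair.{u}} {f g : P ⟶ Q}
    (hfg : OneStepHomotopic J f g) :
    Nonempty (Homotopy ((relativeChains C).map f) ((relativeChains C).map g)) := by
  obtain ⟨H, hH₀, hH₁, hHs⟩ := hfg
  have hC' : ∃ h : ∀ (n : ℕ) (X : Cl.{u}), (C.obj X).X n ⟶ (C.obj ((cylinder J).obj X)).X (n + 1),
      (∀ (n : ℕ) {X Y : Cl.{u}} (f : X ⟶ Y),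
        (C.map f).f n ≫ h n Y = h n X ≫ (C.map ((cylinder J).map f)).f (n + 1)) ∧
      (∀ X, (C.map ((cylinderEnd J false).app X)).f 0 - (C.map ((cylinderEnd J true).app X)).f 0 =
        h 0 X ≫ (C.obj ((cylinder J).obj X)).d 1 0) ∧
      ∀ X n, (C.map ((cylinderEnd J false).app X)).f (n + 1) -
          (C.map ((cylinderEnd J true).app X)).f (n + 1) =
        (C.obj X).d (n + 1) n ≫ h n X +
          h (n + 1) X ≫ (C.obj ((cylinder J).obj X)).d (n + 2) (n + 1) := hC.homotopy
  obtain ⟨h, hnat, hzero, hsucc⟩ := hC'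
  let H' : (cylinder J).obj P.space ⟶ Q.space := H
  let e₀ : P.space ⟶ (cylinder J).obj P.space := (cylinderEnd J false).app P.space
  let e₁ : P.space ⟶ (cylinder J).obj P.space := (cylinderEnd J true).app P.space
  have hf : e₀ ≫ H' = f.map := ContMap.ext (funext hH₀)
  have hg : e₁ ≫ H' = g.map := ContMap.ext (funext hH₁)
  let iP : (⟨P.sub⟩ : Cl.{u}) ⟶ P.space := ClPair.inclusion.app P
  let iQ : (⟨Q.sub⟩ : Cl.{u}) ⟶ Q.space := ClPair.inclusion.app Q
  -- The homotopy restricts to `A × J → B`; it is regarded as defined on the cylinder over the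
  -- subspace `A`, where naturality of the prism can be applied.
  let K : (cylinder J).obj ⟨P.sub⟩ ⟶ (⟨Q.sub⟩ : Cl.{u}) :=
    ContMap.mk (fun p => ⟨H (p.1.1, p.2), hHs p.1.1 p.1.2 p.2⟩)
      ((H.cont.comp (((cylinder J).map iP).cont)).subtype _)
  have hK : (cylinder J).map iP ≫ H' = K ≫ iQ := rfl
  let π : C.obj Q.space ⟶ (relativeChains C).obj Q := (pairSequence C Q).g
  let ρ : C.obj P.space ⟶ (relativeChains C).obj P := (pairSequence C P).g
  have hπ : C.map iQ ≫ π = 0 := (pairSequence C Q).zero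
  have hρ : ∀ f : P ⟶ Q, ρ ≫ (relativeChains C).map f =
    C.map (Y := Q.space) f.map ≫ π := fun f => (pairSequenceMap C f).comm₂₃.symm
  have hρf : ρ ≫ (relativeChains C).map f = C.map e₀ ≫ C.map H' ≫ π := by
    rw [hρ, ← hf, C.map_comp, Category.assoc]
  have hρg : ρ ≫ (relativeChains C).map g = C.map e₁ ≫ C.map H' ≫ π := by
    rw [hρ, ← hg, C.map_comp, Category.assoc]
  have hd : ∀ n, ρ.f n ≫ (((relativeChains C).map f).f n - ((relativeChains C).map g).f n) =
      ((C.map e₀).f n - (C.map e₁).f n) ≫ (C.map H' ≫ π).f n := fun n => by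
    rw [Preadditive.comp_sub, ← comp_f, ← comp_f, hρf, hρg, comp_f, comp_f (C.map e₁),
      ← Preadditive.sub_comp]
  -- By naturality the prism on a chain of `A` lies over `A × J`, hence is sent into `C(B)` and
  -- vanishes in `C(Y, B)`. The prism therefore descends to relative chains.
  have ht : ∀ n, (C.map iP).f n ≫ h n P.space ≫ (C.map H' ≫ π).f (n + 1) = 0 := fun n => by
    rw [reassoc_of% hnat n iP, ← comp_f, ← C.map_comp_assoc, hK, C.map_comp, Category.assoc, hπ,
      comp_zero, zero_f, comp_zero]
  have ht_zero : ((C.map e₀).f 0 - (C.map e₁).f 0) ≫ (C.map H' ≫ π).f 0 =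
      (h 0 P.space ≫ (C.map H' ≫ π).f 1) ≫ ((relativeChains C).obj Q).d 1 0 := by
    rw [show (C.map e₀).f 0 - (C.map e₁).f 0 = _ from hzero P.space, Category.assoc,
      Category.assoc, (C.map H' ≫ π).comm]
  have ht_succ : ∀ n, ((C.map e₀).f (n + 1) - (C.map e₁).f (n + 1)) ≫ (C.map H' ≫ π).f (n + 1) =
      (C.obj P.space).d (n + 1) n ≫ h n P.space ≫ (C.map H' ≫ π).f (n + 1) +
      (h (n + 1) P.space ≫ (C.map H' ≫ π).f (n + 2)) ≫
        ((relativeChains C).obj Q).d (n + 2) (n + 1) := fun n => by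
    rw [show (C.map e₀).f (n + 1) - (C.map e₁).f (n + 1) = _ from hsucc P.space n,
      Preadditive.add_comp, Category.assoc, Category.assoc, Category.assoc, (C.map H' ≫ π).comm]
  exact nonempty_homotopy_of_lift (fun n => (hC.nonempty_splitting P n).some)
    (fun n => h n P.space ≫ (C.map H' ≫ π).f (n + 1)) ht ((hd 0).trans ht_zero)
    fun n => (hd (n + 1)).trans (ht_succ n)

theorem IsChainTheory.homologyMap_eq {P Q : ClPair.{u}} {f g : P ⟶ Q} (hfg : Homotopic J f g)
    (n : ℕ) : (relativeHomology C n).map f = (relativeHomology C n).map g := by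
  induction hfg with
  | rel f g h => exact (hC.nonempty_homotopy h).some.homologyMap_eq n
  | refl f => rfl
  | symm f g _ ih => exact ih.symm
  | trans f g k _ _ ih₁ ih₂ => exact ih₁.trans ih₂

theorem IsChainTheory.cohomologyMap_eq (G : AddCommGrpCat.{u}) {P Q : ClPair.{u}} {f g : P ⟶ Q}
    (hfg : Homotopic J f g) (n : ℕ) :
    (relativeCohomology C G n).map f.op = (relativeCohomology C G n).map g.op := by
  induction hfg with
  | rel f g h => exact (dualHomotopy G (hC.nonempty_homotopy h).some).homologyMap_eq n
  | refl f => rfl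
  | symm f g _ ih => exact ih.symm
  | trans f g k _ _ ih₁ ih₂ => exact ih₁.trans ih₂

theorem IsChainTheory.dimension_homology (X : Cl.{u}) [Unique X] (n : ℕ) (hn : 1 ≤ n) :
    Subsingleton ((relativeHomology C n).obj (absPair X)) := by
  obtain ⟨p, ⟨h⟩, hp⟩ := hC.dimension X
  have : Subsingleton ((C ⋙ homologyFunctor _ _ n).obj X) :=
    subsingleton_homology_of_homotopy h n (hp n hn)
  exact ((hC.homologyIso n).app X).symm.addCommGroupIsoToAddEquiv.toEquiv.subsingleton

/-- The dual of the homotopy between the identity and `p` again ends at a map that vanishes in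
degree `n`. -/
theorem IsChainTheory.dimension_cohomology (G : AddCommGrpCat.{u}) (X : Cl.{u}) [Unique X] (n : ℕ)
    (hn : 1 ≤ n) : Subsingleton ((relativeCohomology C G n).obj (op (absPair X))) := by
  obtain ⟨p, ⟨h⟩, hp⟩ := hC.dimension X
  have h' := dualHomotopy G h
  rw [op_id, CategoryTheory.Functor.map_id] at h'
  have hp' : ((dualComplex G).map p.op).f n = 0 := by
    ext (x : (C.obj X).X n ⟶ G)
    change p.f n ≫ x = 0
    rw [hp n hn, zero_comp]
  have : Subsingleton ((C.op ⋙ dualComplex G ⋙ homologyFunctor _ _ n).obj (op X)) :=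
    subsingleton_homology_of_homotopy h' n hp'
  exact ((hC.cohomologyIso G n).app (op X)).addCommGroupIsoToAddEquiv.toEquiv.subsingleton

/-! ### Excision and projectivity of relative chains -/

theorem IsChainTheory.surjective_relative (P : ClPair.{u}) (n : ℕ) :
    Function.Surjective ((pairSequence C P).g.f n) :=
  ((shortExact_iff_degreewise_shortExact _).1 (hC.shortExact P) n).ab_surjective_g

theorem IsChainTheory.exists_of_relative_eq_zero (P : ClPair.{u}) (n : ℕ)
    (x : (C.obj P.space).X n) (hx : (pairSequence C P).g.f n x = 0) :
    ∃ a, (C.map (ClPair.inclusion.app P)).f n a = x :=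
  (ShortComplex.ab_exact_iff _).1
    ((shortExact_iff_degreewise_shortExact _).1 (hC.shortExact P) n).exact x hx

/-- A chain which lies in `A` and in `B` lies in `A ∩ B`. -/
theorem IsChainTheory.exists_inter (X : Cl.{u}) (A B : Set X) (n : ℕ) (a : (C.obj ⟨A⟩).X n)
    (b : (C.obj ⟨B⟩).X n) (h : (C.map (X := ⟨A⟩) (Y := X) (inclMap A)).f n a =
      (C.map (X := ⟨B⟩) (Y := X) (inclMap B)).f n b) :
    ∃ y, (C.map (ClPair.inclusion.app (excPair X A B))).f n y = b := by
  obtain ⟨r, hr, hnat⟩ := hC.exists_retraction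
  -- This is the intersection as a subspace of `A`, mapped to the intersection as a subspace of `B`.
  let swap : ClPair.subFunctor.obj (excPair X B A) ⟶ ClPair.subFunctor.obj (excPair X A B) :=
    ContMap.mk (fun x => ⟨⟨x.1.1, x.2⟩, x.1.2⟩)
      (((((continuous_subtype_val A).comp (continuous_subtype_val _))).subtype _).subtype _)
  have hswap : ClPair.subFunctor.map (excMap X B A) =
    swap ≫ ClPair.inclusion.app (excPair X A B) := rfl
  -- Retracting from `X` onto `B` fixes `b`. Applied to `a`, it agrees with retracting from `A` onto
  -- `A ∩ B`, since the preimage of `B` in `A` is exactly `A ∩ B`. Hence `b` comes from the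
  -- retraction of `a`.
  have h₁ := ConcreteCategory.congr_hom (hr ⟨X, B⟩ n) b
  have h₂ := ConcreteCategory.congr_hom (hnat (excMap X B A) n fun _ hx => hx) a
  refine ⟨(C.map swap).f n (r (excPair X B A) n a), ?_⟩
  refine Eq.trans ?_ ((h₂.symm.trans (congrArg (r ⟨X, B⟩ n) h)).trans h₁)
  exact (ConcreteCategory.congr_hom (congr_hom ((congrArg C.map hswap).trans (C.map_comp _ _)) n)
    (r (excPair X B A) n a)).symm

/-- Injectivity in each degree says that a chain of `B` that also lies in `A` lies in `A ∩ B`. Small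
approximation shows that relative cycles come from `B` up to boundaries, the part in `A` being zero
in `C(X, A)`. -/
theorem IsChainTheory.quasiIso_excMap (X : Cl.{u}) (A B : Set X)
    (hAB : interior A ∪ interior B = Set.univ) :
    QuasiIso ((relativeChains C).map (excMap X A B)) := by
  let iA : C.obj ⟨A⟩ ⟶ C.obj X := C.map (X := ⟨A⟩) (Y := X) (inclMap A)
  let iB : C.obj ⟨B⟩ ⟶ C.obj X := C.map (X := ⟨B⟩) (Y := X) (inclMap B)
  let ρ : C.obj X ⟶ (relativeChains C).obj ⟨X, A⟩ := (pairSequence C ⟨X, A⟩).g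
  let ρ' : C.obj ⟨B⟩ ⟶ (relativeChains C).obj (excPair X A B) := (pairSequence C (excPair X A B)).g
  have hρ : ∀ n z, ρ.f n (iB.f n z) =
      ((relativeChains C).map (excMap X A B)).f n (ρ'.f n z) := fun n z =>
    ConcreteCategory.congr_hom
      (congr_hom (pairSequenceMap C (excMap X A B)).comm₂₃ n) z
  have hA : ∀ n a, ρ.f n (iA.f n a) = 0 := fun n a =>
    ConcreteCategory.congr_hom (congr_hom (pairSequence C ⟨X, A⟩).zero n) a
  have hd : ∀ i j z, ((relativeChains C).obj ⟨X, A⟩).d i j (ρ.f i z) = ρ.f j ((C.obj X).d i j z) :=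
    fun i j z => ConcreteCategory.congr_hom (ρ.comm i j) z
  have hsurj : ∀ n, Function.Surjective (ρ.f n) := hC.surjective_relative ⟨X, A⟩
  have hsurj' : ∀ n, Function.Surjective (ρ'.f n) := hC.surjective_relative (excPair X A B)
  have hex : ∀ n x, ρ.f n x = 0 → ∃ a, iA.f n a = x := hC.exists_of_relative_eq_zero ⟨X, A⟩
  refine quasiIso_of_injective _ (fun n => ?_) (fun z => ?_) fun n z y hzy => ?_
  · rw [injective_iff_map_eq_zero]
    intro x hx
    obtain ⟨b, rfl⟩ := hsurj' n x
    rw [← hρ] at hx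
    obtain ⟨a, ha⟩ := hex n _ hx
    obtain ⟨y, rfl⟩ := hC.exists_inter X A B n a b ha
    exact ConcreteCategory.congr_hom (congr_hom (pairSequence C (excPair X A B)).zero n) y
  · obtain ⟨z, rfl⟩ := hsurj 0 z
    obtain ⟨w, a, b, h⟩ := hC.small_zero X A B hAB z
    have h : z = (C.obj X).d 1 0 w + iA.f 0 a + iB.f 0 b := h
    refine ⟨ρ.f 1 w, ρ'.f 0 b, ?_⟩
    rw [h, map_add, map_add, hA, hρ, hd, add_zero]
  · obtain ⟨z, rfl⟩ := hsurj (n + 1) z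
    obtain ⟨y, rfl⟩ := hsurj' n y
    rw [hd, ← hρ, ← sub_eq_zero, ← map_sub] at hzy
    obtain ⟨a, ha⟩ := hex n _ hzy
    -- The boundary of a representative `z` agrees with a chain of `B` modulo `C(A)`, so it is small
    -- and approximation applies.
    obtain ⟨w, a, b, h⟩ := hC.small_succ X A B hAB n z a y (sub_eq_iff_eq_add.1 ha.symm)
    have h : z = (C.obj X).d (n + 2) (n + 1) w + iA.f (n + 1) a + iB.f (n + 1) b := h
    refine ⟨ρ.f (n + 2) w, ρ'.f (n + 1) b, ?_⟩
    rw [h, map_add, map_add, hA, hρ, hd, add_zero]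

/-- The splitting exhibits the relative chains as a retract of the projective group of absolute
chains. -/
theorem IsChainTheory.projective_relativeChains (P : ClPair.{u}) (n : ℕ) :
    Projective (((relativeChains C).obj P).X n) := by
  let s := (hC.nonempty_splitting P n).some
  have : Projective ((pairSequence C P).map (HomologicalComplex.eval _ _ n)).X₂ :=
    hC.projective P.space n
  exact Retract.projective ⟨s.s, _, s.s_g⟩

theorem IsChainTheory.isHomologyTheory : IsHomologyTheory J (relativeHomology C) hC.bd where
  homotopy f g hfg n := hC.homologyMap_eq hfg n
  excision X A B hAB n := by
    have := hC.quasiIso_excMap X A B hAB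
    exact inferInstanceAs (IsIso (homologyMap ((relativeChains C).map (excMap X A B)) n))
  dimension X _ n hn := hC.dimension_homology X n hn
  exact_space P n := function_exact_of_iso ((hC.shortExact P).homology_exact₂ n)
    ((hC.homologyIso n).app ⟨P.sub⟩) ((hC.homologyIso n).app P.space) (Iso.refl _)
    ((hC.homologyIso n).hom.naturality (ClPair.inclusion.app P)).symm
    ((homologyMap_comp _ _ n).symm.trans
      ((congrArg (fun f => homologyMap f n) (toAbsolute_pairJ C P)).trans (Category.comp_id _).symm))
  exact_pair P n := function_exact_of_iso
    ((hC.shortExact P).homology_exact₃ (n + 1) n (by simp))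
    ((hC.homologyIso (n + 1)).app P.space) (Iso.refl _) ((hC.homologyIso n).app ⟨P.sub⟩)
    ((homologyMap_comp _ _ _).symm.trans
      ((congrArg (fun f => homologyMap f (n + 1)) (toAbsolute_pairJ C P)).trans
        (Category.comp_id _).symm))
    (Category.id_comp _)
  exact_sub P n := function_exact_of_iso
    ((hC.shortExact P).homology_exact₁ (n + 1) n (by simp))
    (Iso.refl _) ((hC.homologyIso n).app ⟨P.sub⟩) ((hC.homologyIso n).app P.space)
    (Category.id_comp _) ((hC.homologyIso n).hom.naturality (ClPair.inclusion.app P)).symm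
  exact_end P := by
    have h := (hC.shortExact P).epi_g
    have h₁ : Epi (homologyMap (pairSequence C P).g 0) :=
      epi_homologyMap_of_epi_of_not_rel _ _ (by simp)
    have h₂ : homologyMap ((toAbsolute C).app P.space) 0 ≫ (relativeHomology C 0).map (pairJ P) =
        homologyMap (pairSequence C P).g 0 := (homologyMap_comp _ _ 0).symm.trans
      (congrArg (fun f => homologyMap f 0) (toAbsolute_pairJ C P))
    exact (AddCommGrpCat.epi_iff_surjective _).1 (@epi_of_epi_fac _ _ _ _ _ _ _ _ h₁ h₂)

theorem IsChainTheory.cohomologyMap_pairJ (G : AddCommGrpCat.{u}) (P : ClPair.{u}) (n : ℕ) :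
    (relativeCohomology C G n).map (pairJ P).op =
      homologyMap (dualShortComplex G (pairSequence C P)).f n ≫
        (hC.cohomologyIso G n).inv.app (op P.space) := by
  have h := congrArg (fun f => homologyMap ((dualComplex G).map f.op) n) (toAbsolute_pairJ C P)
  rw [op_comp, Functor.map_comp, homologyMap_comp] at h
  have h' : (relativeCohomology C G n).map (pairJ P).op ≫
      (hC.cohomologyIso G n).hom.app (op P.space) =
        homologyMap (dualShortComplex G (pairSequence C P)).f n := h
  rw [← h']
  exact ((Category.assoc _ _ _).trans ((congrArg (_ ≫ ·)
    ((hC.cohomologyIso G n).hom_inv_id_app (op P.space))).trans (Category.comp_id _))).symm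

theorem IsChainTheory.isCohomologyTheory (G : AddCommGrpCat.{u}) :
    IsCohomologyTheory J (relativeCohomology C G) (hC.cobd G) where
  homotopy f g hfg n := hC.cohomologyMap_eq G hfg n
  excision X A B hAB n := by
    have := hC.projective_relativeChains
    have := hC.quasiIso_excMap X A B hAB
    -- A quasi-isomorphism between nonnegative complexes of projectives is a homotopy equivalence.
    exact isIso_homologyMap_dual G ((ChainComplex.quasiIso_iff_of_projective _).1 this) n
  dimension X _ n hn := hC.dimension_cohomology G X n hn
  exact_space P n := function_exact_of_iso ((hC.dual_shortExact G P).homology_exact₂ n)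
    (Iso.refl _) ((hC.cohomologyIso G n).symm.app (op P.space))
    ((hC.cohomologyIso G n).symm.app (op ⟨P.sub⟩))
    ((Category.id_comp _).trans (hC.cohomologyMap_pairJ G P n))
    ((hC.cohomologyIso G n).inv.naturality (ClPair.inclusion.app P).op).symm
  exact_sub P n := function_exact_of_iso
    ((hC.dual_shortExact G P).homology_exact₃ n (n + 1) (by simp))
    ((hC.cohomologyIso G n).symm.app (op P.space)) ((hC.cohomologyIso G n).symm.app (op ⟨P.sub⟩))
    (Iso.refl _) ((hC.cohomologyIso G n).inv.naturality (ClPair.inclusion.app P).op).symm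
    (((hC.cohomologyIso G n).inv_hom_id_app_assoc _ _).trans (Category.comp_id _).symm)
  exact_pair P n := function_exact_of_iso
    ((hC.dual_shortExact G P).homology_exact₁ n (n + 1) (by simp))
    ((hC.cohomologyIso G n).symm.app (op ⟨P.sub⟩)) (Iso.refl _)
    ((hC.cohomologyIso G (n + 1)).symm.app (op P.space))
    (((hC.cohomologyIso G n).inv_hom_id_app_assoc _ _).trans (Category.comp_id _).symm)
    ((Category.id_comp _).trans (hC.cohomologyMap_pairJ G P (n + 1)))
  exact_start P := by
    have h := (hC.dual_shortExact G P).mono_f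
    have h₁ : Mono (homologyMap (dualShortComplex G (pairSequence C P)).f 0) :=
      mono_homologyMap_of_mono_of_not_rel _ _ (by simp)
    have h₂ := hC.cohomologyMap_pairJ G P 0
    have h₃ : Mono ((hC.cohomologyIso G 0).inv.app (op P.space)) := inferInstance
    rw [h₂]
    exact (AddCommGrpCat.mono_iff_injective _).1 (@mono_comp _ _ _ _ _ _ h₁ _ h₃)

end Axioms

end CechClosure

namespace CechClosure

/-! ### Chains generated by models -/

/-- A presentation of a functor of chains: in degree `n` it is generated freely by the maps from a
model, up to those which factor through one of finitely many commuting idempotents. -/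
structure ChainModel (C : Cl.{u} ⥤ ChainComplex AddCommGrpCat.{u} ℕ) where
  model : ℕ → Cl.{u}
  nonempty : ∀ n, Nonempty (model n)
  idx : ℕ → Type
  finite : ∀ n, Finite (idx n)
  proj : ∀ {n}, idx n → (model n ⟶ model n)
  proj_idem : ∀ {n} (i : idx n), proj i ≫ proj i = proj i
  proj_comm : ∀ {n} (i j : idx n), proj i ≫ proj j = proj j ≫ proj i
  gen : ∀ {n} {X : Cl.{u}}, (model n ⟶ X) → (C.obj X).X n
  map_gen : ∀ {n} {X Y : Cl.{u}} (f : X ⟶ Y) (σ : model n ⟶ X),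
    (C.map f).f n (gen σ) = gen (σ ≫ f)
  gen_eq_zero : ∀ {n} {X : Cl.{u}} (σ : model n ⟶ X) (i : idx n), proj i ≫ σ = σ → gen σ = 0
  closure_range_gen : ∀ n (X : Cl.{u}),
    AddSubgroup.closure (Set.range (gen : (model n ⟶ X) → (C.obj X).X n)) = ⊤
  -- Freeness: a function on generators extends to a homomorphism as soon as it kills the degenerate
  -- ones.
  exists_lift : ∀ {n} {X : Cl.{u}} {G : AddCommGrpCat.{u}} (φ : (model n ⟶ X) → G),
    (∀ σ (i : idx n), proj i ≫ σ = σ → φ σ = 0) → ∃ f : (C.obj X).X n ⟶ G, ∀ σ, f (gen σ) = φ σ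

namespace ChainModel

open HomologicalComplex

variable {C : Cl.{u} ⥤ ChainComplex AddCommGrpCat.{u} ℕ} (M : ChainModel C)

include M

theorem hom_ext {n : ℕ} {X : Cl.{u}} {G : AddCommGrpCat.{u}} {f g : (C.obj X).X n ⟶ G}
    (h : ∀ σ : M.model n ⟶ X, f (M.gen σ) = g (M.gen σ)) : f = g := by
  refine AddCommGrpCat.hom_ext (AddMonoidHom.eq_of_eqOn_dense (M.closure_range_gen n X) ?_)
  rintro _ ⟨σ, rfl⟩
  exact h σ

theorem induction {n : ℕ} {X : Cl.{u}} (p : (C.obj X).X n → Prop) (h_zero : p 0)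
    (h_gen : ∀ σ, p (M.gen σ)) (h_sub : ∀ x y, p x → p y → p (x - y)) (x : (C.obj X).X n) :
    p x := by
  have hneg : ∀ x, p x → p (-x) := fun x hx => by simpa using h_sub 0 x h_zero hx
  have hx : x ∈ AddSubgroup.closure (Set.range (M.gen : (M.model n ⟶ X) → (C.obj X).X n)) := by
    rw [M.closure_range_gen]
    trivial
  induction hx using AddSubgroup.closure_induction with
  | mem x hx =>
    obtain ⟨σ, rfl⟩ := hx
    exact h_gen σ
  | zero => exact h_zero
  | add x y _ _ hx hy => simpa using h_sub _ _ hx (hneg _ hy)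
  | neg x _ hx => exact hneg x hx

/-- The chains are a retract of the free group on all maps from the model: the section sends a
degenerate generator to zero and any other to itself. -/
theorem projective (X : Cl.{u}) (n : ℕ) : Projective ((C.obj X).X n) := by
  classical
  let F : AddCommGrpCat.{u} := AddCommGrpCat.free.obj (M.model n ⟶ X)
  have : Projective F := AddCommGrpCat.adj.map_projective _ inferInstance
  obtain ⟨s, hs⟩ := M.exists_lift (n := n) (X := X) (G := F)
    (fun σ => if ∃ i : M.idx n, M.proj i ≫ σ = σ then 0 else FreeAbelianGroup.of σ)
    fun σ i hi => if_pos ⟨i, hi⟩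
  let r : F ⟶ (C.obj X).X n := AddCommGrpCat.ofHom (FreeAbelianGroup.lift M.gen)
  refine Retract.projective ⟨s, r, M.hom_ext fun σ => ?_⟩
  change r (s (M.gen σ)) = M.gen σ
  by_cases h : ∃ i : M.idx n, M.proj i ≫ σ = σ
  · refine (congrArg r ((hs σ).trans (if_pos h))).trans ((map_zero r.hom).trans ?_)
    obtain ⟨i, hi⟩ := h
    exact (M.gen_eq_zero σ i hi).symm
  · exact (congrArg r ((hs σ).trans (if_neg h))).trans (FreeAbelianGroup.lift_apply_of _ _)

theorem isZero_of_isEmpty (X : Cl.{u}) [IsEmpty X] : Limits.IsZero (C.obj X) := by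
  rw [Limits.IsZero.iff_id_eq_zero]
  ext1 n
  refine M.hom_ext fun σ => ?_
  obtain ⟨x⟩ := M.nonempty n
  exact isEmptyElim (ContMap.toFun σ x)

/-- The corestriction of a map to a subspace. -/
def corestrict {X Y : Cl.{u}} (σ : Y ⟶ X) (A : Set X) (h : ∀ y, ContMap.toFun σ y ∈ A) :
    Y ⟶ (⟨A⟩ : Cl.{u}) :=
  ContMap.mk (fun y => ⟨ContMap.toFun σ y, h y⟩) ((ContMap.cont σ).subtype h)

/-- Generators with image in the subspace are kept and all others are sent to zero. This respects
the relations, because a degenerate map stays degenerate after corestriction. -/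
theorem exists_retraction : ∃ r : ∀ (P : ClPair.{u}) (n : ℕ),
    (C.obj (ClPair.totalFunctor.obj P)).X n ⟶ (C.obj (ClPair.subFunctor.obj P)).X n,
    (∀ P n, (C.map (ClPair.inclusion.app P)).f n ≫ r P n = 𝟙 _) ∧
    ∀ {P Q : ClPair.{u}} (f : P ⟶ Q) (n : ℕ), (∀ x, f.map x ∈ Q.sub → x ∈ P.sub) →
      (C.map (ClPair.totalFunctor.map f)).f n ≫ r Q n =
        r P n ≫ (C.map (ClPair.subFunctor.map f)).f n := by
  classical
  have hr : ∀ (P : ClPair.{u}) (n : ℕ), ∃ r : (C.obj (ClPair.totalFunctor.obj P)).X n ⟶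
      (C.obj (ClPair.subFunctor.obj P)).X n, ∀ σ : M.model n ⟶ P.space,
      r (M.gen σ) = if h : ∀ y, ContMap.toFun σ y ∈ P.sub then
        M.gen (X := ⟨P.sub⟩) (corestrict σ P.sub h) else 0 := fun P n => by
    refine M.exists_lift _ fun σ i hi => ?_
    split_ifs with h
    · refine M.gen_eq_zero _ i (ContMap.ext (funext fun y => Subtype.ext ?_))
      exact congrFun (congrArg ContMap.toFun hi) y
    · rfl
  choose r hr using hr
  refine ⟨r, fun P n => M.hom_ext fun σ => ?_, fun {P Q} f n hf => M.hom_ext fun σ => ?_⟩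
  · change r P n ((C.map (ClPair.inclusion.app P)).f n (M.gen σ)) = M.gen σ
    rw [M.map_gen]
    exact (hr P n _).trans (dif_pos fun y => (ContMap.toFun σ y).2)
  · change r Q n ((C.map (ClPair.totalFunctor.map f)).f n (M.gen σ)) =
      (C.map (ClPair.subFunctor.map f)).f n (r P n (M.gen σ))
    rw [M.map_gen]
    by_cases h : ∀ y, ContMap.toFun σ y ∈ P.sub
    · have h₁ := (hr Q n (σ ≫ ClPair.totalFunctor.map f)).trans (dif_pos fun y => f.mapsTo (h y))
      have h₂ := (hr P n σ).trans (dif_pos h)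
      exact h₁.trans ((M.map_gen (ClPair.subFunctor.map f) (corestrict σ P.sub h)).symm.trans
        (congrArg _ h₂.symm))
    -- A discarded generator must still be discarded after composing with `f`; this is where the
    -- condition on preimages enters.
    · have h₁ := (hr Q n (σ ≫ ClPair.totalFunctor.map f)).trans
        (dif_neg fun h' => h fun y => hf _ (h' y))
      have h₂ := (hr P n σ).trans (dif_neg h)
      exact h₁.trans ((map_zero _).symm.trans (congrArg _ h₂.symm))

/-- If every generator lies in `A` or in `B`, then so does every chain. -/
theorem exists_add {n : ℕ} {X : Cl.{u}} {A B : Set X}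
    (h : ∀ σ : M.model n ⟶ X, (∀ y, ContMap.toFun σ y ∈ A) ∨ ∀ y, ContMap.toFun σ y ∈ B)
    (z : (C.obj X).X n) :
    ∃ a b, z = (C.map (X := ⟨A⟩) (Y := X) (inclMap A)).f n a +
      (C.map (X := ⟨B⟩) (Y := X) (inclMap B)).f n b := by
  induction z using M.induction with
  | h_zero => exact ⟨0, 0, by simp⟩
  | h_gen σ =>
    rcases h σ with h | h
    · refine ⟨M.gen (corestrict σ A h), 0, ?_⟩
      rw [M.map_gen, map_zero, add_zero]
      rfl
    · refine ⟨0, M.gen (corestrict σ B h), ?_⟩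
      rw [M.map_gen, map_zero, zero_add]
      rfl
  | h_sub x y hx hy =>
    obtain ⟨a, b, rfl⟩ := hx
    obtain ⟨a', b', rfl⟩ := hy
    refine ⟨a - a', b - b', ?_⟩
    rw [map_sub, map_sub]
    abel

/-- Natural maps out of chains with models lift along the differential as soon as they do so on
the models. -/
theorem exists_natural_lift {G : Cl.{u} ⥤ ChainComplex AddCommGrpCat.{u} ℕ} {n m : ℕ}
    (t : ∀ X : Cl.{u}, (C.obj X).X n ⟶ (G.obj X).X m)
    (ht : ∀ {X Y : Cl.{u}} (f : X ⟶ Y), (C.map f).f n ≫ t Y = t X ≫ (G.map f).f m)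
    (h : ∃ y, (G.obj (M.model n)).d (m + 1) m y = t (M.model n) (M.gen (𝟙 _))) :
    ∃ s : ∀ X : Cl.{u}, (C.obj X).X n ⟶ (G.obj X).X (m + 1),
      (∀ {X Y : Cl.{u}} (f : X ⟶ Y), (C.map f).f n ≫ s Y = s X ≫ (G.map f).f (m + 1)) ∧
      ∀ X, s X ≫ (G.obj X).d (m + 1) m = t X := by
  classical
  have hte : ∀ {X Y : Cl.{u}} (f : X ⟶ Y) x, t Y ((C.map f).f n x) = (G.map f).f m (t X x) :=
    fun f x => ConcreteCategory.congr_hom (ht f) x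
  have hGd : ∀ {X Y : Cl.{u}} (f : X ⟶ Y) y,
      (G.obj Y).d (m + 1) m ((G.map f).f (m + 1) y) = (G.map f).f m ((G.obj X).d (m + 1) m y) :=
    fun f y => ConcreteCategory.congr_hom ((G.map f).comm (m + 1) m) y
  have hGc : ∀ {X Y Z : Cl.{u}} (f : X ⟶ Y) (g : Y ⟶ Z) y,
      (G.map g).f (m + 1) ((G.map f).f (m + 1) y) = (G.map (f ≫ g)).f (m + 1) y := fun f g y =>
    (ConcreteCategory.congr_hom (congr_hom (G.map_comp f g) (m + 1)) y).symm
  -- The lift should send `σ` to `σ_* y`, which must vanish for degenerate `σ`. It suffices that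
  -- every idempotent kills `y`, and `y` is corrected one idempotent `p` at a time by passing to `y
  -- - p_* y`.
  have key : ∀ S : Finset (M.idx n), ∃ y, (G.obj (M.model n)).d (m + 1) m y =
      t (M.model n) (M.gen (𝟙 _)) ∧ ∀ i ∈ S, (G.map (M.proj i)).f (m + 1) y = 0 := by
    intro S
    induction S using Finset.induction_on with
    | empty => simpa using h
    | insert j S _ ih =>
      obtain ⟨y, hy, hS⟩ := ih
      refine ⟨y - (G.map (M.proj j)).f (m + 1) y, ?_, fun i hi => ?_⟩
      -- The correction does not change the boundary: its own boundary is the value of `t` on the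
      -- degenerate generator given by the idempotent, hence zero.
      · rw [map_sub, hGd, hy, ← hte, M.map_gen, Category.id_comp,
          M.gen_eq_zero _ j (M.proj_idem j), map_zero, sub_zero]
      · rw [map_sub, hGc]
        rcases Finset.mem_insert.1 hi with rfl | hi
        · rw [M.proj_idem, sub_self]
        -- Commuting the idempotents preserves the vanishing already achieved.
        · rw [← M.proj_comm, ← hGc, hS i hi, map_zero, sub_zero]
  have := M.finite n
  have := Fintype.ofFinite (M.idx n)
  obtain ⟨y, hy, hproj⟩ := key Finset.univ
  have hs : ∀ X : Cl.{u}, ∃ s : (C.obj X).X n ⟶ (G.obj X).X (m + 1), ∀ σ : M.model n ⟶ X,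
      s (M.gen σ) = (G.map σ).f (m + 1) y := fun X =>
    M.exists_lift _ fun σ i hi => by
      rw [← hi, ← hGc, hproj i (Finset.mem_univ i), map_zero]
  choose s hs using hs
  refine ⟨s, fun {X Y} f => M.hom_ext fun σ => ?_, fun X => M.hom_ext fun σ => ?_⟩
  · change s Y ((C.map f).f n (M.gen σ)) = (G.map f).f (m + 1) (s X (M.gen σ))
    rw [M.map_gen, hs, hs, hGc]
  · change (G.obj X).d (m + 1) m (s X (M.gen σ)) = t X (M.gen σ)
    rw [hs, hGd, hy, ← hte, M.map_gen, Category.id_comp]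

end ChainModel

end CechClosure

namespace CechClosure

/-! ### Acyclic models -/

/-- Recursion with an invariant: each component of a chain map or homotopy is chosen so as to be
compatible with the previous one and to allow the next choice. -/
theorem exists_seq {α : ℕ → Type v} (Q : ∀ n, α n → Prop) (R : ∀ n, α n → α (n + 1) → Prop)
    (a₀ : α 0) (h₀ : Q 0 a₀) (h : ∀ n a, Q n a → ∃ b, Q (n + 1) b ∧ R n a b) :
    ∃ f : ∀ n, α n, f 0 = a₀ ∧ (∀ n, Q n (f n)) ∧ ∀ n, R n (f n) (f (n + 1)) := by
  choose g hg hg' using h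
  let F : ∀ n, {a : α n // Q n a} := fun n =>
    Nat.rec ⟨a₀, h₀⟩ (fun n a => ⟨g n a.1 a.2, hg n a.1 a.2⟩) n
  exact ⟨fun n => (F n).1, rfl, fun n => (F n).2, fun n => hg' n (F n).1 (F n).2⟩

/-- Exactness of a chain complex of abelian groups in positive degrees. -/
def ExactInPosDegrees (K : ChainComplex AddCommGrpCat.{u} ℕ) : Prop :=
  ∀ (m : ℕ) (x : K.X (m + 1)), K.d (m + 1) m x = 0 → ∃ w, K.d (m + 2) (m + 1) w = x

theorem homotopy_comm_succ {K L : ChainComplex AddCommGrpCat.{u} ℕ} {f g : K ⟶ L}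
    (h : Homotopy f g) (m : ℕ) (x : K.X (m + 1)) :
    f.f (m + 1) x = h.hom m (m + 1) (K.d (m + 1) m x) +
      L.d (m + 2) (m + 1) (h.hom (m + 1) (m + 2) x) + g.f (m + 1) x := by
  have := h.comm (m + 1)
  rw [Homotopy.prevD_chainComplex, Homotopy.dNext_succ_chainComplex] at this
  exact ConcreteCategory.congr_hom this x

theorem exactInPosDegrees_of_homotopy {K : ChainComplex AddCommGrpCat.{u} ℕ} {p : K ⟶ K}
    (h : Homotopy (𝟙 K) p) (hp : ∀ n, 1 ≤ n → p.f n = 0) : ExactInPosDegrees K := by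
  intro m x hx
  refine ⟨h.hom (m + 1) (m + 2) x, ?_⟩
  have := homotopy_comm_succ h m x
  rw [hx, map_zero, zero_add, hp (m + 1) (by lia)] at this
  exact (this.trans (add_zero _)).symm

/-- The one-point closure space. -/
def point : Cl.{u} := @Cl.mk PUnit (indiscrete _)

instance : Unique point.{u} := inferInstanceAs (Unique PUnit)

/-- The map to the point. -/
def toPoint (X : Cl.{u}) : X ⟶ point := ContMap.mk (fun _ => PUnit.unit) (continuous_const _)

/-- The map from the point. -/
def fromPoint {X : Cl.{u}} (x : X) : point ⟶ X := ContMap.mk (fun _ => x) (continuous_const _)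

/-- A space which is contractible by a homotopy starting at a constant map. -/
def IsContractible (J : IntervalKind) (X : Cl.{u}) : Prop :=
  ∃ (x : X) (H : (cylinder J).obj X ⟶ X),
    (cylinderEnd J false).app X ≫ H = toPoint X ≫ fromPoint x ∧
    (cylinderEnd J true).app X ≫ H = 𝟙 X

section

variable {J : IntervalKind} {C : Cl.{u} ⥤ ChainComplex AddCommGrpCat.{u} ℕ}

/-- The prism on `X` is pushed forward along the contraction, which turns the two ends of the
cylinder into the constant map and the identity. -/
theorem exists_contraction
    (hC : NaturallyHomotopic (Functor.whiskerRight (cylinderEnd J false) C)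
      (Functor.whiskerRight (cylinderEnd J true) C)) {X : Cl.{u}} (hX : IsContractible J X) :
    ∃ (x : X), ∃ h : ∀ n, (C.obj X).X n ⟶ (C.obj X).X (n + 1),
      (∀ z, (C.map (fromPoint x)).f 0 ((C.map (toPoint X)).f 0 z) - z =
        (C.obj X).d 1 0 (h 0 z)) ∧
      ∀ n z, (C.map (fromPoint x)).f (n + 1) ((C.map (toPoint X)).f (n + 1) z) - z =
        h n ((C.obj X).d (n + 1) n z) + (C.obj X).d (n + 2) (n + 1) (h (n + 1) z) := by
  obtain ⟨x, H, h₀, h₁⟩ := hX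
  obtain ⟨h, -, hzero, hsucc⟩ := hC
  have e₀ : ∀ n z, (C.map H).f n ((C.map ((cylinderEnd J false).app X)).f n z) =
      (C.map (fromPoint x)).f n ((C.map (toPoint X)).f n z) := fun n z =>
    ConcreteCategory.congr_hom (HomologicalComplex.congr_hom
      ((C.map_comp _ _).symm.trans ((congrArg C.map h₀).trans (C.map_comp _ _))) n) z
  have e₁ : ∀ n z, (C.map H).f n ((C.map ((cylinderEnd J true).app X)).f n z) = z := fun n z =>
    ConcreteCategory.congr_hom (HomologicalComplex.congr_hom
      ((C.map_comp _ _).symm.trans ((congrArg C.map h₁).trans (C.map_id _))) n) z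
  have hd : ∀ i j z, (C.obj X).d i j ((C.map H).f i z) =
      (C.map H).f j ((C.obj ((cylinder J).obj X)).d i j z) := fun i j z =>
    ConcreteCategory.congr_hom ((C.map H).comm i j) z
  refine ⟨x, fun n => h n X ≫ (C.map H).f (n + 1), fun z => ?_, fun n z => ?_⟩
  · have := congrArg ((C.map H).f 0) (ConcreteCategory.congr_hom (hzero X) z)
    refine Eq.trans ?_ (this.trans (hd 1 0 (h 0 X z)).symm)
    rw [← e₀]
    nth_rw 2 [← e₁ 0 z]
    exact (map_sub _ _ _).symm
  · have := congrArg ((C.map H).f (n + 1)) (ConcreteCategory.congr_hom (hsucc X n) z)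
    refine Eq.trans ?_ (this.trans ((map_add _ _ _).trans
      (congrArg (_ + ·) (hd (n + 2) (n + 1) (h (n + 1) X z)).symm)))
    rw [← e₀]
    nth_rw 2 [← e₁ (n + 1) z]
    exact (map_sub _ _ _).symm

theorem exactInPosDegrees_of_isContractible
    (hC : NaturallyHomotopic (Functor.whiskerRight (cylinderEnd J false) C)
      (Functor.whiskerRight (cylinderEnd J true) C)) (hpt : ExactInPosDegrees (C.obj point))
    {X : Cl.{u}} (hX : IsContractible J X) : ExactInPosDegrees (C.obj X) := by
  intro m z hz
  obtain ⟨x, h, -, hsucc⟩ := exists_contraction hC hX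
  have hd : ∀ {X Y : Cl.{u}} (f : X ⟶ Y) i j z, (C.obj Y).d i j ((C.map f).f i z) =
      (C.map f).f j ((C.obj X).d i j z) := fun f i j z =>
    ConcreteCategory.congr_hom ((C.map f).comm i j) z
  obtain ⟨w, hw⟩ := hpt m ((C.map (toPoint X)).f (m + 1) z) (by rw [hd, hz, map_zero])
  -- A cycle `z` equals its image through the point minus the boundary of the contraction of `z`,
  -- and the image bounds because the cycle bounds in the point.
  refine ⟨(C.map (fromPoint x)).f (m + 2) w - h (m + 1) z, ?_⟩
  have := hsucc m z
  rw [hz, map_zero, zero_add] at this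
  rw [map_sub, hd, hw, ← this, sub_sub_cancel]

end

namespace ChainModel

variable {F G : Cl.{u} ⥤ ChainComplex AddCommGrpCat.{u} ℕ} (M : ChainModel F)

include M

/-- Acyclic models: a natural map in degree zero extends upward, since the next obstruction on each
model is a cycle and bounds there. The first obstruction lies in degree zero, where the models are
not assumed exact, so `h₀` supplies its solution. -/
theorem exists_chainMap (t₀ : ∀ X : Cl.{u}, (F.obj X).X 0 ⟶ (G.obj X).X 0)
    (ht₀ : ∀ {X Y : Cl.{u}} (f : X ⟶ Y), (F.map f).f 0 ≫ t₀ Y = t₀ X ≫ (G.map f).f 0)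
    (h₀ : ∀ x, ∃ w, (G.obj (M.model 1)).d 1 0 w = t₀ _ ((F.obj (M.model 1)).d 1 0 x))
    (hG : ∀ n, ExactInPosDegrees (G.obj (M.model n))) :
    ∃ φ : F ⟶ G, ∀ X, (φ.app X).f 0 = t₀ X := by
  obtain ⟨t, htz, htn, htc⟩ := exists_seq
    (α := fun n => ∀ X : Cl.{u}, (F.obj X).X n ⟶ (G.obj X).X n)
    (fun n t => (∀ {X Y : Cl.{u}} (f : X ⟶ Y), (F.map f).f n ≫ t Y = t X ≫ (G.map f).f n) ∧
      ∀ x : (F.obj (M.model (n + 1))).X (n + 1), ∃ w, (G.obj (M.model (n + 1))).d (n + 1) n w =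
        t _ ((F.obj (M.model (n + 1))).d (n + 1) n x))
    (fun n t t' => ∀ X, t' X ≫ (G.obj X).d (n + 1) n = (F.obj X).d (n + 1) n ≫ t X)
    t₀ ⟨ht₀, h₀⟩ (by
      rintro n t ⟨htn, htd⟩
      obtain ⟨s, hsn, hs⟩ := M.exists_natural_lift (n := n + 1) (m := n)
        (fun X => (F.obj X).d (n + 1) n ≫ t X) (fun {X Y} f => by
          rw [(F.map f).comm_assoc, htn, Category.assoc]) (htd (M.gen (𝟙 _)))
      refine ⟨s, ⟨hsn, fun x => hG (n + 2) n _ ?_⟩, hs⟩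
      have : ∀ X, (F.obj X).d (n + 2) (n + 1) ≫ s X ≫ (G.obj X).d (n + 1) n = 0 := fun X => by
        rw [hs, (F.obj X).d_comp_d_assoc, Limits.zero_comp]
      exact ConcreteCategory.congr_hom (this _) x)
  refine ⟨{ app := fun X => { f := fun n => t n X, comm' := ?_ }, naturality := ?_ }, fun X => ?_⟩
  · rintro i j rfl
    exact htc j X
  · intro X Y f
    ext1 n
    exact (htn n).1 f
  · exact congrFun htz X

/-- Acyclic models for homotopies: in each positive degree the error left by the previous component
is a cycle on the model, hence a boundary. -/
theorem naturallyHomotopic {φ ψ : F ⟶ G} (h₀ : ∀ X, (φ.app X).f 0 = (ψ.app X).f 0)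
    (hG : ∀ n, ExactInPosDegrees (G.obj (M.model n))) : NaturallyHomotopic φ ψ := by
  have hφ : ∀ (φ : F ⟶ G) n {X Y : Cl.{u}} (f : X ⟶ Y),
      (F.map f).f n ≫ (φ.app Y).f n = (φ.app X).f n ≫ (G.map f).f n := fun φ n X Y f =>
    HomologicalComplex.congr_hom (φ.naturality f) n
  obtain ⟨s, hs₀, hsn, hsc⟩ := exists_seq
    (α := fun n => ∀ X : Cl.{u}, (F.obj X).X n ⟶ (G.obj X).X (n + 1))
    (fun n s => (∀ {X Y : Cl.{u}} (f : X ⟶ Y), (F.map f).f n ≫ s Y = s X ≫ (G.map f).f (n + 1)) ∧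
      -- This is the homotopy identity precomposed with the differential, which removes the
      -- component one degree lower; the invariant thus mentions only the current one.
      ∀ X, (F.obj X).d (n + 1) n ≫ s X ≫ (G.obj X).d (n + 1) n =
        (F.obj X).d (n + 1) n ≫ ((φ.app X).f n - (ψ.app X).f n))
    (fun n s s' => ∀ X, (φ.app X).f (n + 1) - (ψ.app X).f (n + 1) =
      (F.obj X).d (n + 1) n ≫ s X + s' X ≫ (G.obj X).d (n + 2) (n + 1))
    -- Since the maps agree in degree zero, the homotopy can start with zero.
    (fun X => 0) ⟨fun f => by simp, fun X => by simp [h₀ X]⟩ (by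
      rintro n s ⟨hsn, hsd⟩
      obtain ⟨s', hsn', hs'⟩ := M.exists_natural_lift (n := n + 1) (m := n + 1)
        (fun X => (φ.app X).f (n + 1) - (ψ.app X).f (n + 1) - (F.obj X).d (n + 1) n ≫ s X)
        (fun {X Y} f => by
          rw [Preadditive.comp_sub, Preadditive.comp_sub, Preadditive.sub_comp,
            Preadditive.sub_comp, hφ, hφ, (F.map f).comm_assoc, hsn, Category.assoc])
        (hG (n + 1) n _ (by
          have : ∀ X, ((φ.app X).f (n + 1) - (ψ.app X).f (n + 1) - (F.obj X).d (n + 1) n ≫ s X) ≫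
              (G.obj X).d (n + 1) n = 0 := fun X => by
            rw [Preadditive.sub_comp, Preadditive.sub_comp, Category.assoc, hsd,
              Preadditive.comp_sub, (φ.app _).comm, (ψ.app _).comm, sub_self]
          exact ConcreteCategory.congr_hom (this _) (M.gen (𝟙 _))))
      refine ⟨s', ⟨hsn', fun X => ?_⟩, fun X => ?_⟩
      · rw [hs', Preadditive.comp_sub, (F.obj X).d_comp_d_assoc, Limits.zero_comp, sub_zero]
      · rw [hs', add_sub_cancel])
  refine ⟨s, fun n {X Y} f => (hsn n).1 f, fun X => ?_, fun X n => hsc n X⟩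
  rw [hs₀, h₀ X, sub_self, Limits.zero_comp]

end ChainModel

end CechClosure

namespace CechClosure

/-! ### The models of the cubical chains -/

/-- The lift of a closure space to a higher universe. -/
def uliftCl (X : Cl.{0}) : Cl.{u} :=
  @Cl.mk (ULift.{u} X)
    { cl := fun A => ULift.down ⁻¹' ClosureSpace.cl (ULift.down '' A)
      cl_empty := by simp [ClosureSpace.cl_empty]
      subset_cl := fun A x hx => ClosureSpace.subset_cl _ ⟨x, hx, rfl⟩
      cl_union := fun A B => by rw [Set.image_union, ClosureSpace.cl_union, Set.preimage_union] }

/-- The map `uliftCl X → X`. -/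
def uliftDown (X : Cl.{0}) : ContMap (uliftCl.{u} X) X :=
  ⟨ULift.down, by rintro A _ ⟨x, hx, rfl⟩; exact hx⟩

/-- The map `X → uliftCl X`. -/
def uliftUp (X : Cl.{0}) : ContMap X (uliftCl.{u} X) :=
  ⟨ULift.up, by
    rintro A _ ⟨x, hx, rfl⟩
    change x ∈ ClosureSpace.cl (ULift.down '' (ULift.up '' A))
    rwa [← Set.image_comp, show ULift.down ∘ ULift.up = (id : X → X) from rfl, Set.image_id]⟩

/-- Maps from the lift of a space. -/
def uliftHomEquiv (M : Cl.{0}) (X : Cl.{u}) : (uliftCl.{u} M ⟶ X) ≃ ContMap M X where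
  toFun σ := ContMap.comp σ (uliftUp M)
  invFun σ := ContMap.comp σ (uliftDown M)
  left_inv _ := rfl
  right_inv _ := rfl

section Cubical

variable {J : IntervalKind} {n : ℕ}

/-- The projection of the cube which makes the `i`-th coordinate zero. -/
def cubeProj (i : Fin n) : ContMap (J.Cube n) (J.Cube n) :=
  ⟨fun a => Function.update a i (J.endpoint false), continuous_pi fun k => by
    by_cases h : k = i
    · subst h
      simpa using continuous_const _
    · simpa [h] using continuous_apply k⟩

/-- Degeneracy becomes invariance under an idempotent of the cube, the form required by
`ChainModel`. -/
theorem isDegenerate_iff {X : Type u} [ClosureSpace X] {σ : SingularCube J n X} :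
    IsDegenerate σ ↔ ∃ i, σ.comp (cubeProj i) = σ := by
  refine exists_congr fun i => ⟨fun h => ContMap.ext (funext fun a => h _ _ fun k hk => ?_),
    fun h a b hab => ?_⟩
  · exact Function.update_of_ne hk _ _
  · rw [← h]
    refine congrArg σ.toFun (funext fun k => ?_)
    change Function.update a i _ k = Function.update b i _ k
    by_cases hk : k = i
    · subst hk
      simp
    · simp [hk, hab k hk]

/-- The class of a singular cube in the cubical chains. -/
def cubeClass {X : Cl.{u}} (σ : SingularCube J n X) : ((cubicalChains J).obj X).X n :=
  (QuotientAddGroup.mk (FreeAbelianGroup.of σ) : NormCubeGroup J n X)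

theorem cubicalChains_map_cubeClass {X Y : Cl.{u}} (f : X ⟶ Y) (σ : SingularCube J n X) :
    ((cubicalChains J).map f).f n (cubeClass σ) = cubeClass (ContMap.comp f σ) := rfl

theorem cubicalChains_d (X : Cl.{u}) : ((cubicalChains J).obj X).d (n + 1) n =
    AddCommGrpCat.ofHom (normBoundary J n X) :=
  ChainComplex.of_d (fun n => AddCommGrpCat.of (NormCubeGroup J n X))
    (fun n => AddCommGrpCat.ofHom (normBoundary J n X)) n

theorem cubicalChains_d_cubeClass {X : Cl.{u}} (σ : SingularCube J (n + 1) X) :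
    ((cubicalChains J).obj X).d (n + 1) n (cubeClass σ) =
      ∑ i : Fin (n + 1), (-1 : ℤ) ^ ((i : ℕ) + 1) •
        (cubeClass (cubeFace i false σ) - cubeClass (cubeFace i true σ)) := by
  rw [cubicalChains_d]
  change (QuotientAddGroup.mk' (degenerate J n X)) (cubeBoundary J n X (FreeAbelianGroup.of σ)) = _
  rw [cubeBoundary_apply, map_sum]
  refine Finset.sum_congr rfl fun i _ => ?_
  rw [map_zsmul, faceDiff, FreeAbelianGroup.lift_apply_of]
  rfl

theorem cubeClass_eq_zero {X : Cl.{u}} {σ : SingularCube J n X} (h : IsDegenerate σ) :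
    cubeClass σ = 0 :=
  (QuotientAddGroup.eq_zero_iff _).2 (of_mem_degenerate h)

variable (J)

/-- The presentation of the cubical chains by cubes. -/
def cubicalModel : ChainModel.{u} (cubicalChains J) where
  model n := uliftCl ⟨J.Cube n⟩
  nonempty n := ⟨⟨fun _ => J.endpoint false⟩⟩
  idx n := Fin n
  finite n := inferInstance
  proj {n} i := (uliftHomEquiv ⟨J.Cube n⟩ _).symm ((uliftUp _).comp (cubeProj i))
  proj_idem i := ContMap.ext (funext fun a => ULift.ext _ _ (Function.update_idem _ _ _))
  proj_comm {n} i j := ContMap.ext (funext fun a => ULift.ext _ _ (by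
    change Function.update (Function.update a.down i _) j _ =
      Function.update (Function.update a.down j _) i _
    by_cases h : i = j
    · subst h
      rfl
    · exact Function.update_comm h _ _ _))
  gen {n X} σ := cubeClass (uliftHomEquiv ⟨J.Cube n⟩ X σ)
  map_gen f σ := rfl
  gen_eq_zero {n X} σ i h := cubeClass_eq_zero (isDegenerate_iff.2
    ⟨i, congrArg (uliftHomEquiv ⟨J.Cube n⟩ X) h⟩)
  closure_range_gen n X := by
    refine AddSubgroup.eq_top_iff' _ |>.2 fun x => ?_
    obtain ⟨x, rfl⟩ := QuotientAddGroup.mk_surjective x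
    induction x using FreeAbelianGroup.induction_on with
    | zero => exact zero_mem _
    | of σ =>
      have h : cubeClass σ ∈ AddSubgroup.closure (Set.range fun σ => cubeClass
          (uliftHomEquiv ⟨J.Cube n⟩ X σ)) :=
        AddSubgroup.subset_closure ⟨(uliftHomEquiv ⟨J.Cube n⟩ X).symm σ, rfl⟩
      exact h
    | neg σ h => exact neg_mem h
    | add x y hx hy => exact add_mem hx hy
  exists_lift {n X G} φ hφ := by
    have h : degenerate J n X ≤ (FreeAbelianGroup.lift
        fun σ => φ ((uliftHomEquiv ⟨J.Cube n⟩ X).symm σ)).ker := by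
      refine (AddSubgroup.closure_le _).2 ?_
      rintro _ ⟨σ, hσ, rfl⟩
      obtain ⟨i, hi⟩ := isDegenerate_iff.1 hσ
      refine (FreeAbelianGroup.lift_apply_of _ _).trans (hφ _ i ?_)
      exact congrArg (uliftHomEquiv ⟨J.Cube n⟩ X).symm hi
    exact ⟨AddCommGrpCat.ofHom (QuotientAddGroup.lift _ _ h),
      fun σ => FreeAbelianGroup.lift_apply_of _ _⟩

/-! ### The cubical prism and the one-point space -/

/-- The cube `(a₀, …, aₙ) ↦ (σ(a₁, …, aₙ), a₀)` in the cylinder. -/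
def prismCube {X : Cl.{u}} (σ : SingularCube J n X) :
    SingularCube J (n + 1) ((cylinder J).obj X) :=
  ⟨fun a => (σ fun k => a k.succ, a 0), Continuous.prodMk
    (σ.cont.comp (continuous_pi fun k => continuous_apply k.succ)) (continuous_apply 0)⟩

/-- The new coordinate comes first, so independence of coordinate `i` becomes independence of
coordinate `i + 1`. -/
theorem prismCube_degenerate (X : Cl.{u}) :
    degenerate J n X ≤ (degenerate J (n + 1) ((cylinder J).obj X)).comap
      (FreeAbelianGroup.map (prismCube J)) := by
  refine (AddSubgroup.closure_le _).2 ?_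
  rintro _ ⟨σ, ⟨i, hi⟩, rfl⟩
  change FreeAbelianGroup.map (prismCube J) _ ∈ degenerate J _ _
  rw [FreeAbelianGroup.map_of_apply]
  refine of_mem_degenerate ⟨i.succ, fun a b hab => Prod.ext ?_ ?_⟩
  · exact hi _ _ fun k hk => hab _ fun h => hk (Fin.succ_injective _ h)
  · exact hab 0 (Fin.succ_ne_zero i).symm

/-- The prism operator on cubical chains. -/
def cubePrism (n : ℕ) (X : Cl.{u}) : ((cubicalChains J).obj X).X n ⟶
    ((cubicalChains J).obj ((cylinder J).obj X)).X (n + 1) :=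
  AddCommGrpCat.ofHom (QuotientAddGroup.map (degenerate J n X)
    (degenerate J (n + 1) ((cylinder J).obj X)) _ (prismCube_degenerate J X))

theorem cubePrism_cubeClass {X : Cl.{u}} (σ : SingularCube J n X) :
    cubePrism J n X (cubeClass σ) = cubeClass (prismCube J σ) := rfl

theorem cubeFace_zero_prismCube {X : Cl.{u}} (σ : SingularCube J n X) (e : Bool) :
    cubeFace 0 e (prismCube J σ) = ContMap.comp ((cylinderEnd J e).app X) σ :=
  rfl

theorem cubeFace_succ_prismCube {X : Cl.{u}} (σ : SingularCube J (n + 1) X) (i : Fin (n + 1))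
    (e : Bool) : cubeFace i.succ e (prismCube J σ) = prismCube J (cubeFace i e σ) := by
  refine ContMap.ext (funext fun a => Prod.ext (congrArg σ.toFun (funext fun k => ?_)) ?_)
  · change i.succ.insertNth (α := fun _ => J.space) (J.endpoint e) a k.succ =
      i.insertNth (α := fun _ => J.space) (J.endpoint e) (fun k => a k.succ) k
    rcases Fin.eq_self_or_eq_succAbove i k with rfl | ⟨k, rfl⟩
    · rw [Fin.insertNth_apply_same, Fin.insertNth_apply_same]
    · rw [Fin.insertNth_apply_succAbove, ← Fin.succ_succAbove_succ, Fin.insertNth_apply_succAbove]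
  · change i.succ.insertNth (α := fun _ => J.space) (J.endpoint e) a 0 = a 0
    rw [← Fin.succ_succAbove_zero i, Fin.insertNth_apply_succAbove]

theorem cubical_prism_zero {X : Cl.{u}} (σ : SingularCube J 0 X) :
    cubeClass (ContMap.comp ((cylinderEnd J false).app X) σ) -
      cubeClass (ContMap.comp ((cylinderEnd J true).app X) σ) =
    ((cubicalChains J).obj ((cylinder J).obj X)).d 1 0
      (-cubeClass (prismCube J σ)) := by
  rw [map_neg, cubicalChains_d_cubeClass, Fin.sum_univ_succ]
  simp [cubeFace_zero_prismCube]

/-- The zeroth faces of the prism are the two ends, entering with sign `-1`, which is why the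
homotopy is minus the prism. The other faces are prisms over faces of `σ`, and the index shift
reverses their signs. -/
theorem cubical_prism_succ {X : Cl.{u}} (σ : SingularCube J (n + 1) X) :
    cubeClass (ContMap.comp ((cylinderEnd J false).app X) σ) -
      cubeClass (ContMap.comp ((cylinderEnd J true).app X) σ) =
    -(cubePrism J n X (((cubicalChains J).obj X).d (n + 1) n (cubeClass σ))) +
    ((cubicalChains J).obj ((cylinder J).obj X)).d (n + 2) (n + 1)
      (-cubeClass (prismCube J σ)) := by
  rw [map_neg, cubicalChains_d_cubeClass, cubicalChains_d_cubeClass, Fin.sum_univ_succ (n := n + 1),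
    map_sum]
  simp only [map_zsmul, map_sub, cubePrism_cubeClass, cubeFace_zero_prismCube,
    cubeFace_succ_prismCube, Fin.val_succ, Fin.val_zero, pow_succ, pow_zero]
  simp

theorem cubical_homotopy : NaturallyHomotopic.{u}
    (Functor.whiskerRight (cylinderEnd J false) (cubicalChains J))
    (Functor.whiskerRight (cylinderEnd J true) (cubicalChains J)) := by
  refine ⟨fun n X => -cubePrism J n X, fun n {X Y} f => ?_, fun X => ?_, fun X n => ?_⟩
  · refine (cubicalModel J).hom_ext fun σ => ?_
    rfl
  · refine (cubicalModel J).hom_ext fun σ => ?_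
    have h := cubical_prism_zero J ((uliftHomEquiv ⟨J.Cube 0⟩ X) σ)
    exact h
  · refine (cubicalModel J).hom_ext fun σ => ?_
    have h := cubical_prism_succ J ((uliftHomEquiv ⟨J.Cube (n + 1)⟩ X) σ)
    exact h

theorem cubeClass_eq_zero_of_unique (X : Cl.{u}) [Unique X] (σ : SingularCube J (n + 1) X) :
    cubeClass σ = 0 :=
  cubeClass_eq_zero ⟨0, fun _ _ _ => Subsingleton.elim _ _⟩

/-- Every cube of positive dimension in a point is degenerate, so normalized chains vanish there and
the identity serves as `p`. -/
theorem cubical_dimension (X : Cl.{u}) [Unique X] :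
    ∃ p : (cubicalChains J).obj X ⟶ (cubicalChains J).obj X,
      Nonempty (Homotopy (𝟙 _) p) ∧ ∀ n, 1 ≤ n → p.f n = 0 := by
  refine ⟨𝟙 _, ⟨Homotopy.refl _⟩, fun n hn => (cubicalModel J).hom_ext fun σ => ?_⟩
  obtain ⟨n, rfl⟩ := Nat.exists_eq_add_of_le' hn
  exact cubeClass_eq_zero_of_unique J X _

end Cubical

end CechClosure

namespace CechClosure

/-! ### The models of the simplicial chains -/

section Simplicial

variable {J : IntervalKind} {n : ℕ}

theorem finsetSum_hom_apply {A B : AddCommGrpCat.{u}} {ι : Type v} (s : Finset ι)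
    (f : ι → (A ⟶ B)) (x : A) : (∑ i ∈ s, f i) x = ∑ i ∈ s, f i x := by
  classical
  induction s using Finset.induction_on with
  | empty => rfl
  | insert i s hi ih =>
    rw [Finset.sum_insert hi, Finset.sum_insert hi, ← ih]
    rfl

/-- The generator of the simplicial chains given by a simplex. -/
noncomputable def simplexClass {X : Cl.{u}} (σ : ContMap (J.simplex n) X) :
    ((simplicialChains J).obj X).X n :=
  FreeAbelianGroup.of σ

theorem simplicialChains_map_simplexClass {X Y : Cl.{u}} (f : X ⟶ Y)
    (σ : ContMap (J.simplex n) X) :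
    ((simplicialChains J).map f).f n (simplexClass σ) = simplexClass (ContMap.comp f σ) :=
  FreeAbelianGroup.map_of_apply _

theorem simplicialChains_d_simplexClass {X : Cl.{u}} (σ : ContMap (J.simplex (n + 1)) X) :
    ((simplicialChains J).obj X).d (n + 1) n (simplexClass σ) =
      ∑ i : Fin (n + 2), (-1 : ℤ) ^ (i : ℕ) •
        simplexClass (σ.comp (J.simplexMap i.succAboveOrderEmb.toOrderHom)) := by
  have h := ConcreteCategory.congr_hom (AlgebraicTopology.AlternatingFaceMapComplex.obj_d_eq
    (((SimplicialObject.whiskering _ _).obj AddCommGrpCat.free).obj ((singularSet J).obj X)) n)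
    (simplexClass σ)
  refine h.trans ?_
  refine (finsetSum_hom_apply _ _ _).trans ?_
  refine Finset.sum_congr rfl fun i _ => ?_
  exact congrArg (fun y : ((simplicialChains J).obj X).X n => (-1 : ℤ) ^ (i : ℕ) • y)
    (FreeAbelianGroup.map_of_apply _)

variable (J)

theorem IntervalKind.nonempty_simplex (n : ℕ) : Nonempty (J.simplex n) := by
  cases J
  · exact ⟨(stdSimplex.vertex 0 : stdSimplex ℝ (Fin (n + 1)))⟩
  · exact ⟨(0 : Fin (n + 1))⟩
  · exact ⟨(0 : Fin (n + 1))⟩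

/-- The presentation of the simplicial chains by simplices. -/
noncomputable def simplicialModel : ChainModel.{u} (simplicialChains J) where
  model n := uliftCl (J.simplex n)
  nonempty n := (J.nonempty_simplex n).map ULift.up
  -- Simplicial chains are not normalized: no generator is set to zero.
  idx n := Empty
  finite n := inferInstance
  proj i := i.elim
  proj_idem i := i.elim
  proj_comm i := i.elim
  gen {n X} σ := simplexClass (uliftHomEquiv (J.simplex n) X σ)
  map_gen f σ := simplicialChains_map_simplexClass f _
  gen_eq_zero σ i := i.elim
  closure_range_gen n X := by
    refine AddSubgroup.eq_top_iff' _ |>.2 fun x => ?_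
    induction x using FreeAbelianGroup.induction_on with
    | zero => exact zero_mem _
    | of σ =>
      have h : simplexClass σ ∈ AddSubgroup.closure (Set.range fun σ => simplexClass
          (uliftHomEquiv (J.simplex n) X σ)) :=
        AddSubgroup.subset_closure ⟨(uliftHomEquiv (J.simplex n) X).symm σ, rfl⟩
      exact h
    | neg σ h => exact neg_mem h
    | add x y hx hy => exact add_mem hx hy
  exists_lift {n X G} φ hφ :=
    ⟨AddCommGrpCat.ofHom (FreeAbelianGroup.lift
      fun σ => φ ((uliftHomEquiv (J.simplex n) X).symm σ)),
      fun σ => FreeAbelianGroup.lift_apply_of _ _⟩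

theorem Continuous.of_topological {X : Type u} {Y : Type v} [TopologicalSpace X]
    [TopologicalSpace Y] {f : X → Y} (hf : _root_.Continuous f) :
    @Continuous X Y (ofTopology X) (ofTopology Y) f :=
  fun _ => image_closure_subset_closure_image hf

/-! ### The simplicial prism and the one-point space -/

/-- The second barycentric coordinate, as a map from the `1`-simplex to the interval. -/
noncomputable def IntervalKind.toInterval : (J : IntervalKind) → ContMap (J.simplex 1) J.space
  | I => @ContMap.mk (stdSimplex ℝ (Fin 2)) unitInterval (ofTopology _) (ofTopology _)
      stdSimplexHomeomorphUnitInterval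
      (Continuous.of_topological stdSimplexHomeomorphUnitInterval.continuous)
  | J1 => ⟨id, continuous_id⟩
  | Jplus => ⟨id, continuous_id⟩

theorem stdSimplex_map_const_apply (e : Fin 2) (x : stdSimplex ℝ (Fin (n + 1))) :
    stdSimplex.map (S := ℝ) (fun _ => e) x 1 = if e = 1 then 1 else 0 := by
  rw [stdSimplex.map_coe, FunOnFinite.linearMap_apply_apply]
  fin_cases e
  · simp
  · simp

theorem IntervalKind.toInterval_simplexMap_const (e : Fin 2) (x : J.simplex n) :
    J.toInterval (J.simplexMap (OrderHom.const _ e) x) = J.endpoint (e = 1) := by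
  cases J
  · refine Subtype.ext ((stdSimplex_map_const_apply e x).trans ?_)
    fin_cases e <;> rfl
  · fin_cases e <;> rfl
  · fin_cases e <;> rfl

/-- The simplex of the cylinder given by a simplex of the base and maps of vertices. -/
noncomputable def prismSimplex {X : Cl.{u}} (σ : ContMap (J.simplex n) X) {m : ℕ}
    (a : Fin (m + 1) →o Fin (n + 1)) (b : Fin (m + 1) →o Fin 2) :
    ContMap (J.simplex m) ((cylinder J).obj X) :=
  ⟨fun x => (σ (J.simplexMap a x), J.toInterval (J.simplexMap b x)), Continuous.prodMk
    (σ.cont.comp (J.simplexMap a).cont) (J.toInterval.cont.comp (J.simplexMap b).cont)⟩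

variable {J}

/-- Together with `prismSimplex_comp_left`, this reduces the simplicial homotopy identities to
identities between order preserving maps of vertices. -/
theorem prismSimplex_comp {X : Cl.{u}} (σ : ContMap (J.simplex n) X) {l m : ℕ}
    (a : Fin (m + 1) →o Fin (n + 1)) (b : Fin (m + 1) →o Fin 2) (c : Fin (l + 1) →o Fin (m + 1)) :
    (prismSimplex J σ a b).comp (J.simplexMap c) = prismSimplex J σ (a.comp c) (b.comp c) :=
  ContMap.ext (funext fun x => Prod.ext (congrArg σ.toFun (J.simplexMap_comp a c x).symm)
    (congrArg J.toInterval.toFun (J.simplexMap_comp b c x).symm))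

theorem prismSimplex_comp_left {X : Cl.{u}} {k m : ℕ} (σ : ContMap (J.simplex k) X)
    (c : Fin (n + 1) →o Fin (k + 1)) (a : Fin (m + 1) →o Fin (n + 1)) (b : Fin (m + 1) →o Fin 2) :
    prismSimplex J (σ.comp (J.simplexMap c)) a b = prismSimplex J σ (c.comp a) b :=
  ContMap.ext (funext fun x => Prod.ext (congrArg σ.toFun (J.simplexMap_comp c a x).symm) rfl)

theorem prismSimplex_const {X : Cl.{u}} (σ : ContMap (J.simplex n) X) (e : Fin 2) :
    prismSimplex J σ OrderHom.id (OrderHom.const _ e) =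
      ContMap.comp ((cylinderEnd J (e = 1)).app X) σ :=
  ContMap.ext (funext fun x => Prod.ext (congrArg σ.toFun (J.simplexMap_id n x))
    (J.toInterval_simplexMap_const e x))

/-- The map `[n] → [1]` which is `0` up to `i` and `1` after it. -/
def stepMap {m : ℕ} (i : Fin m) : Fin (m + 1) →o Fin 2 where
  toFun k := if k ≤ i.castSucc then 0 else 1
  monotone' k l h := by
    dsimp only
    split_ifs with hk hl
    · exact le_rfl
    · exact Fin.zero_le _
    · exact absurd (h.trans (by assumption)) hk
    · exact le_rfl

/-- Such formulas in `ℕ` turn the identities between vertex maps into case distinctions with linear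
arithmetic. -/
theorem val_succAbove (i : Fin (n + 1)) (k : Fin n) :
    (i.succAbove k : ℕ) = if (k : ℕ) < i then (k : ℕ) else k + 1 := by
  rw [Fin.succAbove]
  split_ifs <;> simp_all [Fin.lt_def]

theorem val_predAbove (i : Fin n) (k : Fin (n + 1)) :
    (i.predAbove k : ℕ) = if (i : ℕ) < k then (k : ℕ) - 1 else k := by
  have h : i.castSucc < k ↔ (i : ℕ) < k := Iff.rfl
  by_cases hk : (i : ℕ) < k
  · rw [Fin.predAbove_of_castSucc_lt _ _ (h.2 hk), if_pos hk, Fin.val_pred]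
  · rw [Fin.predAbove_of_le_castSucc _ _ (not_lt.1 fun h' => hk (h.1 h')), if_neg hk]
    rfl

theorem val_stepMap (i : Fin n) (k : Fin (n + 1)) :
    (stepMap i k : ℕ) = if (k : ℕ) ≤ i then 0 else 1 := by
  change ((if k ≤ i.castSucc then 0 else 1 : Fin 2) : ℕ) = _
  split_ifs <;> simp_all [Fin.le_def]

/-- The simplicial homotopy between the ends of the cylinder. -/
noncomputable def singularSetHomotopy (X : Cl.{u}) : SimplicialObject.Homotopy
    ((singularSet J).map ((cylinderEnd J false).app X))
    ((singularSet J).map ((cylinderEnd J true).app X)) where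
  -- The usual triangulation of the prism: the `i`-th simplex has vertices `(0,0), …, (i,0), (i,1),
  -- …, (n,1)`.
  h {n} i := TypeCat.ofHom fun σ : ContMap (J.simplex n) X =>
    prismSimplex J σ (Fin.predAboveOrderHom i) (stepMap i)
  h_zero_comp_δ_zero n := by
    ext σ
    refine (prismSimplex_comp _ _ _ _).trans ((congrArg₂ (prismSimplex J σ) ?_ ?_).trans
      (prismSimplex_const σ 1))
    · refine OrderHom.ext _ _ (funext fun k => Fin.ext ?_)
      change (Fin.predAbove (0 : Fin (n + 1)) (Fin.succAbove 0 k) : ℕ) = k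
      grind [val_succAbove, val_predAbove, val_stepMap]
    · refine OrderHom.ext _ _ (funext fun k => Fin.ext ?_)
      change (stepMap (0 : Fin (n + 1)) (Fin.succAbove 0 k) : ℕ) = 1
      grind [val_succAbove, val_predAbove, val_stepMap]
  h_last_comp_δ_last n := by
    ext σ
    refine (prismSimplex_comp _ _ _ _).trans ((congrArg₂ (prismSimplex J σ) ?_ ?_).trans
      (prismSimplex_const σ 0))
    · refine OrderHom.ext _ _ (funext fun k => Fin.ext ?_)
      change (Fin.predAbove (Fin.last n) (Fin.succAbove (Fin.last (n + 1)) k) : ℕ) = k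
      grind [val_succAbove, val_predAbove, val_stepMap]
    · refine OrderHom.ext _ _ (funext fun k => Fin.ext ?_)
      change (stepMap (Fin.last n) (Fin.succAbove (Fin.last (n + 1)) k) : ℕ) = 0
      grind [val_succAbove, val_predAbove, val_stepMap]
  h_succ_comp_δ_castSucc_of_lt {n} i j hij := by
    ext σ
    refine (prismSimplex_comp _ _ _ _).trans ((congrArg₂ (prismSimplex J σ) ?_ ?_).trans
      (prismSimplex_comp_left σ i.succAboveOrderEmb.toOrderHom _ _).symm)
    · refine OrderHom.ext _ _ (funext fun k => Fin.ext ?_)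
      change (Fin.predAbove j.succ (Fin.succAbove i.castSucc k) : ℕ) = Fin.succAbove i (Fin.predAbove j k)
      grind [val_succAbove, val_predAbove, val_stepMap]
    · refine OrderHom.ext _ _ (funext fun k => Fin.ext ?_)
      change (stepMap j.succ (Fin.succAbove i.castSucc k) : ℕ) = stepMap j k
      grind [val_succAbove, val_predAbove, val_stepMap]
  h_succ_comp_δ_castSucc_succ {n} j := by
    ext σ
    refine (prismSimplex_comp _ _ _ _).trans ((congrArg₂ (prismSimplex J σ) ?_ ?_).trans
      (prismSimplex_comp _ _ _ _).symm)
    · refine OrderHom.ext _ _ (funext fun k => Fin.ext ?_)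
      change (Fin.predAbove j.succ (Fin.succAbove j.castSucc.succ k) : ℕ) = Fin.predAbove j.castSucc (Fin.succAbove j.castSucc.succ k)
      grind [val_succAbove, val_predAbove, val_stepMap]
    · refine OrderHom.ext _ _ (funext fun k => Fin.ext ?_)
      change (stepMap j.succ (Fin.succAbove j.castSucc.succ k) : ℕ) = stepMap j.castSucc (Fin.succAbove j.castSucc.succ k)
      grind [val_succAbove, val_predAbove, val_stepMap]
  h_castSucc_comp_δ_succ_of_lt {n} i j hji := by
    ext σ
    refine (prismSimplex_comp _ _ _ _).trans ((congrArg₂ (prismSimplex J σ) ?_ ?_).trans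
      (prismSimplex_comp_left σ i.succAboveOrderEmb.toOrderHom _ _).symm)
    · refine OrderHom.ext _ _ (funext fun k => Fin.ext ?_)
      change (Fin.predAbove j.castSucc (Fin.succAbove i.succ k) : ℕ) = Fin.succAbove i (Fin.predAbove j k)
      grind [val_succAbove, val_predAbove, val_stepMap]
    · refine OrderHom.ext _ _ (funext fun k => Fin.ext ?_)
      change (stepMap j.castSucc (Fin.succAbove i.succ k) : ℕ) = stepMap j k
      grind [val_succAbove, val_predAbove, val_stepMap]
  h_comp_σ_castSucc_of_le {n} i j hij := by
    ext σ
    refine (prismSimplex_comp _ _ _ _).trans ((congrArg₂ (prismSimplex J σ) ?_ ?_).trans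
      (prismSimplex_comp_left σ (Fin.predAboveOrderHom i) _ _).symm)
    · refine OrderHom.ext _ _ (funext fun k => Fin.ext ?_)
      change (Fin.predAbove j (Fin.predAbove i.castSucc k) : ℕ) = Fin.predAbove i (Fin.predAbove j.succ k)
      grind [val_succAbove, val_predAbove, val_stepMap]
    · refine OrderHom.ext _ _ (funext fun k => Fin.ext ?_)
      change (stepMap j (Fin.predAbove i.castSucc k) : ℕ) = stepMap j.succ k
      grind [val_succAbove, val_predAbove, val_stepMap]
  h_comp_σ_succ_of_lt {n} i j hji := by
    ext σ
    refine (prismSimplex_comp _ _ _ _).trans ((congrArg₂ (prismSimplex J σ) ?_ ?_).trans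
      (prismSimplex_comp_left σ (Fin.predAboveOrderHom i) _ _).symm)
    · refine OrderHom.ext _ _ (funext fun k => Fin.ext ?_)
      change (Fin.predAbove j (Fin.predAbove i.succ k) : ℕ) = Fin.predAbove i (Fin.predAbove j.castSucc k)
      grind [val_succAbove, val_predAbove, val_stepMap]
    · refine OrderHom.ext _ _ (funext fun k => Fin.ext ?_)
      change (stepMap j (Fin.predAbove i.succ k) : ℕ) = stepMap j.castSucc k
      grind [val_succAbove, val_predAbove, val_stepMap]

variable (J)

theorem simplicial_homotopy : NaturallyHomotopic.{u}
    (Functor.whiskerRight (cylinderEnd J false) (simplicialChains J))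
    (Functor.whiskerRight (cylinderEnd J true) (simplicialChains J)) := by
  let H := fun X : Cl.{u} =>
    ((singularSetHomotopy (J := J) X).whiskerRight AddCommGrpCat.free).toChainHomotopy
  refine ⟨fun n X => (H X).hom n (n + 1), fun n {X Y} f => ?_, fun X => ?_, fun X n => ?_⟩
  -- A simplicial homotopy on one space carries no naturality in the space; this is read off from
  -- the explicit alternating sum on generators.
  · have h : ∀ (X : Cl.{u}) (σ : ContMap (J.simplex n) X), (H X).hom n (n + 1) (simplexClass σ) =
        -∑ k : Fin (n + 1), ((-1 : ℤ) ^ (k : ℕ)) •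
          simplexClass (prismSimplex J σ (Fin.predAboveOrderHom k) (stepMap k)) := fun X σ => by
      refine (ConcreteCategory.congr_hom
        (SimplicialObject.Homotopy.ToChainHomotopy.hom_eq
          ((singularSetHomotopy (J := J) X).whiskerRight AddCommGrpCat.free) n)
        (FreeAbelianGroup.of σ)).trans ?_
      refine congrArg Neg.neg ((finsetSum_hom_apply _ _ _).trans ?_)
      refine Finset.sum_congr rfl fun k _ => ?_
      exact congrArg (fun y : ((simplicialChains J).obj _).X (n + 1) => (-1 : ℤ) ^ (k : ℕ) • y)
        (FreeAbelianGroup.map_of_apply _)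
    refine (simplicialModel J).hom_ext fun σ => ?_
    have h₁ := h Y (ContMap.comp f (uliftHomEquiv _ _ σ))
    have h₂ := congrArg (((simplicialChains J).map ((cylinder J).map f)).f (n + 1))
      (h X (uliftHomEquiv _ _ σ))
    rw [map_neg, map_sum] at h₂
    simp only [map_zsmul, simplicialChains_map_simplexClass] at h₂
    refine (congrArg ((H Y).hom n (n + 1)) (simplicialChains_map_simplexClass f _)).trans ?_
    exact h₁.trans h₂.symm
  · have h := (H X).comm 0
    rw [Homotopy.prevD_chainComplex, Homotopy.dNext_zero_chainComplex, zero_add] at h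
    exact sub_eq_iff_eq_add.2 h
  · have h := (H X).comm (n + 1)
    rw [Homotopy.prevD_chainComplex, Homotopy.dNext_succ_chainComplex] at h
    exact sub_eq_iff_eq_add.2 h

/-- All `n + 2` faces coincide, so the alternating sum is `0` or `1` according to the parity of `n`.
-/
theorem simplicialChains_d_simplexClass_of_unique {X : Cl.{u}} [Unique X]
    (σ : ContMap (J.simplex (n + 1)) X) (τ : ContMap (J.simplex n) X) :
    ((simplicialChains J).obj X).d (n + 1) n (simplexClass σ) =
      if Even n then 0 else simplexClass τ := by
  rw [simplicialChains_d_simplexClass]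
  have h : ∀ τ' : ContMap (J.simplex n) X, τ' = τ := fun τ' =>
    ContMap.ext (funext fun _ => Subsingleton.elim _ _)
  simp only [h, ← Finset.sum_smul, Fin.sum_neg_one_pow]
  simp [Nat.even_add]

theorem simplicial_dimension (X : Cl.{u}) [Unique X] :
    ∃ p : (simplicialChains J).obj X ⟶ (simplicialChains J).obj X,
      Nonempty (Homotopy (𝟙 _) p) ∧ ∀ n, 1 ≤ n → p.f n = 0 := by
  let c : ∀ n, ContMap (J.simplex n) X := fun n => ⟨fun _ => default, continuous_const _⟩
  have hc : ∀ n (σ : ContMap (J.simplex n) X), σ = c n := fun n σ =>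
    ContMap.ext (funext fun _ => Subsingleton.elim _ _)
  have hd₀ : ((simplicialChains J).obj X).d 1 0 = 0 :=
    (simplicialModel J).hom_ext fun σ =>
      (simplicialChains_d_simplexClass_of_unique J _ (c 0)).trans (if_pos (by simp))
  -- The differentials alternate between zero and an isomorphism, so the contraction inverts those
  -- leaving positive even degrees: it is nonzero exactly in odd degrees.
  obtain ⟨s, hs⟩ : ∃ s : ∀ n, ((simplicialChains J).obj X).X n ⟶
      ((simplicialChains J).obj X).X (n + 1), ∀ n (σ : ContMap (J.simplex n) X),
      s n (simplexClass σ) = if Even n then 0 else simplexClass (c (n + 1)) := by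
    choose s hs using fun n => (simplicialModel J).exists_lift (n := n) (X := X)
      (fun _ => if Even n then 0 else simplexClass (c (n + 1))) fun σ i => i.elim
    exact ⟨s, fun n σ => hs n ((uliftHomEquiv _ _).symm σ)⟩
  let p : (simplicialChains J).obj X ⟶ (simplicialChains J).obj X :=
    { f := fun n => if n = 0 then 𝟙 _ else 0
      comm' := by
        rintro _ n rfl
        cases n <;> simp [hd₀] }
  have hp : ∀ n, 1 ≤ n → p.f n = 0 := fun n hn => if_neg (by lia)
  refine ⟨p, ⟨homotopyOfComponents s ?_ fun n => ?_⟩, hp⟩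
  · have h : s 0 = 0 := (simplicialModel J).hom_ext fun σ => (hs _ _).trans (if_pos (by simp))
    simp [p, h]
  · rw [hp (n + 1) (by lia), sub_zero]
    refine (simplicialModel J).hom_ext fun σ => ?_
    change simplexClass (uliftHomEquiv _ _ σ) = s n (((simplicialChains J).obj X).d (n + 1) n
      (simplexClass (uliftHomEquiv _ _ σ))) + ((simplicialChains J).obj X).d (n + 2) (n + 1)
        (s (n + 1) (simplexClass (uliftHomEquiv _ _ σ)))
    rw [hs, simplicialChains_d_simplexClass_of_unique J _ (c n), hc (n + 1) (uliftHomEquiv _ _ σ)]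
    by_cases hn : Even n
    · rw [if_pos hn, if_neg (by simpa [Nat.even_add_one] using hn), map_zero, zero_add,
        simplicialChains_d_simplexClass_of_unique J _ (c (n + 1)),
        if_neg (by simpa [Nat.even_add_one] using hn)]
    · rw [if_neg hn, if_pos (by simpa [Nat.even_add_one] using hn), map_zero, add_zero, hs,
        if_neg hn]

end Simplicial

end CechClosure

namespace CechClosure

/-! ### Excision for the finite intervals -/

/-- A space with a point whose only neighborhood is the whole space. -/
def HasTop (X : Type u) [ClosureSpace X] : Prop := ∃ t : X, ∀ V, IsNhd V t → V = Set.univ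

/-- A neighborhood in the product contains a box of neighborhoods, and every side of a box around
the point of top coordinates is everything. -/
theorem HasTop.pi {ι : Type v} {X : ι → Type u} [∀ i, ClosureSpace (X i)]
    (h : ∀ i, HasTop (X i)) : HasTop (∀ i, X i) := by
  choose t ht using h
  refine ⟨t, fun V hV => ?_⟩
  obtain ⟨F, W, hW, hV⟩ := isNhd_pi_iff.1 hV
  exact Set.eq_univ_of_forall fun x => hV fun i hi => by
    rw [ht i _ (hW i hi)]
    trivial

theorem HasTop.ulift {X : Cl.{0}} (h : HasTop X) : HasTop (uliftCl.{u} X) := by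
  obtain ⟨t, ht⟩ := h
  refine ⟨ULift.up t, fun V hV => Set.eq_univ_of_forall fun x => ?_⟩
  have := ht _ (continuous_iff_nhd.1 (uliftUp.{u} X).cont t V hV)
  exact (this ▸ Set.mem_univ x.down :)

theorem hasTop_Jtop (m : ℕ) : HasTop (Jtop m) := by
  refine ⟨Fin.last m, fun V hV => Set.eq_univ_of_forall fun x => ?_⟩
  by_contra hx
  exact hV ⟨x, hx⟩

/-- The last vertex lies in the closure of every vertex, so no neighborhood of it can omit a point.
-/
theorem hasTop_Jle (m : ℕ) : HasTop (Jle m) := by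
  refine ⟨Fin.last m, fun V hV => Set.eq_univ_of_forall fun x => ?_⟩
  by_contra hx
  exact hV ⟨x, hx, Fin.le_last _⟩

/-- The top point is sent into `i(A)` or `i(B)`; the preimage of that set, `A` or `B`, is then a
neighborhood of the top point, hence everything. -/
theorem HasTop.forall_mem_or {M : Type v} [ClosureSpace M] (hM : HasTop M) {X : Type u}
    [ClosureSpace X] {A B : Set X} (h : interior A ∪ interior B = Set.univ) (σ : ContMap M X) :
    (∀ y, σ y ∈ A) ∨ ∀ y, σ y ∈ B := by
  obtain ⟨t, ht⟩ := hM
  have key : ∀ A : Set X, σ t ∈ interior A → ∀ y, σ y ∈ A := fun A hA y =>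
    (Set.eq_univ_iff_forall.1 (ht _ (continuous_iff_nhd.1 σ.cont t A hA))) y
  exact (h ▸ Set.mem_univ (σ t) : σ t ∈ interior A ∪ interior B).imp (key A) (key B)

theorem ChainModel.isChainTheory_of_hasTop {J : IntervalKind}
    {C : Cl.{u} ⥤ ChainComplex AddCommGrpCat.{u} ℕ} (M : ChainModel C)
    (hM : ∀ n, HasTop (M.model n))
    (homotopy : NaturallyHomotopic (Functor.whiskerRight (cylinderEnd J false) C)
      (Functor.whiskerRight (cylinderEnd J true) C))
    (dimension : ∀ (X : Cl.{u}) [Unique X], ∃ p : C.obj X ⟶ C.obj X,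
      Nonempty (Homotopy (𝟙 _) p) ∧ ∀ n, 1 ≤ n → p.f n = 0) :
    IsChainTheory J C where
  projective := M.projective
  isZero_of_isEmpty := M.isZero_of_isEmpty
  exists_retraction := M.exists_retraction
  homotopy := homotopy
  dimension := dimension
  small_zero X A B h z := by
    obtain ⟨a, b, hab⟩ := M.exists_add (fun σ => (hM 0).forall_mem_or h σ) z
    -- Every chain is already small, so no boundary correction is needed.
    exact ⟨0, a, b, by rw [map_zero, zero_add, hab]⟩
  small_succ X A B h n z _ _ _ := by
    obtain ⟨a, b, hab⟩ := M.exists_add (fun σ => (hM (n + 1)).forall_mem_or h σ) z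
    exact ⟨0, a, b, by rw [map_zero, zero_add, hab]⟩

theorem isChainTheory_simplicialChains_J1 : IsChainTheory.{u} .J1 (simplicialChains .J1) :=
  (simplicialModel .J1).isChainTheory_of_hasTop (fun n => (hasTop_Jtop n).ulift)
    (simplicial_homotopy _) (simplicial_dimension _)

theorem isChainTheory_simplicialChains_Jplus :
    IsChainTheory.{u} .Jplus (simplicialChains .Jplus) :=
  (simplicialModel .Jplus).isChainTheory_of_hasTop (fun n => (hasTop_Jle n).ulift)
    (simplicial_homotopy _) (simplicial_dimension _)

theorem isChainTheory_cubicalChains_J1 : IsChainTheory.{u} .J1 (cubicalChains .J1) :=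
  (cubicalModel .J1).isChainTheory_of_hasTop
    (fun n => HasTop.ulift (X := ⟨IntervalKind.J1.Cube n⟩) (.pi fun _ => hasTop_Jtop 1))
    (cubical_homotopy _) (cubical_dimension _)

theorem isChainTheory_cubicalChains_Jplus : IsChainTheory.{u} .Jplus (cubicalChains .Jplus) :=
  (cubicalModel .Jplus).isChainTheory_of_hasTop
    (fun n => HasTop.ulift (X := ⟨IntervalKind.Jplus.Cube n⟩) (.pi fun _ => hasTop_Jle 1))
    (cubical_homotopy _) (cubical_dimension _)

end CechClosure

namespace CechClosure

/-! ### Contractibility of the topological models -/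

theorem isNhd_ofTopology {X : Type u} [TopologicalSpace X] {V : Set X} {x : X} :
    @IsNhd X (ofTopology X) V x ↔ V ∈ nhds x := by
  rw [← mem_interior_iff_mem_nhds, interior_eq_compl_closure_compl]
  exact Iff.rfl

/-- The domain carries the product of closures, not the closure of the product topology; the two are
compared through boxes of neighborhoods. -/
theorem Continuous.of_topological_prod {X : Type u} {Y : Type v} {Z : Type w} [TopologicalSpace X]
    [TopologicalSpace Y] [TopologicalSpace Z] {f : X × Y → Z} (hf : _root_.Continuous f) :
    @Continuous (X × Y) Z (@instProd X Y (ofTopology X) (ofTopology Y)) (ofTopology Z) f := by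
  let _ := ofTopology X
  let _ := ofTopology Y
  let _ := ofTopology Z
  refine continuous_iff_nhd.2 fun p V hV => ?_
  have h := hf.continuousAt.preimage_mem_nhds (isNhd_ofTopology.1 hV)
  obtain ⟨U, hU, W, hW, hUW⟩ := mem_nhds_prod_iff.1 h
  exact isNhd_prod_iff.2 ⟨U, W, isNhd_ofTopology.2 hU, isNhd_ofTopology.2 hW, hUW⟩

theorem isContractible_uliftCl {J : IntervalKind} {M : Cl.{0}} (x : M)
    (H : ContMap (M × J.space) M) (h₀ : ∀ y, H (y, J.endpoint false) = x)
    (h₁ : ∀ y, H (y, J.endpoint true) = y) : IsContractible J (uliftCl.{u} M) := by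
  refine ⟨ULift.up x, (uliftUp M).comp (H.comp ⟨fun p : uliftCl.{u} M × J.space => (p.1.down, p.2),
    Continuous.prodMk ((uliftDown M).cont.comp continuous_fst) continuous_snd⟩), ?_, ?_⟩
  · exact ContMap.ext (funext fun y => congrArg ULift.up (h₀ y.down))
  · exact ContMap.ext (funext fun y => congrArg ULift.up (h₁ y.down))

/-- Multiplication on the unit interval. -/
def intervalMul : ContMap (IntervalKind.I.space × IntervalKind.I.space) IntervalKind.I.space where
  toFun := fun p : unitInterval × unitInterval => p.1 * p.2
  cont := Continuous.of_topological_prod (X := unitInterval) (Y := unitInterval)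
    (Z := unitInterval) continuous_mul

theorem isContractible_cube (n : ℕ) :
    IsContractible .I (uliftCl.{u} ⟨IntervalKind.I.Cube n⟩) := by
  refine isContractible_uliftCl (M := ⟨IntervalKind.I.Cube n⟩) (fun _ => (0 : unitInterval))
    ⟨fun p i => intervalMul (p.1 i, p.2), continuous_pi fun i => intervalMul.cont.comp
      (((continuous_apply i).comp continuous_fst).prodMk continuous_snd)⟩ ?_ ?_
  · exact fun y => funext fun i => mul_zero (M₀ := unitInterval) (y i)
  · exact fun y => funext fun i => mul_one (M := unitInterval) (y i)

theorem isContractible_simplex (n : ℕ) :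
    IsContractible .I (uliftCl.{u} (IntervalKind.I.simplex n)) := by
  let v : stdSimplex ℝ (Fin (n + 1)) := stdSimplex.vertex 0
  -- The straight-line homotopy from vertex `0`, which stays in the simplex by convexity.
  let H : stdSimplex ℝ (Fin (n + 1)) × unitInterval → stdSimplex ℝ (Fin (n + 1)) := fun p =>
    ⟨(1 - p.2.1) • v.1 + p.2.1 • p.1.1, convex_stdSimplex ℝ _ v.2 p.1.2 (by linarith [p.2.2.2])
      p.2.2.1 (by ring)⟩
  have hH : _root_.Continuous H := by
    refine _root_.Continuous.subtype_mk ?_ _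
    fun_prop
  refine isContractible_uliftCl (M := topSimplex n) (J := .I) v
    ⟨H, Continuous.of_topological_prod (X := stdSimplex ℝ (Fin (n + 1))) (Y := unitInterval)
      (Z := stdSimplex ℝ (Fin (n + 1))) hH⟩ ?_ ?_
  · intro y
    refine Subtype.ext ?_
    change (1 - (0 : ℝ)) • v.1 + (0 : ℝ) • _ = v.1
    simp
  · intro y
    refine Subtype.ext ?_
    change (1 - (1 : ℝ)) • v.1 + (1 : ℝ) • _ = _
    rw [sub_self, zero_smul, one_smul, zero_add]

theorem exactInPosDegrees_simplicialChains {J : IntervalKind} {X : Cl.{u}}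
    (hX : IsContractible J X) : ExactInPosDegrees ((simplicialChains J).obj X) := by
  obtain ⟨p, ⟨h⟩, hp⟩ := simplicial_dimension J point.{u}
  exact exactInPosDegrees_of_isContractible (simplicial_homotopy J)
    (exactInPosDegrees_of_homotopy h hp) hX

theorem exactInPosDegrees_cubicalChains {J : IntervalKind} {X : Cl.{u}}
    (hX : IsContractible J X) : ExactInPosDegrees ((cubicalChains J).obj X) := by
  obtain ⟨p, ⟨h⟩, hp⟩ := cubical_dimension J point.{u}
  exact exactInPosDegrees_of_isContractible (cubical_homotopy J)
    (exactInPosDegrees_of_homotopy h hp) hX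

end CechClosure

namespace CechClosure

/-! ### Small chains -/

section Small

/-- A chain of `X` is small with respect to `A` and `B` if it is the sum of a chain of `A` and a
chain of `B`. -/
def IsSmall (C : Cl.{u} ⥤ ChainComplex AddCommGrpCat.{u} ℕ) {X : Cl.{u}} (A B : Set X) {n : ℕ}
    (z : (C.obj X).X n) : Prop :=
  ∃ a b, z = (C.map (X := ⟨A⟩) (Y := X) (inclMap A)).f n a +
    (C.map (X := ⟨B⟩) (Y := X) (inclMap B)).f n b

variable {C D : Cl.{u} ⥤ ChainComplex AddCommGrpCat.{u} ℕ} {X : Cl.{u}} {A B : Set X} {n : ℕ}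

theorem IsSmall.zero : IsSmall C A B (0 : (C.obj X).X n) :=
  ⟨0, 0, by rw [map_zero, map_zero, add_zero]⟩

theorem IsSmall.add {y z : (C.obj X).X n} (hy : IsSmall C A B y) (hz : IsSmall C A B z) :
    IsSmall C A B (y + z) := by
  obtain ⟨a, b, rfl⟩ := hy
  obtain ⟨a', b', rfl⟩ := hz
  exact ⟨a + a', b + b', by rw [map_add, map_add]; abel⟩

theorem IsSmall.neg {z : (C.obj X).X n} (hz : IsSmall C A B z) : IsSmall C A B (-z) := by
  obtain ⟨a, b, rfl⟩ := hz
  exact ⟨-a, -b, by rw [map_neg, map_neg]; abel⟩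

theorem IsSmall.sub {y z : (C.obj X).X n} (hy : IsSmall C A B y) (hz : IsSmall C A B z) :
    IsSmall C A B (y - z) := sub_eq_add_neg y z ▸ hy.add hz.neg

theorem IsSmall.map {m : ℕ} {t : ∀ X : Cl.{u}, (C.obj X).X n ⟶ (D.obj X).X m}
    (ht : ∀ {X Y : Cl.{u}} (f : X ⟶ Y), (C.map f).f n ≫ t Y = t X ≫ (D.map f).f m)
    {z : (C.obj X).X n} (hz : IsSmall C A B z) : IsSmall D A B (t X z) := by
  obtain ⟨a, b, rfl⟩ := hz
  refine ⟨t _ a, t _ b, ?_⟩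
  rw [map_add]
  exact congrArg₂ (· + ·) (ConcreteCategory.congr_hom (ht _) a)
    (ConcreteCategory.congr_hom (ht _) b)

theorem IsSmall.map_natTrans (φ : C ⟶ D) {z : (C.obj X).X n} (hz : IsSmall C A B z) :
    IsSmall D A B ((φ.app X).f n z) :=
  hz.map (t := fun X => (φ.app X).f n) fun f => HomologicalComplex.congr_hom (φ.naturality f) n

variable (C A B) in
/-- Every chain of degree `n` whose boundary is small is small up to a boundary. -/
def SmallApprox (n : ℕ) : Prop :=
  -- For `n = 0` no such `m` exists and the condition on the boundary is void.
  ∀ z : (C.obj X).X n, (∀ m, m + 1 = n → IsSmall C A B ((C.obj X).d n m z)) →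
    ∃ w : (C.obj X).X (n + 1), IsSmall C A B (z - (C.obj X).d (n + 1) n w)

/-- In `z - φ z = T d z + d T z` the term `T d z` is small, because a natural operator preserves
small chains; what remains is a boundary. -/
theorem exists_isSmall_sub_of_naturallyHomotopic {φ : C ⟶ C} (h : NaturallyHomotopic (𝟙 C) φ)
    {z : (C.obj X).X n} (hz : ∀ m, m + 1 = n → IsSmall C A B ((C.obj X).d n m z)) :
    ∃ w : (C.obj X).X (n + 1),
      IsSmall C A B (z - (φ.app X).f n z - (C.obj X).d (n + 1) n w) := by
  obtain ⟨T, hT, h₀, h₁⟩ := h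
  refine ⟨T n X z, ?_⟩
  cases n with
  | zero =>
    have := ConcreteCategory.congr_hom (h₀ X) z
    have : z - (φ.app X).f 0 z = (C.obj X).d 1 0 (T 0 X z) := this
    rw [this, sub_self]
    exact IsSmall.zero
  | succ n =>
    have := ConcreteCategory.congr_hom (h₁ X n) z
    have : z - (φ.app X).f (n + 1) z =
      T n X ((C.obj X).d (n + 1) n z) + (C.obj X).d (n + 2) (n + 1) (T (n + 1) X z) := this
    rw [this, add_sub_cancel_right]
    exact (hz n rfl).map (t := T n) (hT n)

/-- Each passage from `z` to `φ z` costs only a small chain and a boundary and keeps the boundary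
small, so finitely many passages may be summed. -/
theorem SmallApprox.of_iterate {φ : C ⟶ C} (h : NaturallyHomotopic (𝟙 C) φ)
    (hφ : ∀ z : (C.obj X).X n, ∃ m, IsSmall C A B (((φ.app X).f n)^[m] z)) :
    SmallApprox C A B n := by
  intro z hz
  obtain ⟨m, hm⟩ := hφ z
  induction m generalizing z with
  | zero => exact ⟨0, by rwa [map_zero, sub_zero]⟩
  | succ m ih =>
    obtain ⟨w, hw⟩ := ih ((φ.app X).f n z) (fun k hk => by
      have := ConcreteCategory.congr_hom ((φ.app X).comm n k) z
      have : (C.obj X).d n k ((φ.app X).f n z) = (φ.app X).f k ((C.obj X).d n k z) := this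
      rw [this]
      exact (hz k hk).map_natTrans φ) hm
    obtain ⟨w', hw'⟩ := exists_isSmall_sub_of_naturallyHomotopic h hz
    refine ⟨w + w', ?_⟩
    convert hw.add hw' using 1
    rw [map_add]
    abel

/-- The image in `D` is approximated and brought back by `ψ`; the difference between `z` and its
round trip is small up to a boundary. Only the composite on `C` has to be homotopic to the identity.
-/
theorem SmallApprox.transfer (φ : C ⟶ D) (ψ : D ⟶ C) (h : NaturallyHomotopic (𝟙 C) (φ ≫ ψ))
    (hD : SmallApprox D A B n) : SmallApprox C A B n := by
  intro z hz
  obtain ⟨w, hw⟩ := hD ((φ.app X).f n z) (fun k hk => by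
    have := ConcreteCategory.congr_hom ((φ.app X).comm n k) z
    have : (D.obj X).d n k ((φ.app X).f n z) = (φ.app X).f k ((C.obj X).d n k z) := this
    rw [this]
    exact (hz k hk).map_natTrans φ)
  obtain ⟨w', hw'⟩ := exists_isSmall_sub_of_naturallyHomotopic h hz
  refine ⟨(ψ.app X).f (n + 1) w + w', ?_⟩
  have hw := hw.map_natTrans ψ
  rw [map_sub] at hw
  have e := ConcreteCategory.congr_hom ((ψ.app X).comm (n + 1) n) w
  have e : (C.obj X).d (n + 1) n ((ψ.app X).f (n + 1) w) =
    (ψ.app X).f n ((D.obj X).d (n + 1) n w) := e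
  rw [← e] at hw
  convert hw.add hw' using 1
  rw [map_add]
  change _ = (((φ ≫ ψ).app X).f n z - _) + _
  abel

theorem ChainModel.isChainTheory {J : IntervalKind} (M : ChainModel C)
    (homotopy : NaturallyHomotopic (Functor.whiskerRight (cylinderEnd J false) C)
      (Functor.whiskerRight (cylinderEnd J true) C))
    (dimension : ∀ (X : Cl.{u}) [Unique X], ∃ p : C.obj X ⟶ C.obj X,
      Nonempty (Homotopy (𝟙 _) p) ∧ ∀ n, 1 ≤ n → p.f n = 0)
    (small : ∀ (X : Cl.{u}) (A B : Set X), interior A ∪ interior B = Set.univ →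
      ∀ n, SmallApprox C A B n) :
    IsChainTheory J C where
  projective := M.projective
  isZero_of_isEmpty := M.isZero_of_isEmpty
  exists_retraction := M.exists_retraction
  homotopy := homotopy
  dimension := dimension
  small_zero X A B h z := by
    obtain ⟨w, a, b, hw⟩ := small X A B h 0 z (fun m hm => by lia)
    exact ⟨w, a, b, by rw [sub_eq_iff_eq_add.1 hw]; abel⟩
  small_succ X A B h n z a b hz := by
    obtain ⟨w, a, b, hw⟩ := small X A B h (n + 1) z (fun m hm => by
      obtain rfl : m = n := by lia
      exact ⟨a, b, hz⟩)
    exact ⟨w, a, b, by rw [sub_eq_iff_eq_add.1 hw]; abel⟩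

end Small

end CechClosure

namespace CechClosure

/-! ### Subdivision of cubes -/

section Subdivision

variable {n : ℕ} {X : Cl.{u}}

/-- The affine map of the unit interval onto its first (for `false`) or second half. -/
noncomputable def intervalHalf (e : Bool) : ContMap IntervalKind.I.space IntervalKind.I.space where
  toFun := fun t : unitInterval => (⟨(t.1 + if e then 1 else 0) / 2, by
    have := t.2.1
    split_ifs <;> linarith, by
    have := t.2.2
    split_ifs <;> linarith⟩ : unitInterval)
  cont := Continuous.of_topological (X := unitInterval) (Y := unitInterval)
    (_root_.Continuous.subtype_mk (by fun_prop) _)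

theorem intervalHalf_false_false : intervalHalf false (IntervalKind.I.endpoint false) =
    IntervalKind.I.endpoint false :=
  Subtype.ext (by change ((0 : ℝ) + 0) / 2 = 0; norm_num)

theorem intervalHalf_true_true : intervalHalf true (IntervalKind.I.endpoint true) =
    IntervalKind.I.endpoint true :=
  Subtype.ext (by change ((1 : ℝ) + 1) / 2 = 1; norm_num)

theorem intervalHalf_false_true : intervalHalf false (IntervalKind.I.endpoint true) =
    intervalHalf true (IntervalKind.I.endpoint false) :=
  Subtype.ext (by change ((1 : ℝ) + 0) / 2 = (0 + 1) / 2; norm_num)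

/-- The inclusion of one of the `2ⁿ` subcubes with edges of length `1/2`. -/
noncomputable def subcube (ε : Fin n → Bool) :
    ContMap (IntervalKind.I.Cube n) (IntervalKind.I.Cube n) :=
  ⟨fun a i => intervalHalf (ε i) (a i),
    continuous_pi fun i => (intervalHalf (ε i)).cont.comp (continuous_apply i)⟩

/-- The restriction of a cube to the slice where the `i`-th coordinate is `t`. -/
def cubeSlice {J : IntervalKind} (i : Fin (n + 1)) (t : J.space) (σ : SingularCube J (n + 1) X) :
    SingularCube J n X :=
  σ.comp ⟨fun a => i.insertNth t a, continuous_insertNth i t⟩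

/-- The `i`-th bit decides at which of `0`, `1/2`, `1` the big cube is sliced; the other bits
subdivide the slice. -/
theorem cubeFace_subcube (σ : SingularCube .I (n + 1) X) (i : Fin (n + 1)) (e e' : Bool)
    (ε : Fin n → Bool) : cubeFace i e (σ.comp (subcube (i.insertNth (α := fun _ => Bool) e' ε))) =
      (cubeSlice i (intervalHalf e' (IntervalKind.I.endpoint e)) σ).comp (subcube ε) := by
  refine ContMap.ext (funext fun a => congrArg σ.toFun (funext fun k => ?_))
  change intervalHalf (i.insertNth (α := fun _ => Bool) e' ε k)
    (i.insertNth (α := fun _ => IntervalKind.I.space) (IntervalKind.I.endpoint e) a k) =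
    i.insertNth (α := fun _ => IntervalKind.I.space) (intervalHalf e' (IntervalKind.I.endpoint e))
      (fun l => intervalHalf (ε l) (a l)) k
  rcases Fin.eq_self_or_eq_succAbove i k with rfl | ⟨k, rfl⟩
  · simp only [Fin.insertNth_apply_same]
  · simp only [Fin.insertNth_apply_succAbove]

theorem isDegenerate_comp_subcube {σ : SingularCube .I n X} (h : IsDegenerate σ)
    (ε : Fin n → Bool) : IsDegenerate (σ.comp (subcube ε)) := by
  obtain ⟨i, hi⟩ := h
  refine ⟨i, fun a b hab => hi _ _ fun k hk => ?_⟩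
  exact congrArg (intervalHalf (ε k)) (hab k hk)

theorem sum_subcube_faces (σ : SingularCube .I (n + 1) X) (i : Fin (n + 1)) :
    ∑ ε : Fin (n + 1) → Bool, (cubeClass (cubeFace i false (σ.comp (subcube ε))) -
      cubeClass (cubeFace i true (σ.comp (subcube ε)))) =
    ∑ ε : Fin n → Bool, (cubeClass ((cubeFace i false σ).comp (subcube ε)) -
      cubeClass ((cubeFace i true σ).comp (subcube ε))) := by
  rw [← (Fin.insertNthEquiv (fun _ => Bool) i).sum_comp, Fintype.sum_prod_type_right]
  refine Finset.sum_congr rfl fun ε _ => ?_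
  rw [Fintype.sum_bool]
  have h := fun e e' => congrArg cubeClass (cubeFace_subcube σ i e e' ε)
  refine (congrArg₂ (· + ·) (congrArg₂ (· - ·) (h false true) (h true true))
    (congrArg₂ (· - ·) (h false false) (h true false))).trans ?_
  -- The two faces at `1/2`, shared by neighboring subcubes, cancel and only the outer faces remain.
  rw [intervalHalf_false_false, intervalHalf_true_true, intervalHalf_false_true]
  exact sub_add_sub_cancel' _ _ _

theorem exists_subdivision : ∃ S : cubicalChains.{u} .I ⟶ cubicalChains .I,
    ∀ (n : ℕ) (X : Cl.{u}) (σ : SingularCube .I n X),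
      (S.app X).f n (cubeClass σ) = ∑ ε : Fin n → Bool, cubeClass (σ.comp (subcube ε)) := by
  have h : ∀ (n : ℕ) (X : Cl.{u}), ∃ s : ((cubicalChains .I).obj X).X n ⟶
      ((cubicalChains .I).obj X).X n, ∀ σ : SingularCube .I n X,
      s (cubeClass σ) = ∑ ε : Fin n → Bool, cubeClass (σ.comp (subcube ε)) := fun n X => by
    obtain ⟨s, hs⟩ := (cubicalModel .I).exists_lift (n := n) (X := X)
      (fun σ => ∑ ε : Fin n → Bool, cubeClass ((uliftHomEquiv _ _ σ).comp (subcube ε)))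
      fun σ i hi => Finset.sum_eq_zero fun ε _ => cubeClass_eq_zero
        (isDegenerate_comp_subcube (σ := uliftHomEquiv ⟨IntervalKind.I.Cube n⟩ X σ)
          (isDegenerate_iff.2 ⟨i, congrArg (uliftHomEquiv _ X) hi⟩) ε)
    exact ⟨s, fun σ => hs ((uliftHomEquiv _ _).symm σ)⟩
  choose s hs using h
  refine ⟨{ app := fun X => { f := fun n => s n X, comm' := ?_ }, naturality := ?_ },
    fun n X σ => hs n X σ⟩
  · rintro _ n rfl
    refine (cubicalModel .I).hom_ext fun σ => ?_
    obtain ⟨σ, rfl⟩ := (uliftHomEquiv _ _).symm.surjective σ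
    change ((cubicalChains .I).obj X).d (n + 1) n (s (n + 1) X (cubeClass σ)) =
      s n X (((cubicalChains .I).obj X).d (n + 1) n (cubeClass σ))
    rw [hs, map_sum, cubicalChains_d_cubeClass, map_sum]
    simp only [cubicalChains_d_cubeClass, map_zsmul, map_sub, hs]
    rw [Finset.sum_comm]
    refine Finset.sum_congr rfl fun i _ => ?_
    rw [← Finset.smul_sum, sum_subcube_faces, Finset.sum_sub_distrib]
  · intro X Y f
    ext1 n
    refine (cubicalModel .I).hom_ext fun σ => ?_
    obtain ⟨σ, rfl⟩ := (uliftHomEquiv _ _).symm.surjective σ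
    change s n Y (((cubicalChains .I).map f).f n (cubeClass σ)) =
      ((cubicalChains .I).map f).f n (s n X (cubeClass σ))
    rw [hs, map_sum, cubicalChains_map_cubeClass, hs]
    rfl

/-- Acyclic models apply since cubes are contractible and a `0`-cube has itself as its only subcube.
-/
theorem naturallyHomotopic_subdivision {S : cubicalChains.{u} .I ⟶ cubicalChains .I}
    (hS : ∀ (n : ℕ) (X : Cl.{u}) (σ : SingularCube .I n X),
      (S.app X).f n (cubeClass σ) = ∑ ε : Fin n → Bool, cubeClass (σ.comp (subcube ε))) :
    NaturallyHomotopic (𝟙 (cubicalChains .I)) S := by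
  refine (cubicalModel .I).naturallyHomotopic (fun X => ?_)
    fun n => exactInPosDegrees_cubicalChains (isContractible_cube n)
  refine (cubicalModel .I).hom_ext fun σ => ?_
  refine Eq.trans ?_ (hS 0 X (uliftHomEquiv _ _ σ)).symm
  rw [Fintype.sum_unique]
  exact congrArg cubeClass (ContMap.ext (funext fun a => congrArg (uliftHomEquiv _ X σ).toFun
    (funext fun k => k.elim0)))

end Subdivision

end CechClosure

namespace CechClosure

/-! ### Excision for the unit interval -/

section Lebesgue

variable {n : ℕ} {X : Cl.{u}} {A B : Set X}

theorem mem_nhds_of_isNhd_cube {V : Set (IntervalKind.I.Cube n)} {a : Fin n → unitInterval}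
    (h : IsNhd (X := IntervalKind.I.Cube n) V a) : (V : Set (Fin n → unitInterval)) ∈ nhds a := by
  obtain ⟨F, W, hW, hV⟩ := isNhd_pi_iff.1 h
  refine Filter.mem_of_superset (set_pi_mem_nhds F.finite_toSet fun i hi =>
    isNhd_ofTopology.1 (hW i hi)) ?_
  exact fun b hb => hV hb

/-- Singular cubes are small on all sufficiently small subsets of the cube. -/
theorem exists_lebesgue (h : interior A ∪ interior B = Set.univ) (σ : SingularCube .I n X) :
    ∃ δ > 0, ∀ κ : IntervalKind.I.Cube n → IntervalKind.I.Cube n,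
      (∀ a b i, dist (α := unitInterval) (κ a i) (κ b i) < δ) →
      (∀ a, σ (κ a) ∈ A) ∨ ∀ a, σ (κ a) ∈ B := by
  -- The closure on `X` need not be idempotent, so `i(A)` need not be open. The cover consists of
  -- the topological interiors of the preimages of `A` and `B`.
  let c : Bool → Set (Fin n → unitInterval) := fun e =>
    _root_.interior {a | σ a ∈ bif e then A else B}
  have hc : (Set.univ : Set (Fin n → unitInterval)) ⊆ ⋃ e, c e := by
    intro a _
    rcases (h ▸ Set.mem_univ (σ a) : σ a ∈ interior A ∪ interior B) with ha | ha
    · exact Set.mem_iUnion.2 ⟨true, mem_interior_iff_mem_nhds.2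
        (mem_nhds_of_isNhd_cube (continuous_iff_nhd.1 σ.cont a A ha))⟩
    · exact Set.mem_iUnion.2 ⟨false, mem_interior_iff_mem_nhds.2
        (mem_nhds_of_isNhd_cube (continuous_iff_nhd.1 σ.cont a B ha))⟩
  obtain ⟨δ, hδ, hball⟩ := lebesgue_number_lemma_of_metric isCompact_univ
    (fun e => isOpen_interior) hc
  refine ⟨δ, hδ, fun κ hκ => ?_⟩
  -- Any base point would do: the image of `κ` lies in the ball of radius `δ` around `κ a₀`.
  let a₀ : IntervalKind.I.Cube n := fun _ => IntervalKind.I.endpoint false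
  obtain ⟨e, he⟩ := hball (κ a₀ : Fin n → unitInterval) trivial
  have key : ∀ a, σ (κ a) ∈ bif e then A else B := fun a => by
    have h₁ : dist (α := Fin n → unitInterval) (κ a) (κ a₀) < δ :=
      (dist_pi_lt_iff (X := fun _ : Fin n => unitInterval) hδ).2 fun i => hκ a a₀ i
    exact interior_subset (s := {a : Fin n → unitInterval | σ a ∈ bif e then A else B}) (he h₁)
  cases e
  · exact Or.inr key
  · exact Or.inl key

theorem dist_intervalHalf (e : Bool) (s t : unitInterval) :
    dist (α := unitInterval) (intervalHalf e s) (intervalHalf e t) = dist s t / 2 := by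
  change |(s.1 + if e then 1 else 0) / 2 - (t.1 + if e then 1 else 0) / 2| = |s.1 - t.1| / 2
  rw [← sub_div, add_sub_add_right_eq_sub, abs_div, abs_two]

/-- The iterated subdivision of a cube consists of restrictions of the cube along maps which
contract every coordinate by `2⁻ᵐ`. -/
theorem iterate_subdivision_mem {S : cubicalChains.{u} .I ⟶ cubicalChains .I}
    (hS : ∀ (n : ℕ) (X : Cl.{u}) (σ : SingularCube .I n X),
      (S.app X).f n (cubeClass σ) = ∑ ε : Fin n → Bool, cubeClass (σ.comp (subcube ε)))
    (σ : SingularCube .I n X) (m : ℕ) :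
    ((S.app X).f n)^[m] (cubeClass σ) ∈ AddSubgroup.closure
      {z | ∃ κ : ContMap (IntervalKind.I.Cube n) (IntervalKind.I.Cube n),
        (∀ a b i, dist (α := unitInterval) (κ a i) (κ b i) ≤
          (1 / 2) ^ m * dist (α := unitInterval) (a i) (b i)) ∧
          z = cubeClass (σ.comp κ)} := by
  induction m with
  | zero =>
    refine AddSubgroup.subset_closure ⟨⟨id, continuous_id⟩, fun a b i => ?_, rfl⟩
    rw [pow_zero, one_mul]
    exact le_rfl
  | succ m ih =>
    rw [Function.iterate_succ_apply']
    generalize ((S.app X).f n)^[m] (cubeClass σ) = z at ih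
    induction ih using AddSubgroup.closure_induction with
    | mem z hz =>
      obtain ⟨κ, hκ, rfl⟩ := hz
      rw [hS]
      refine sum_mem fun ε _ => AddSubgroup.subset_closure ⟨κ.comp (subcube ε), ?_, rfl⟩
      intro a b i
      refine (hκ _ _ i).trans (le_of_eq ?_)
      refine (congrArg _ (dist_intervalHalf (ε i) (a i) (b i))).trans ?_
      rw [pow_succ]
      ring
    | zero => rw [map_zero]; exact zero_mem _
    | add x y _ _ hx hy => rw [map_add]; exact add_mem hx hy
    | neg x _ hx => rw [map_neg]; exact neg_mem hx

/-- The bound covers all later iterates, so that a combination of chains can use the larger of two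
bounds. On a cube, `m` is chosen so that `2⁻ᵐ` is below its Lebesgue number. -/
theorem exists_isSmall_iterate_subdivision {S : cubicalChains.{u} .I ⟶ cubicalChains .I}
    (hS : ∀ (n : ℕ) (X : Cl.{u}) (σ : SingularCube .I n X),
      (S.app X).f n (cubeClass σ) = ∑ ε : Fin n → Bool, cubeClass (σ.comp (subcube ε)))
    (h : interior A ∪ interior B = Set.univ) (z : ((cubicalChains .I).obj X).X n) :
    ∃ m, ∀ k ≥ m, IsSmall (cubicalChains .I) A B (((S.app X).f n)^[k] z) := by
  induction z using (cubicalModel .I).induction with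
  | h_zero => exact ⟨0, fun k _ => by
      rw [iterate_map_zero]
      exact IsSmall.zero⟩
  | h_gen σ =>
    obtain ⟨σ, rfl⟩ := (uliftHomEquiv _ _).symm.surjective σ
    obtain ⟨δ, hδ, hσ⟩ := exists_lebesgue h σ
    obtain ⟨m, hm⟩ := exists_pow_lt_of_lt_one hδ (by norm_num : (1 / 2 : ℝ) < 1)
    refine ⟨m, fun k hk => ?_⟩
    have hz := iterate_subdivision_mem hS σ k
    change IsSmall (cubicalChains .I) A B (((S.app X).f n)^[k] (cubeClass σ))
    generalize ((S.app X).f n)^[k] (cubeClass σ) = z at hz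
    induction hz using AddSubgroup.closure_induction with
    | mem z hz =>
      obtain ⟨κ, hκ, rfl⟩ := hz
      have hκ' : ∀ a b i, dist (α := unitInterval) (κ a i) (κ b i) < δ := fun a b i => by
        refine (hκ a b i).trans_lt (lt_of_le_of_lt ?_ hm)
        have h₁ : dist (α := unitInterval) (a i) (b i) ≤ 1 :=
          Real.dist_le_of_mem_Icc_01 (Subtype.prop (p := (· ∈ unitInterval)) (a i))
            (Subtype.prop (p := (· ∈ unitInterval)) (b i))
        refine (mul_le_of_le_one_right (by positivity) h₁).trans ?_
        exact pow_le_pow_of_le_one (by norm_num) (by norm_num) hk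
      rcases hσ κ hκ' with hA | hB
      · refine ⟨cubeClass (X := ⟨A⟩) ⟨fun a => ⟨σ (κ a), hA a⟩, (σ.comp κ).cont.subtype hA⟩, 0, ?_⟩
        rw [map_zero, add_zero]
        rfl
      · refine ⟨0, cubeClass (X := ⟨B⟩) ⟨fun a => ⟨σ (κ a), hB a⟩, (σ.comp κ).cont.subtype hB⟩, ?_⟩
        rw [map_zero, zero_add]
        rfl
    | zero => exact IsSmall.zero
    | add x y _ _ hx hy => exact hx.add hy
    | neg x _ hx => exact hx.neg
  | h_sub x y hx hy =>
    obtain ⟨m, hm⟩ := hx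
    obtain ⟨m', hm'⟩ := hy
    refine ⟨max m m', fun k hk => ?_⟩
    rw [iterate_map_sub]
    exact (hm k (le_of_max_le_left hk)).sub (hm' k (le_of_max_le_right hk))

theorem smallApprox_cubicalChains_I (h : interior A ∪ interior B = Set.univ) (n : ℕ) :
    SmallApprox (cubicalChains .I) A B n := by
  obtain ⟨S, hS⟩ := exists_subdivision.{u}
  refine SmallApprox.of_iterate (naturallyHomotopic_subdivision hS) fun z => ?_
  obtain ⟨m, hm⟩ := exists_isSmall_iterate_subdivision hS h z
  exact ⟨m, hm m le_rfl⟩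

end Lebesgue

theorem isChainTheory_cubicalChains_I : IsChainTheory.{u} .I (cubicalChains .I) :=
  (cubicalModel .I).isChainTheory (cubical_homotopy _) (cubical_dimension _)
    fun _ _ _ h => smallApprox_cubicalChains_I h

end CechClosure

namespace CechClosure

/-! ### Comparison of simplicial and cubical chains -/

/-- With no degenerate generators in degree zero, precomposition with `q` defines the map there, and
acyclic models extend it. -/
theorem ChainModel.exists_chainMap_of_isContractible {J : IntervalKind}
    {F G : Cl.{u} ⥤ ChainComplex AddCommGrpCat.{u} ℕ} (M : ChainModel F) (N : ChainModel G)
    [IsEmpty (M.idx 0)] (q : N.model 0 ⟶ M.model 0) (hF : (F.obj point).d 1 0 = 0)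
    (hG : NaturallyHomotopic (Functor.whiskerRight (cylinderEnd J false) G)
      (Functor.whiskerRight (cylinderEnd J true) G)) (hpt : ExactInPosDegrees (G.obj point))
    (hM : ∀ n, IsContractible J (M.model n)) :
    ∃ φ : F ⟶ G, ∀ (X : Cl.{u}) (σ : M.model 0 ⟶ X),
      (φ.app X).f 0 (M.gen σ) = N.gen (q ≫ σ) := by
  choose t ht using fun X : Cl.{u} => M.exists_lift (n := 0) (X := X)
    (fun σ => N.gen (q ≫ σ)) fun σ i => isEmptyElim i
  have htn : ∀ {X Y : Cl.{u}} (f : X ⟶ Y), (F.map f).f 0 ≫ t Y = t X ≫ (G.map f).f 0 :=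
    fun {X Y} f => M.hom_ext fun σ => by
      change t Y ((F.map f).f 0 (M.gen σ)) = (G.map f).f 0 (t X (M.gen σ))
      rw [M.map_gen, ht, ht, N.map_gen, Category.assoc]
  -- In degree zero a chain of a contractible model bounds once its image in the point vanishes. The
  -- image of a boundary does, because the first differential of the point is zero.
  have h₀ : ∀ x, ∃ w, (G.obj (M.model 1)).d 1 0 w = t _ ((F.obj (M.model 1)).d 1 0 x) := by
    intro x
    obtain ⟨y, h, hh, -⟩ := exists_contraction hG (hM 1)
    refine ⟨-h 0 (t _ ((F.obj (M.model 1)).d 1 0 x)), ?_⟩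
    have h₁ : (G.map (toPoint (M.model 1))).f 0 (t _ ((F.obj (M.model 1)).d 1 0 x)) = 0 := by
      refine (ConcreteCategory.congr_hom (htn (toPoint _)) _).symm.trans ?_
      change t point ((F.map (toPoint _)).f 0 ((F.obj (M.model 1)).d 1 0 x)) = 0
      have h₂ : (F.map (toPoint _)).f 0 ((F.obj (M.model 1)).d 1 0 x) =
          (F.obj point).d 1 0 ((F.map (toPoint _)).f 1 x) :=
        (ConcreteCategory.congr_hom ((F.map (toPoint _)).comm 1 0) x).symm
      rw [h₂, hF]
      exact map_zero _
    rw [map_neg, ← hh, h₁, map_zero, zero_sub, neg_neg]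
  obtain ⟨φ, hφ⟩ := M.exists_chainMap t htn h₀
    fun n => exactInPosDegrees_of_isContractible hG hpt (hM n)
  exact ⟨φ, fun X σ => (ConcreteCategory.congr_hom (hφ X) _).trans (ht X σ)⟩

theorem exists_simplicial_cubical : ∃ (φ : simplicialChains.{u} .I ⟶ cubicalChains .I)
    (ψ : cubicalChains.{u} .I ⟶ simplicialChains .I),
    NaturallyHomotopic (𝟙 (simplicialChains .I)) (φ ≫ ψ) := by
  let M := simplicialModel.{u} .I
  let N := cubicalModel.{u} .I
  have : IsEmpty (M.idx 0) := inferInstanceAs (IsEmpty Empty)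
  have : IsEmpty (N.idx 0) := inferInstanceAs (IsEmpty (Fin 0))
  obtain ⟨x⟩ := M.nonempty 0
  obtain ⟨y⟩ := N.nonempty 0
  let q : N.model 0 ⟶ M.model 0 := ContMap.mk (fun _ => x) (continuous_const x)
  let r : M.model 0 ⟶ N.model 0 := ContMap.mk (fun _ => y) (continuous_const y)
  -- The `0`-simplex is a single point, so the composite is the identity in degree zero, as acyclic
  -- models require.
  have hrq : r ≫ q = 𝟙 _ := ContMap.ext (funext fun z => by
    obtain ⟨x⟩ := x
    obtain ⟨z⟩ := z
    exact congrArg ULift.up (Subsingleton.elim (α := stdSimplex ℝ (Fin 1)) x z))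
  obtain ⟨p, ⟨h⟩, hp⟩ := simplicial_dimension .I point.{u}
  obtain ⟨p', ⟨h'⟩, hp'⟩ := cubical_dimension .I point.{u}
  obtain ⟨φ, hφ⟩ := M.exists_chainMap_of_isContractible N q
    (M.hom_ext fun σ => (simplicialChains_d_simplexClass_of_unique .I _
      ⟨fun _ => default, continuous_const _⟩).trans (if_pos (by simp)))
    (cubical_homotopy .I) (exactInPosDegrees_of_homotopy h' hp') isContractible_simplex
  obtain ⟨ψ, hψ⟩ := N.exists_chainMap_of_isContractible M r
    (N.hom_ext fun σ => (congrArg _ (cubeClass_eq_zero_of_unique .I _ _)).trans (map_zero _))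
    (simplicial_homotopy .I) (exactInPosDegrees_of_homotopy h hp) isContractible_cube
  refine ⟨φ, ψ, M.naturallyHomotopic (fun X => M.hom_ext fun σ => ?_)
    fun n => exactInPosDegrees_simplicialChains (isContractible_simplex n)⟩
  change M.gen σ = (ψ.app X).f 0 ((φ.app X).f 0 (M.gen σ))
  rw [hφ, hψ, ← Category.assoc, hrq, Category.id_comp]

theorem isChainTheory_simplicialChains_I : IsChainTheory.{u} .I (simplicialChains .I) := by
  obtain ⟨φ, ψ, h⟩ := exists_simplicial_cubical.{u}
  exact (simplicialModel .I).isChainTheory (simplicial_homotopy _) (simplicial_dimension _)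
    fun _ _ _ hAB n => (smallApprox_cubicalChains_I hAB n).transfer φ ψ h

theorem isChainTheory_simplicialChains (J : IntervalKind) :
    IsChainTheory.{u} J (simplicialChains J) := by
  cases J
  · exact isChainTheory_simplicialChains_I
  · exact isChainTheory_simplicialChains_J1
  · exact isChainTheory_simplicialChains_Jplus

theorem isChainTheory_cubicalChains (J : IntervalKind) :
    IsChainTheory.{u} J (cubicalChains J) := by
  cases J
  · exact isChainTheory_cubicalChains_I
  · exact isChainTheory_cubicalChains_J1
  · exact isChainTheory_cubicalChains_Jplus

end CechClosure

theorem mainTheorem7 (J : CechClosure.IntervalKind) :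
    (∃ bd, CechClosure.IsHomologyTheory J
      (CechClosure.relativeHomology.{u} (CechClosure.simplicialChains J)) bd) ∧
    (∃ bd, CechClosure.IsHomologyTheory J
      (CechClosure.relativeHomology.{u} (CechClosure.cubicalChains J)) bd) ∧
    ∀ G : AddCommGrpCat.{u},
      (∃ cobd, CechClosure.IsCohomologyTheory J
        (CechClosure.relativeCohomology (CechClosure.simplicialChains J) G) cobd) ∧
      (∃ cobd, CechClosure.IsCohomologyTheory J
        (CechClosure.relativeCohomology (CechClosure.cubicalChains J) G) cobd) :=
  have hS := CechClosure.isChainTheory_simplicialChains J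
  have hC := CechClosure.isChainTheory_cubicalChains J
  ⟨⟨_, hS.isHomologyTheory⟩, ⟨_, hC.isHomologyTheory⟩,
    fun G => ⟨⟨_, hS.isCohomologyTheory G⟩, ⟨_, hC.isCohomologyTheory G⟩⟩⟩
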